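/- **Conventions.** All rings $R$ below are commutative and Noetherian. For a ring $A$, $A\text{-mod}$ is the category of finitely generated left $A$-modules. A *finite* $R$-algebra is an associative unital $R$-algebra that is a finitely generated $R$-module; it is *finite projective* if it is moreover projective over $R$. *Highest weight categories.* Let $\mathcal C$ be an $R$-linear abelian category equivalent ($R$-linearly) to $A\text{-mod}$ for a finite projective $R$-algebra $A$, let $\mathcal T$ be a finite poset and $\Delta(\tau)\in\mathcal C$, $\tau\in\mathcal T$, objects (called standard). For $\mathcal T'\subset\mathcal T$, an object is $\mathcal T'$-standardly filtered if it has a finite filtration with successive quotients of the form $\Delta(\tau)\otimes_R P$ with $\tau\in\mathcal T'$ and $P$ a finitely generated projective $R$-module; $\mathcal C^{\Delta}$ is the full subcategory of $\mathcal T$-standardly filtered objects. $\mathcal C$ is a highest weight category over $R$ if (i) each $\Delta(\tau)$ is flat over $R$; (ii) $R\to\operatorname{End}(\Delta(\tau))$ is an isomorphism; (iii) $\operatorname{Hom}(\Delta(\tau_1),\Delta(\tau_2))\ne0$ implies $\tau_1\le\tau_2$; (iv) every nonzero $M$ admits a nonzero morphism from some $\Delta(\tau)$; (v) for each $\tau$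 there is a projective object with an epimorphism onto $\Delta(\tau)$ whose kernel is $\{\tau'>\tau\}$-standardly filtered. An equivalence of highest weight categories is an $R$-linear equivalence that sends standard objects to standard objects. *Base change.* Let $\underline{\mathcal C}$ be an $R$-linear abelian category equivalent to $\underline A\text{-mod}$ for a finite $R$-algebra $\underline A$, and $\pi:\mathcal C\to\underline{\mathcal C}$ a right exact $R$-linear functor, so that $\pi=B\otimes_A\bullet$ for an $\underline A$-$A$-bimodule $B$. For a Noetherian $R$-algebra $R'$ put $A_{R'}=R'\otimes_RA$, $\mathcal C_{R'}=A_{R'}\text{-mod}$ (a highest weight category over $R'$ with standard objects $R'\otimes_R\Delta(\tau)$), $\underline{\mathcal C}_{R'}=\underline A_{R'}\text{-mod}$ and $\pi_{R'}=(R'\otimes_RB)\otimes_{A_{R'}}\bullet$. *RS functors.* Let $R$ be a normal Noetherian domain with fraction field $\mathbb F$; for a prime $\mathfrak p$ let $\kappa(\mathfrak p)=\operatorname{Frac}(R/\mathfrak p)$. The functor $\pi$ is a Rouquier–Soergel functor if: (RS1) $\pi$ is exact on $\mathcal C^\Delta$; (RS2) $\pi(\Delta(\tau))$ is projective over $R$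 for all $\tau$; (RS3) $\mathcal C_{\mathbb F}$ and $\underline{\mathcal C}_{\mathbb F}$ are split semisimple and $\pi_{\mathbb F}$ is an equivalence between them; (RS4) for every prime $\mathfrak p$ of height $\le2$ the functor $\pi_{\kappa(\mathfrak p)}$ is faithful on $\mathcal C_{\kappa(\mathfrak p)}^\Delta$. **Theorem.** Let $R$ be a regular local ring, let $\mathcal C^1,\mathcal C^2$ be highest weight categories over $R$ with finite posets $\mathcal T^1,\mathcal T^2$ and standard objects $\Delta^1(\tau),\Delta^2(\tau)$, let $\underline{\mathcal C}$ be as above, and let $\pi^i:\mathcal C^i\to\underline{\mathcal C}$ ($i=1,2$) be Rouquier–Soergel functors. Suppose that (a) there is an order-preserving bijection $\iota:\mathcal T^1\to\mathcal T^2$ with $\pi^1(\Delta^1(\tau))\cong\pi^2(\Delta^2(\iota(\tau)))$ for all $\tau\in\mathcal T^1$; (b) for every prime $\mathfrak p\subset R$ of height $1$, the essential images of $\mathcal C^{1,\Delta}_{R_{\mathfrak p}}$ under $\pi^1_{R_{\mathfrak p}}$ and of $\mathcal C^{2,\Delta}_{R_{\mathfrak p}}$ under $\pi^2_{R_{\mathfrak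 p}}$ in $\underline{\mathcal C}_{R_{\mathfrak p}}$ coincide. Then there is an equivalence of highest weight categories $\Phi:\mathcal C^1\to\mathcal C^2$ with an isomorphism $\theta:\pi^2\circ\Phi\cong\pi^1$. It is unique: for any other such pair $(\Psi,\eta)$ there is a unique isomorphism of functors $\alpha:\Phi\cong\Psi$ compatible with $\theta$ and $\eta$, i.e. $\eta\circ\pi^2(\alpha)=\theta$. Every such equivalence automatically sends $\Delta^1(\tau)$ to an object isomorphic to $\Delta^2(\iota(\tau))$, for all $\tau\in\mathcal T^1$. -/

import Mathlib

open CategoryTheory CategoryTheory.Limits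
open scoped TensorProduct

universe u v w v' w' v₁ w₁ v₂ w₂ v₃ w₃ t₁ t₂

noncomputable section

namespace HighestWeight

/-! ### Tensor product with a bimodule over noncommutative rings -/

section BimoduleTensor

variable (A' A B : Type u) [Ring A'] [Ring A] [AddCommGroup B] [Module A' B] [Module Aᵐᵒᵖ B]
variable (M : Type u) [AddCommGroup M] [Module A M]

/-- The relations `b a ⊗ m = b ⊗ a m` in `B ⊗_ℤ M`. -/
def tensorRel : Submodule A' (B ⊗[ℤ] M) :=
  Submodule.span A' {x | ∃ (b : B) (a : A) (m : M),
    x = (MulOpposite.op a • b) ⊗ₜ[ℤ] m - b ⊗ₜ[ℤ] (a • m)}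

/-- `B ⊗_A M` for an `A'`-`A`-bimodule `B` and a left `A`-module `M`; a left `A'`-module. -/
abbrev BTensor : Type u := (B ⊗[ℤ] M) ⧸ tensorRel A' A B M

variable {M} {N : Type u} [AddCommGroup N] [Module A N]

/-- `id_B ⊗ f` for an `A`-linear map `f`. -/
def BTensor.map (f : M →ₗ[A] N) : BTensor A' A B M →ₗ[A'] BTensor A' A B N :=
  Submodule.mapQ _ _
    (TensorProduct.AlgebraTensorModule.lTensor A' B (f.toAddMonoidHom.toIntLinearMap)) (by
      rw [tensorRel, Submodule.span_le]
      rintro _ ⟨b, a, m, rfl⟩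
      refine Submodule.subset_span ⟨b, a, f m, ?_⟩
      simp)

theorem BTensor.map_mk_tmul (f : M →ₗ[A] N) (b : B) (m : M) :
    BTensor.map A' A B f (Submodule.Quotient.mk (b ⊗ₜ[ℤ] m)) =
      Submodule.Quotient.mk (b ⊗ₜ[ℤ] f m) := rfl

theorem BTensor.hom_ext {X : Type u} [AddCommGroup X] [Module A' X]
    {f g : BTensor A' A B M →ₗ[A'] X}
    (h : ∀ (b : B) (m : M), f (Submodule.Quotient.mk (b ⊗ₜ[ℤ] m)) =
      g (Submodule.Quotient.mk (b ⊗ₜ[ℤ] m))) : f = g := by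
  refine LinearMap.ext fun x => ?_
  obtain ⟨x, rfl⟩ := Submodule.Quotient.mk_surjective _ x
  induction x using TensorProduct.induction_on with
  | zero => simp
  | tmul b m => exact h b m
  | add x y hx hy => rw [Submodule.Quotient.mk_add, map_add, map_add, hx, hy]

theorem BTensor.finite [SMulCommClass A' Aᵐᵒᵖ B] [Module.Finite A' B] [Module.Finite A M] :
    Module.Finite A' (BTensor A' A B M) := by
  classical
  obtain ⟨s, hs⟩ := Module.Finite.fg_top (R := A') (M := B)
  obtain ⟨t, ht⟩ := Module.Finite.fg_top (R := A) (M := M)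
  let q : B → M → BTensor A' A B M := fun b m => Submodule.Quotient.mk (b ⊗ₜ[ℤ] m)
  let S : Submodule A' (BTensor A' A B M) :=
    Submodule.span A' ((fun p : B × M => q p.1 p.2) '' (s ×ˢ t : Finset (B × M)))
  have key : ∀ m ∈ t, ∀ b : B, q b m ∈ S := by
    intro m hm b
    have hb : b ∈ Submodule.span A' (s : Set B) := hs ▸ Submodule.mem_top
    induction hb using Submodule.span_induction with
    | mem x hx => exact Submodule.subset_span ⟨(x, m), by simpa using ⟨hx, hm⟩, rfl⟩
    | zero => simp [q]
    | add x y _ _ hx hy =>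
      have : q (x + y) m = q x m + q y m := by
        simp only [q, TensorProduct.add_tmul, Submodule.Quotient.mk_add]
      rw [this]; exact S.add_mem hx hy
    | smul a x _ hx =>
      have : q (a • x) m = a • q x m := by
        simp only [q, ← Submodule.Quotient.mk_smul, TensorProduct.smul_tmul']
      rw [this]; exact S.smul_mem a hx
  have key2 : ∀ (m : M) (b : B), q b m ∈ S := by
    intro m
    have hm : m ∈ Submodule.span A (t : Set M) := ht ▸ Submodule.mem_top
    induction hm using Submodule.span_induction with
    | mem x hx => exact key x (by simpa using hx)
    | zero => intro b; simp [q]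
    | add x y _ _ hx hy =>
      intro b
      have : q b (x + y) = q b x + q b y := by
        simp only [q, TensorProduct.tmul_add, Submodule.Quotient.mk_add]
      rw [this]; exact S.add_mem (hx b) (hy b)
    | smul a x _ hx =>
      intro b
      have : q b (a • x) = q (MulOpposite.op a • b) x := by
        refine ((Submodule.Quotient.eq _).2 ?_).symm
        exact Submodule.subset_span ⟨b, a, x, rfl⟩
      rw [this]; exact hx _
  refine ⟨⟨Finset.image (fun p : B × M => q p.1 p.2) (s ×ˢ t), ?_⟩⟩
  rw [Finset.coe_image]
  refine Submodule.eq_top_iff'.2 fun x => ?_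
  obtain ⟨x, rfl⟩ := Submodule.Quotient.mk_surjective _ x
  change _ ∈ S
  induction x using TensorProduct.induction_on with
  | zero => simp
  | tmul b m => exact key2 m b
  | add x y hx hy => rw [Submodule.Quotient.mk_add]; exact S.add_mem hx hy

/-- The functor `B ⊗_A -` on finitely generated modules, for an `A'`-`A`-bimodule `B` that is
finitely generated over `A'`. -/
def tensorFunctor [SMulCommClass A' Aᵐᵒᵖ B] [Module.Finite A' B] :
    FGModuleCat.{u} A ⥤ FGModuleCat.{u} A' where
  obj M :=
    haveI := BTensor.finite A' A B (M := M)
    FGModuleCat.of A' (BTensor A' A B M)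
  map {M N} f :=
    haveI := BTensor.finite A' A B (M := M)
    haveI := BTensor.finite A' A B (M := N)
    FGModuleCat.ofHom (BTensor.map A' A B f.hom.hom)
  map_id M := by
    ext1
    exact BTensor.hom_ext A' A B fun b m => rfl
  map_comp f g := by
    ext1
    exact BTensor.hom_ext A' A B fun b m => rfl

end BimoduleTensor

/-! ### Base change of modules and bimodules -/

section BaseChange

variable (R : Type u) [CommRing R] (R' : Type u) [CommRing R'] [Algebra R R']

/-- `R' ⊗_R M`, to be regarded as a module over `R' ⊗_R A` when `M` is an `A`-module. -/
def BC (M : Type u) [AddCommGroup M] [Module R M] : Type u := R' ⊗[R] M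

variable (A : Type u) [Ring A] [Algebra R A]
variable (M : Type u) [AddCommGroup M] [Module R M]

instance : AddCommGroup (BC R R' M) := inferInstanceAs (AddCommGroup (R' ⊗[R] M))

instance : Module R' (BC R R' M) := inferInstanceAs (Module R' (R' ⊗[R] M))

/-- The element `r ⊗ m` of `R' ⊗_R M`. -/
def BC.tmul {M : Type u} [AddCommGroup M] [Module R M] (r : R') (m : M) : BC R R' M :=
  r ⊗ₜ[R] m

theorem BC.induction_on {M : Type u} [AddCommGroup M] [Module R M] {p : BC R R' M → Prop}
    (z : BC R R' M) (zero : p 0) (tmul : ∀ s m, p (BC.tmul R R' s m))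
    (add : ∀ x y, p x → p y → p (x + y)) : p z :=
  TensorProduct.induction_on (motive := p) z zero tmul add

/-- The action of `R' ⊗_R A` on `R' ⊗_R M`, as an `R'`-algebra homomorphism. -/
def BC.actHom [Module A M] [IsScalarTower R A M] :
    R' ⊗[R] A →ₐ[R'] Module.End R' (R' ⊗[R] M) :=
  (Module.endTensorEndAlgHom (R := R) (S := R') (A := R') (M := R') (N := M)).comp
    (Algebra.TensorProduct.map (Algebra.lsmul R' R' R') (Algebra.lsmul R R M))

theorem BC.actHom_tmul [Module A M] [IsScalarTower R A M] (r s : R') (a : A) (m : M) :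
    BC.actHom R R' A M (r ⊗ₜ[R] a) (s ⊗ₜ[R] m) = (r * s) ⊗ₜ[R] (a • m) := rfl

/-- `(r ⊗ a) • (s ⊗ m) = r s ⊗ a m`. -/
instance BC.leftModule [Module A M] [IsScalarTower R A M] : Module (R' ⊗[R] A) (BC R R' M) :=
  Module.compHom (R' ⊗[R] M) (BC.actHom R R' A M).toRingHom

theorem BC.smul_tmul [Module A M] [IsScalarTower R A M] (r s : R') (a : A) (m : M) :
    (r ⊗ₜ[R] a : R' ⊗[R] A) • BC.tmul R R' s m = BC.tmul R R' (r * s) (a • m) := rfl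

/-- The identification of `(R' ⊗_R A)ᵐᵒᵖ` with `R' ⊗_R Aᵐᵒᵖ`. -/
def BC.opHom : (R' ⊗[R] A)ᵐᵒᵖ →ₐ[R] R' ⊗[R] Aᵐᵒᵖ :=
  (Algebra.TensorProduct.map ((AlgEquiv.toOpposite R R').symm : R'ᵐᵒᵖ →ₐ[R] R')
    (AlgHom.id R Aᵐᵒᵖ)).comp
    ((Algebra.TensorProduct.opAlgEquiv R R R' A).symm : (R' ⊗[R] A)ᵐᵒᵖ →ₐ[R] R'ᵐᵒᵖ ⊗[R] Aᵐᵒᵖ)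

/-- `(s ⊗ m) • (r ⊗ a) = r s ⊗ m a`. -/
instance BC.rightModule [Module Aᵐᵒᵖ M] [IsScalarTower R Aᵐᵒᵖ M] :
    Module (R' ⊗[R] A)ᵐᵒᵖ (BC R R' M) :=
  Module.compHom (BC R R' M) (BC.opHom R R' A).toRingHom

theorem BC.op_smul_tmul [Module Aᵐᵒᵖ M] [IsScalarTower R Aᵐᵒᵖ M] (r s : R') (a : A) (m : M) :
    MulOpposite.op (r ⊗ₜ[R] a : R' ⊗[R] A) • BC.tmul R R' s m =
      BC.tmul R R' (r * s) (MulOpposite.op a • m) := rfl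

instance BC.smulCommClass (A' : Type u) [Ring A'] [Algebra R A']
    [Module A' M] [IsScalarTower R A' M] [Module Aᵐᵒᵖ M] [IsScalarTower R Aᵐᵒᵖ M]
    [SMulCommClass A' Aᵐᵒᵖ M] :
    SMulCommClass (R' ⊗[R] A') (R' ⊗[R] A)ᵐᵒᵖ (BC R R' M) where
  smul_comm x y z := by
    induction y using MulOpposite.rec' with
    | _ y =>
    induction x using TensorProduct.induction_on with
    | zero => simp
    | add x₁ x₂ h₁ h₂ => rw [add_smul, add_smul, smul_add, h₁, h₂]
    | tmul r a' =>
    induction y using TensorProduct.induction_on with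
    | zero => simp
    | add y₁ y₂ h₁ h₂ => rw [MulOpposite.op_add, add_smul, add_smul, smul_add, h₁, h₂]
    | tmul r' a =>
    induction z using BC.induction_on with
    | zero => simp
    | add z₁ z₂ h₁ h₂ => rw [smul_add, smul_add, smul_add, smul_add, h₁, h₂]
    | tmul s m =>
      rw [BC.op_smul_tmul, BC.smul_tmul, BC.smul_tmul, BC.op_smul_tmul, smul_comm a',
        mul_left_comm]

instance BC.isScalarTower [Module A M] [IsScalarTower R A M] :
    IsScalarTower R' (R' ⊗[R] A) (BC R R' M) where
  smul_assoc r x y := by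
    change BC.actHom R R' A M (r • x) y = r • BC.actHom R R' A M x y
    rw [map_smul]; rfl

theorem BC.finite [Module A M] [IsScalarTower R A M] [Module.Finite R M] :
    Module.Finite (R' ⊗[R] A) (BC R R' M) :=
  haveI : Module.Finite R' (BC R R' M) := inferInstanceAs (Module.Finite R' (R' ⊗[R] M))
  Module.Finite.of_restrictScalars_finite R' (R' ⊗[R] A) (BC R R' M)

end BaseChange

/-! ### Linear structure on modules over an algebra -/

/-- For an algebra `A` over a commutative ring `k`, the category of `A`-modules is `k`-linear:
`(r • f) x = r • f x`. -/
instance (priority := 50) algebraLinear (k A : Type u) [CommRing k] [Ring A] [Algebra k A] :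
    Linear k (ModuleCat.{u} A) where
  homModule M N :=
    letI : Module k N := Module.restrictScalars k A N
    haveI : IsScalarTower k A N := IsScalarTower.restrictScalars k A N
    ModuleCat.homAddEquiv.module k
  smul_comp M N P r f g := by
    ext x
    change g.hom (algebraMap k A r • f.hom x) = algebraMap k A r • g.hom (f.hom x)
    simp
  comp_smul M N P f r g := by
    ext x
    rfl

/-! ### Standardly filtered objects and highest weight categories -/

section Category

variable (R : Type u) [CommRing R] {C : Type v} [Category.{w} C] [Preadditive C] [Linear R C]

/-- `X` is the tensor product `D ⊗_R P` of an object `D` of an `R`-linear category with an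
`R`-module `P`: morphisms `X ⟶ Y` are the same as `R`-linear maps `P → Hom (D, Y)`. -/
def IsTensorObj (D X : C) (P : Type u) [AddCommGroup P] [Module R P] : Prop :=
  ∃ t : P →ₗ[R] (D ⟶ X), ∀ Y : C,
    Function.Bijective fun f : X ⟶ Y => (Linear.rightComp R D f).comp t

/-- The `S`-standardly filtered objects: those admitting a finite filtration with successive
quotients `Δ τ ⊗_R P`, where `τ ∈ S` and `P` is a finitely generated projective `R`-module. -/
inductive StdFiltered {T : Type*} (Δ : T → C) (S : Set T) : C → Prop
  | zero (X : C) (hX : IsZero X) : StdFiltered Δ S X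
  | ext (E : ShortComplex C) (hE : E.ShortExact) (h₁ : StdFiltered Δ S E.X₁)
      (τ : T) (hτ : τ ∈ S) (P : Type u) [AddCommGroup P] [Module R P] [Module.Finite R P]
      [Module.Projective R P] (h₃ : IsTensorObj R (Δ τ) E.X₃ P) : StdFiltered Δ S E.X₂

/-- `M` is projective over `R`, tested on the Hom modules from projective objects; in a category
of finitely generated `A`-modules (`A` a finite `R`-algebra) this says that the underlying
`R`-module is projective. -/
def ProjectiveOver (M : C) : Prop := ∀ P : C, Projective P → Module.Projective R (P ⟶ M)

/-- `M` is flat over `R`, tested on the Hom modules from projective objects; in a category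
of finitely generated `A`-modules (`A` a finite `R`-algebra) this says that the underlying
`R`-module is flat. -/
def FlatOver (M : C) : Prop := ∀ P : C, Projective P → Module.Flat R (P ⟶ M)

/-- The axioms of a highest weight category over `R` with poset `T` and standard objects `Δ`,
for an `R`-linear abelian category. -/
structure IsHighestWeight {T : Type*} [PartialOrder T] (Δ : T → C) : Prop where
  flat : ∀ τ, FlatOver R (Δ τ)
  end_eq : ∀ τ, Function.Bijective fun r : R => r • 𝟙 (Δ τ)
  le_of_hom : ∀ (τ₁ τ₂ : T) (f : Δ τ₁ ⟶ Δ τ₂), f ≠ 0 → τ₁ ≤ τ₂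
  exists_hom : ∀ M : C, ¬ IsZero M → ∃ (τ : T) (f : Δ τ ⟶ M), f ≠ 0
  exists_proj : ∀ τ, ∃ E : ShortComplex C, E.ShortExact ∧ Projective E.X₂ ∧
    Nonempty (E.X₃ ≅ Δ τ) ∧ StdFiltered R Δ (Set.Ioi τ) E.X₁

/-- Split semisimple: every object is a finite direct sum of simple objects, and the endomorphism
ring of every simple object is the base ring (here a field). -/
def IsSplitSemisimple (K : Type u) [CommRing K] (C : Type v) [Category.{w} C] [Preadditive C]
    [Linear K C] : Prop :=
  (∀ X : C, ∃ (n : ℕ) (S : Fin n → C) (b : Bicone S),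
    (∀ i, Simple (S i)) ∧ Nonempty b.IsBilimit ∧ Nonempty (b.pt ≅ X)) ∧
  ∀ S : C, Simple S → Function.Bijective fun r : K => r • 𝟙 S

/-- An identification of the `R`-linear category `C` with the category of finitely generated
modules over an `R`-algebra `alg` that is finitely generated as an `R`-module. -/
structure ModuleModel (R : Type u) [CommRing R] (C : Type v) [Category.{w} C] [Preadditive C]
    [Linear R C] where
  alg : Type u
  [ring : Ring alg]
  [algebra : Algebra R alg]
  [finite : Module.Finite R alg]
  equiv : C ≌ FGModuleCat.{u} alg
  [additive : equiv.functor.Additive]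
  [linear : equiv.functor.Linear R]

attribute [instance] ModuleModel.ring ModuleModel.algebra ModuleModel.finite
  ModuleModel.additive ModuleModel.linear

end Category

/-! ### Base change of categories, objects and functors -/

section Models

variable {R : Type u} [CommRing R] {C : Type v} [Category.{w} C] [Preadditive C] [Linear R C]

/-- The `R`-module underlying an object of `C`. -/
instance ModuleModel.moduleR (M : ModuleModel R C) (X : FGModuleCat.{u} M.alg) : Module R X :=
  Module.restrictScalars R M.alg X

instance ModuleModel.towerR (M : ModuleModel R C) (X : FGModuleCat.{u} M.alg) :
    IsScalarTower R M.alg X :=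
  IsScalarTower.restrictScalars R M.alg X

instance ModuleModel.finiteR (M : ModuleModel R C) (X : FGModuleCat.{u} M.alg) :
    Module.Finite R X :=
  Module.Finite.trans M.alg X

/-- The base change `C_{R'}`: finitely generated modules over `R' ⊗_R A`. -/
abbrev ModuleModel.Cat (M : ModuleModel R C) (R' : Type u) [CommRing R'] [Algebra R R'] :
    Type (u + 1) :=
  FGModuleCat.{u} (R' ⊗[R] M.alg)

/-- The base change `R' ⊗_R X` of an object `X` of `C`. -/
def ModuleModel.obj (M : ModuleModel R C) (R' : Type u) [CommRing R'] [Algebra R R'] (X : C) :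
    M.Cat R' :=
  haveI := BC.finite R R' M.alg (M.equiv.functor.obj X)
  FGModuleCat.of (R' ⊗[R] M.alg) (BC R R' (M.equiv.functor.obj X))

end Models

section Functor

variable {R : Type u} [CommRing R] {C : Type v} [Category.{w} C] [Preadditive C] [Linear R C]
  {D : Type v'} [Category.{w'} D] [Preadditive D] [Linear R D]
  (M : ModuleModel R C) (N : ModuleModel R D) (F : C ⥤ D) [F.Additive] [F.Linear R]

/-- The functor `F`, seen as a functor between categories of modules. -/
abbrev modelFunctor : FGModuleCat.{u} M.alg ⥤ FGModuleCat.{u} N.alg :=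
  M.equiv.inverse ⋙ F ⋙ N.equiv.functor

/-- Right multiplication by `a`, an endomorphism of the left regular module. -/
def rightMul (A : Type u) [Ring A] (a : A) : FGModuleCat.of A A ⟶ FGModuleCat.of A A :=
  ObjectProperty.homMk (ModuleCat.ofHom (LinearMap.toSpanSingleton A A a))

theorem rightMul_one (A : Type u) [Ring A] : rightMul A 1 = 𝟙 _ :=
  FGModuleCat.hom_ext (LinearMap.ext fun x => mul_one (M := A) x)

theorem rightMul_zero (A : Type u) [Ring A] : rightMul A 0 = 0 :=
  FGModuleCat.hom_ext (LinearMap.ext fun x => mul_zero (M₀ := A) x)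

theorem rightMul_mul (A : Type u) [Ring A] (a b : A) :
    rightMul A (a * b) = rightMul A a ≫ rightMul A b :=
  FGModuleCat.hom_ext (LinearMap.ext fun x => (mul_assoc (G := A) x a b).symm)

theorem rightMul_add (A : Type u) [Ring A] (a b : A) :
    rightMul A (a + b) = rightMul A a + rightMul A b :=
  FGModuleCat.hom_ext (LinearMap.ext fun x => mul_add (R := A) x a b)

theorem rightMul_smul (k A : Type u) [CommRing k] [Ring A] [Algebra k A] (r : k) (a : A) :
    rightMul A (r • a) = r • rightMul A a :=
  FGModuleCat.hom_ext (LinearMap.ext fun x =>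
    (by rw [Algebra.smul_def, ← mul_assoc, ← mul_assoc, Algebra.commutes] :
      (x : A) * (r • a) = algebraMap k A r * (x * a)))

/-- The bimodule `B` representing `F`: the value of `F` on the left regular module, with the right
action induced from right multiplications. -/
def bimodule : FGModuleCat.{u} N.alg := (modelFunctor M N F).obj (FGModuleCat.of M.alg M.alg)

/-- The right action of `A` on the bimodule. -/
def bimoduleAct : M.algᵐᵒᵖ →+* Module.End N.alg (bimodule M N F) where
  toFun a := ((modelFunctor M N F).map (rightMul M.alg a.unop)).hom.hom
  map_one' := by
    rw [MulOpposite.unop_one, rightMul_one]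
    exact congrArg (fun f : bimodule M N F ⟶ bimodule M N F => f.hom.hom)
      ((modelFunctor M N F).map_id _)
  map_mul' a b := by
    rw [MulOpposite.unop_mul, rightMul_mul]
    exact congrArg (fun f : bimodule M N F ⟶ bimodule M N F => f.hom.hom)
      ((modelFunctor M N F).map_comp _ _)
  map_zero' := by
    rw [MulOpposite.unop_zero, rightMul_zero]
    exact congrArg (fun f : bimodule M N F ⟶ bimodule M N F => f.hom.hom)
      ((modelFunctor M N F).map_zero _ _)
  map_add' a b := by
    rw [MulOpposite.unop_add, rightMul_add]
    exact congrArg (fun f : bimodule M N F ⟶ bimodule M N F => f.hom.hom)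
      ((modelFunctor M N F).map_add)

instance : Module M.algᵐᵒᵖ (bimodule M N F) := Module.compHom _ (bimoduleAct M N F)

theorem bimodule_op_smul (a : M.alg) (b : bimodule M N F) :
    MulOpposite.op a • b = ((modelFunctor M N F).map (rightMul M.alg a)).hom.hom b := rfl

instance : SMulCommClass N.alg M.algᵐᵒᵖ (bimodule M N F) where
  smul_comm a' a b := ((bimoduleAct M N F a).map_smul a' b).symm

/-- The left and right actions of `R` on the bimodule coincide. -/
instance : IsScalarTower R M.algᵐᵒᵖ (bimodule M N F) where
  smul_assoc r a b := by
    change ((modelFunctor M N F).map (rightMul M.alg (r • a.unop))).hom.hom b = _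
    rw [rightMul_smul, Functor.map_smul]
    rfl

/-- The base change `F_{R'} = (R' ⊗_R B) ⊗_{R' ⊗_R A} -` of `F`. -/
def baseChangeFunctor (R' : Type u) [CommRing R'] [Algebra R R'] : M.Cat R' ⥤ N.Cat R' :=
  haveI := BC.finite R R' N.alg (bimodule M N F)
  tensorFunctor (R' ⊗[R] N.alg) (R' ⊗[R] M.alg) (BC R R' (bimodule M N F))

variable {T : Type*} (Δ : T → C)

/-- The standardly filtered objects of `C_{R'}`, whose standard objects are `R' ⊗_R Δ τ`. -/
def StdFilteredBC (R' : Type u) [CommRing R'] [Algebra R R'] (X : M.Cat R') : Prop :=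
  StdFiltered R' (fun τ => M.obj R' (Δ τ)) Set.univ X

/-- The essential image in `D_{R'}` of the standardly filtered objects of `C_{R'}`. -/
def stdImage (R' : Type u) [CommRing R'] [Algebra R R'] : ObjectProperty (N.Cat R') :=
  fun Y => ∃ X : M.Cat R', StdFilteredBC M Δ R' X ∧
    Nonempty ((baseChangeFunctor M N F R').obj X ≅ Y)

/-- `F_{R'}` is faithful on standardly filtered objects. -/
def NegOneFaithful (R' : Type u) [CommRing R'] [Algebra R R'] : Prop :=
  ∀ X Y : M.Cat R', StdFilteredBC M Δ R' X → StdFilteredBC M Δ R' Y →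
    Function.Injective fun f : X ⟶ Y => (baseChangeFunctor M N F R').map f

/-- Rouquier–Soergel functors (for a right exact `R`-linear functor `F` on a highest weight
category over a normal Noetherian domain `R`). -/
structure IsRouquierSoergel : Prop where
  exact : ∀ E : ShortComplex C, E.ShortExact → StdFiltered R Δ Set.univ E.X₁ →
    StdFiltered R Δ Set.univ E.X₂ → StdFiltered R Δ Set.univ E.X₃ → (E.map F).ShortExact
  projective : ∀ τ, ProjectiveOver R (F.obj (Δ τ))
  generic : IsSplitSemisimple (FractionRing R) (M.Cat (FractionRing R)) ∧
    IsSplitSemisimple (FractionRing R) (N.Cat (FractionRing R)) ∧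
    (baseChangeFunctor M N F (FractionRing R)).IsEquivalence
  faithful : ∀ (p : Ideal R) [p.IsPrime], p.height ≤ 2 → NegOneFaithful M N F Δ p.ResidueField

end Functor

/-- An equivalence of highest weight categories: an `R`-linear equivalence sending standard
objects to standard objects. -/
def IsHWEquivalence (R : Type u) [CommRing R] {C₁ C₂ : Type*} [Category C₁] [Category C₂]
    [Preadditive C₁] [Preadditive C₂] [Linear R C₁] [Linear R C₂] {T₁ T₂ : Type*}
    (Δ₁ : T₁ → C₁) (Δ₂ : T₂ → C₂) (Φ : C₁ ≌ C₂) : Prop :=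
  Φ.functor.Additive ∧ Φ.functor.Linear R ∧
    ∀ τ, ∃ τ', Nonempty (Φ.functor.obj (Δ₁ τ) ≅ Δ₂ τ')

end HighestWeight

end

/-! Write the three categories as modules over `A₁`, `A₂`, `A'` and the functors as `Gᵢ = Bᵢ ⊗ -`.
The aim is a finite projective generator `Q` over `A₂` with `G₂ Q ≅ B₁`; full faithfulness then
gives `End Q = End B₁ = A₁ᵒᵖ`, and `Q ⊗ -` is the required equivalence.

Detection. A regular local ring is a domain of full depth. Hence associated primes of `R/(x)`, for
`x ≠ 0`, have height at most 1, and those of `R/(x, y)`, for `y` regular modulo `x`, have height at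
most 2 (`assHeightLE_span_singleton`, `assHeightLE_span_pair`). Faithfulness over the residue field
of a prime `q` of height at most 2 makes `x ↦ (b ⊗ x)_b` on a standard module injective at `q`,
hence split up to a multiplier outside `q`. Consequently, for such ideals `I`, an element `x` of a
filtered module `X` lies in `I X` once all `b ⊗ x` lie in `I (G X)` (`IsRS.detects`). Taking `I = 0`
and `I = (s)`, and using the equivalence over the fraction field, one finds that `X → Hom(B, G X)`
is bijective, so `G` is bijective on homomorphisms into `X` (`IsRS.isGood`).

Extensions. Let `M` be an extension of `G Δ` by `G Y` with `Y` filtered. It comes from an extension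
of `Δ` by `Y` as soon as every map `b ↦ b ⊗ x` lifts to `M` (`exists_extension_of_lifts`). For fixed
`x`, the multipliers `s` for which `s (b ⊗ x)` lifts form an ideal. If it lies in no prime of height
at most 1, it contains `s ≠ 0` and some `t` regular modulo `s`; detection for `I = (s, t)` adjusts
the two lifts until one is divisible by `s`, and the quotient lifts `b ⊗ x` itself
(`IsRS.exists_lift`). So only primes of height 0 and 1 matter: the first is handled by the generic
equivalence, the second by the agreement of images (`IsRS.exists_lift_prime`).

Transfer. By induction on the length of a filtration, with a minimal label moved to the top, every
filtered `A₁`-module `X` has a filtered counterpart `Y` over `A₂` with `G₁ X ≅ G₂ Y`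
(`IsRS.exists_transfer`). Transferring projective covers of standard modules in both directions and
lifting gives maps `G₁ P₁ → G₂ P₂ → G₁ P₁` whose composite is the identity up to maps into the
kernel of `P₁ → Δ`. Descending induction on the label then makes `G₁ P₁` a retract of the `G₂`-image
of a projective (`IsRS.isCovered_Δ`), and `B₁` becomes such an image as well (`IsRS.isImage_B`).

Uniqueness. Projective objects are retracts of filtered ones, so the functor is bijective on
morphisms into them. A transformation of right exact functors is determined by its value on the
regular module, and an equivalence sends this to a projective (`existsUnique_natIso`). Standard
objects are matched by the same full faithfulness (`nonempty_iso_standard`). -/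

section

/-! ### Depth and heights of associated primes over Noetherian local rings. -/

open IsLocalRing RingTheory.Sequence


/-- There is a weakly regular sequence of length `n` on `M` inside the maximal ideal. -/
def HasRegularSequence (R : Type u) [CommRing R] [IsLocalRing R] (n : ℕ) (M : Type v)
    [AddCommGroup M] [Module R M] : Prop :=
  ∃ rs : List R, rs.length = n ∧ (∀ r ∈ rs, r ∈ maximalIdeal R) ∧ IsWeaklyRegular M rs

section

variable {R : Type u} [CommRing R] [IsLocalRing R] {M : Type v} [AddCommGroup M] [Module R M]

theorem HasRegularSequence.zero : HasRegularSequence R 0 M :=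
  ⟨[], rfl, by simp, IsWeaklyRegular.nil R M⟩

theorem hasRegularSequence_succ {n : ℕ} : HasRegularSequence R (n + 1) M ↔
    ∃ x ∈ maximalIdeal R, IsSMulRegular M x ∧ HasRegularSequence R n (QuotSMulTop x M) := by
  constructor
  · rintro ⟨rs, hl, hm, hr⟩
    cases rs with
    | nil => simp at hl
    | cons x rs =>
      rw [isWeaklyRegular_cons_iff] at hr
      exact ⟨x, hm x (by simp), hr.1, rs, by simpa using hl, fun r h => hm r (by simp [h]), hr.2⟩
  · rintro ⟨x, hx, hr, rs, hl, hm, hs⟩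
    refine ⟨x :: rs, by simp [hl], ?_, (isWeaklyRegular_cons_iff M x rs).2 ⟨hr, hs⟩⟩
    intro r h
    rcases List.mem_cons.1 h with rfl | h
    exacts [hx, hm r h]

theorem HasRegularSequence.congr {n : ℕ} {M' : Type*} [AddCommGroup M'] [Module R M']
    (e : M ≃ₗ[R] M') (h : HasRegularSequence R n M) : HasRegularSequence R n M' := by
  obtain ⟨rs, hl, hm, hr⟩ := h
  exact ⟨rs, hl, hm, (e.isWeaklyRegular_congr rs).1 hr⟩

/-- Over a local ring, weakly regular sequences in the maximal ideal on a Noetherian module may be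
permuted; this is the case of length two. -/
theorem isSMulRegular_quotSMulTop_swap [IsNoetherian R M] {x z : R} (hx : x ∈ maximalIdeal R)
    (hz : z ∈ maximalIdeal R) (h₁ : IsSMulRegular M x) (h₂ : IsSMulRegular (QuotSMulTop x M) z) :
    IsSMulRegular M z ∧ IsSMulRegular (QuotSMulTop z M) x := by
  have h : IsWeaklyRegular M [x, z] :=
    (isWeaklyRegular_cons_iff M x [z]).2 ⟨h₁, (isWeaklyRegular_singleton_iff _ _).2 h₂⟩
  have h' := isWeaklyRegular_of_perm_of_subset_maximalIdeal h (List.Perm.swap z x []) (by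
    rintro r hr
    rcases List.mem_pair.1 hr with rfl | rfl
    exacts [hx, hz])
  rw [isWeaklyRegular_cons_iff, isWeaklyRegular_singleton_iff] at h'
  exact h'

theorem quotSMulTop_mk_eq_zero_iff {x : R} {m : M} :
    (Submodule.Quotient.mk m : QuotSMulTop x M) = 0 ↔ ∃ m', m = x • m' := by
  rw [Submodule.Quotient.mk_eq_zero, Submodule.mem_smul_pointwise_iff_exists]
  simp [eq_comm]

/-- `M / x M / y M` and `M / y M / x M` agree. -/
noncomputable def quotSMulTopComm (x y : R) :
    QuotSMulTop y (QuotSMulTop x M) ≃ₗ[R] QuotSMulTop x (QuotSMulTop y M) := by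
  let f (x y : R) : QuotSMulTop y (QuotSMulTop x M) →ₗ[R] QuotSMulTop x (QuotSMulTop y M) :=
    Submodule.liftQ _ (Submodule.liftQ _ ((Submodule.mkQ _).comp (Submodule.mkQ _)) (by
      intro m hm
      obtain ⟨m', -, rfl⟩ := (Submodule.mem_smul_pointwise_iff_exists _ _ _).1 hm
      exact quotSMulTop_mk_eq_zero_iff.2 ⟨Submodule.Quotient.mk m', rfl⟩)) (by
      intro m hm
      obtain ⟨m', -, rfl⟩ := (Submodule.mem_smul_pointwise_iff_exists _ _ _).1 hm
      obtain ⟨m', rfl⟩ := Submodule.Quotient.mk_surjective _ m'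
      have : (Submodule.Quotient.mk (y • m') : QuotSMulTop y M) = 0 :=
        quotSMulTop_mk_eq_zero_iff.2 ⟨m', rfl⟩
      change Submodule.Quotient.mk (Submodule.Quotient.mk (y • m') : QuotSMulTop y M) = _
      rw [this]
      rfl)
  have hf (x y : R) (z) : f y x (f x y z) = z := by
    obtain ⟨z, rfl⟩ := Submodule.Quotient.mk_surjective _ z
    obtain ⟨z, rfl⟩ := Submodule.Quotient.mk_surjective _ z
    rfl
  exact LinearEquiv.ofLinearMap (f x y) (f y x) (LinearMap.ext (hf y x)) (LinearMap.ext (hf x y))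

variable [IsNoetherianRing R]

/-- The maximal ideal contains a common regular element of three finite modules if it contains
regular elements of each. -/
theorem exists_common_regular {M₁ M₂ M₃ : Type v} [AddCommGroup M₁] [Module R M₁]
    [Module.Finite R M₁] [AddCommGroup M₂] [Module R M₂] [Module.Finite R M₂]
    [AddCommGroup M₃] [Module R M₃] [Module.Finite R M₃]
    (h₁ : maximalIdeal R ∉ associatedPrimes R M₁) (h₂ : maximalIdeal R ∉ associatedPrimes R M₂)
    (h₃ : maximalIdeal R ∉ associatedPrimes R M₃) :
    ∃ z ∈ maximalIdeal R, IsSMulRegular M₁ z ∧ IsSMulRegular M₂ z ∧ IsSMulRegular M₃ z := by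
  classical
  set s := associatedPrimes R M₁ ∪ associatedPrimes R M₂ ∪ associatedPrimes R M₃ with hs
  have hfin : s.Finite := ((associatedPrimes.finite R M₁).union (associatedPrimes.finite R M₂)).union
    (associatedPrimes.finite R M₃)
  have hprime : ∀ p ∈ s, p.IsPrime := by
    rintro p ((h | h) | h) <;> exact h.isPrime
  have hm : ∀ p ∈ s, ¬ maximalIdeal R ≤ p := by
    intro p hp hle
    have : maximalIdeal R = p :=
      (maximalIdeal.isMaximal R).eq_of_le (hprime p hp).ne_top hle
    subst this
    rcases hp with (h | h) | h
    exacts [h₁ h, h₂ h, h₃ h]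
  -- Prime avoidance over the three finite sets of associated primes together.
  have hn : ¬ ((maximalIdeal R : Set R) ⊆ ⋃ p ∈ (hfin.toFinset : Set (Ideal R)), (p : Set R)) := by
    intro hle
    rw [Ideal.subset_union_prime (f := fun p : Ideal R => p) ⊤ ⊤
      (fun p hp _ _ => hprime p (by simpa using hp))] at hle
    obtain ⟨p, hp, hle⟩ := hle
    exact hm p (by simpa using hp) hle
  obtain ⟨z, hz, hzn⟩ := Set.not_subset.1 hn
  have key : ∀ {N : Type v} [AddCommGroup N] [Module R N], associatedPrimes R N ⊆ s →
      IsSMulRegular N z := by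
    intro N _ _ hN
    by_contra hreg
    have : z ∈ ({r | IsSMulRegular N r} : Set R)ᶜ := hreg
    rw [← biUnion_associatedPrimes_eq_compl_regular] at this
    obtain ⟨p, hp, hzp⟩ := Set.mem_iUnion₂.1 this
    exact hzn (Set.mem_iUnion₂.2 ⟨p, by simpa using hN hp, hzp⟩)
  exact ⟨z, hz, key fun p hp => Or.inl (Or.inl hp), key fun p hp => Or.inl (Or.inr hp),
    key fun p hp => Or.inr hp⟩

theorem maximalIdeal_notMem_associatedPrimes {x : R} (hx : x ∈ maximalIdeal R)
    (h : IsSMulRegular M x) : maximalIdeal R ∉ associatedPrimes R M := by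
  intro hm
  have : x ∈ ({r | IsSMulRegular M r} : Set R)ᶜ := by
    rw [← biUnion_associatedPrimes_eq_compl_regular]
    exact Set.mem_iUnion₂.2 ⟨_, hm, hx⟩
  exact this h

/-- If the maximal ideal annihilated the class of `u` modulo `y`, then `x u = y v` and `w u = y u'`.
Cancelling `y` gives `w v = x u'`, so `v = x v'` by regularity of `w` modulo `x`. Cancelling `x`
gives `u = y v'`, so the class was zero. -/
theorem maximalIdeal_notMem_associatedPrimes_quotSMulTop {x y w : R} (hy : y ∈ maximalIdeal R)
    (hw : w ∈ maximalIdeal R) (hx : x ∈ maximalIdeal R)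
    (hxM : IsSMulRegular M x) (hwM : IsSMulRegular (QuotSMulTop x M) w)
    (hyM : IsSMulRegular M y) : maximalIdeal R ∉ associatedPrimes R (QuotSMulTop y M) := by
  intro hm
  obtain ⟨-, u, hu⟩ := isAssociatedPrime_iff.1 hm
  have hu' : ∀ r, r ∈ maximalIdeal R ↔ r • u = 0 := by
    intro r
    rw [hu, Submodule.mem_colon_singleton, Submodule.mem_bot]
  obtain ⟨u, rfl⟩ := Submodule.Quotient.mk_surjective _ u
  have h1 : ∀ r ∈ maximalIdeal R, ∃ m, r • u = y • m := fun r hr =>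
    quotSMulTop_mk_eq_zero_iff.1 ((hu' r).1 hr)
  obtain ⟨v, hv⟩ := h1 x hx
  obtain ⟨u', hu₁⟩ := h1 w hw
  have h2 : w • v = x • u' := by
    apply hyM
    change y • w • v = y • x • u'
    rw [smul_comm y w, ← hv, smul_comm w x, hu₁, smul_comm]
  have h3 : (Submodule.Quotient.mk v : QuotSMulTop x M) = 0 := by
    apply hwM
    change w • Submodule.Quotient.mk v = w • (0 : QuotSMulTop x M)
    rw [smul_zero, ← Submodule.Quotient.mk_smul]
    exact quotSMulTop_mk_eq_zero_iff.2 ⟨u', h2⟩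
  obtain ⟨v', rfl⟩ := quotSMulTop_mk_eq_zero_iff.1 h3
  have h4 : u = y • v' := hxM (by change x • u = x • y • v'; rw [hv, smul_comm])
  have : (1 : R) ∈ maximalIdeal R := (hu' 1).2 (by
    rw [one_smul]; exact quotSMulTop_mk_eq_zero_iff.2 ⟨v', h4⟩)
  exact (maximalIdeal.isMaximal R).ne_top ((Ideal.eq_top_iff_one _).2 this)

/-- Dividing by any regular element lowers the depth by at most one. -/
theorem HasRegularSequence.quotSMulTop {n : ℕ} : ∀ {M : Type v} [AddCommGroup M] [Module R M]
    [Module.Finite R M] {y : R}, HasRegularSequence R (n + 1) M → y ∈ maximalIdeal R →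
    IsSMulRegular M y → HasRegularSequence R n (QuotSMulTop y M) := by
  induction n with
  | zero => intros; exact .zero
  | succ k ih =>
    intro M _ _ _ y h hy hyM
    obtain ⟨x, hx, hxM, h⟩ := hasRegularSequence_succ.1 h
    obtain ⟨w, hw, hwM, -⟩ := hasRegularSequence_succ.1 h
    -- The element `z` links `x` to `y`. By induction on `M/x`, the module `M/x/z = M/z/x` has depth
    -- at least `k`, so `M/z` has depth at least `k + 1`. Induction on `M/z` bounds the depth of
    -- `M/z/y = M/y/z`, and `z` is put in front.
    obtain ⟨z, hz, -, hzx, hzy⟩ := exists_common_regular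
      (maximalIdeal_notMem_associatedPrimes hx hxM)
      (maximalIdeal_notMem_associatedPrimes hw hwM)
      (maximalIdeal_notMem_associatedPrimes_quotSMulTop hy hw hx hxM hwM hyM)
    have h1 := (ih h hz hzx).congr (quotSMulTopComm x z)
    have h2 : HasRegularSequence R (k + 1) (QuotSMulTop z M) := hasRegularSequence_succ.2
      ⟨x, hx, (isSMulRegular_quotSMulTop_swap hx hz hxM hzx).2, h1⟩
    have h3 := ih h2 hy (isSMulRegular_quotSMulTop_swap hy hz hyM hzy).2
    exact hasRegularSequence_succ.2 ⟨z, hz, hzy, h3.congr (quotSMulTopComm z y)⟩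

/-- The height of an associated prime plus the length of a regular sequence is bounded by the
dimension. -/
theorem IsAssociatedPrime.height_add_le {n : ℕ} : ∀ {M : Type v} [AddCommGroup M] [Module R M]
    [Module.Finite R M], HasRegularSequence R n M → ∀ q : Ideal R, IsAssociatedPrime q M →
    q.height + n ≤ (maximalIdeal R).height := by
  induction n with
  | zero =>
    intro M _ _ _ _ q hq
    simpa using Ideal.height_mono (le_maximalIdeal hq.isPrime.ne_top)
  | succ k ih =>
    intro M _ _ _ h q hq
    obtain ⟨x, hx, hxM, h⟩ := hasRegularSequence_succ.1 h
    obtain ⟨hqp, u, hu⟩ := isAssociatedPrime_iff.1 hq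
    have hu' : ∀ r, r ∈ q ↔ r • u = 0 := by
      intro r
      rw [hu, Submodule.mem_colon_singleton, Submodule.mem_bot]
    have hu0 : u ≠ 0 := by
      rintro rfl
      exact hqp.ne_top ((Ideal.eq_top_iff_one _).2 ((hu' 1).2 (smul_zero _)))
    -- `N` is the part of `M` killed by `q`. If it were contained in `x M`, then `N = x N` by
    -- regularity of `x`, and Nakayama would give `N = 0`. So some element of `N` survives modulo
    -- `x`, and an associated prime of `M/x` containing its annihilator contains both `q` and `x ∉
    -- q`, hence has larger height.
    let N : Submodule R M :=
      { carrier := {m | ∀ r ∈ q, r • m = 0}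
        add_mem' := fun ha hb r hr => by rw [smul_add, ha r hr, hb r hr, add_zero]
        zero_mem' := fun r _ => smul_zero r
        smul_mem' := fun c m hm r hr => by rw [smul_comm, hm r hr, smul_zero] }
    have huN : u ∈ N := fun r hr => (hu' r).1 hr
    obtain ⟨m, hmN, hm⟩ : ∃ m ∈ N, (Submodule.Quotient.mk m : QuotSMulTop x M) ≠ 0 := by
      by_contra! hcon
      have hle : N ≤ Ideal.span {x} • N := by
        intro m hm
        obtain ⟨m', rfl⟩ := quotSMulTop_mk_eq_zero_iff.1 (hcon m hm)
        refine Submodule.smul_mem_smul (Ideal.mem_span_singleton_self x) fun r hr => ?_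
        exact hxM (by change x • r • m' = x • 0; rw [smul_zero, smul_comm, hm r hr])
      have hbot := Submodule.eq_bot_of_le_smul_of_le_jacobson_bot _ N
        (IsNoetherian.noetherian N) hle (by
          rw [IsLocalRing.jacobson_eq_maximalIdeal ⊥ bot_ne_top, Ideal.span_singleton_le_iff_mem]
          exact hx)
      rw [hbot] at huN
      exact hu0 huN
    obtain ⟨p, hp, hle⟩ := exists_le_isAssociatedPrime_of_isNoetherianRing R _ hm
    have hqle : q ≤ p := fun r hr => hle (by
      rw [Submodule.mem_colon_singleton, Submodule.mem_bot, ← Submodule.Quotient.mk_smul, hmN r hr]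
      rfl)
    have hxp : x ∈ p := hle (by
      rw [Submodule.mem_colon_singleton, Submodule.mem_bot, ← Submodule.Quotient.mk_smul]
      exact quotSMulTop_mk_eq_zero_iff.2 ⟨m, rfl⟩)
    have hxq : x ∉ q := fun hxq => hu0 (hxM (by
      change x • u = x • 0; rw [smul_zero]; exact (hu' x).1 hxq))
    have hlt : q < p := lt_of_le_of_ne hqle fun h => hxq (h ▸ hxp)
    haveI := hp.isPrime
    have := ih h p hp
    calc q.height + (k + 1 : ℕ) = (q.height + 1) + k := by push_cast; ring
      _ ≤ p.height + k := by gcongr; exact Ideal.height_add_one_le_of_lt_of_isPrime hlt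
      _ ≤ _ := this

end

/-- A Noetherian local ring whose maximal ideal is generated by `d` elements and has height at
least `d` is a domain of depth at least `d`. -/
theorem isDomain_and_hasRegularSequence (d : ℕ) : ∀ (R : Type u) [CommRing R] [IsLocalRing R]
    [IsNoetherianRing R], (maximalIdeal R).spanFinrank ≤ d → (d : ℕ∞) ≤ (maximalIdeal R).height →
    IsDomain R ∧ HasRegularSequence R d R := by
  induction d with
  | zero =>
    intro R _ _ _ h _
    refine ⟨?_, .zero⟩
    have h0 : maximalIdeal R = ⊥ := (Submodule.spanFinrank_eq_zero_iff_eq_bot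
      (IsNoetherian.noetherian _)).1 (Nat.le_zero.1 h)
    exact (isField_iff_maximalIdeal_eq.2 h0).isDomain
  | succ d ih =>
    intro R _ _ _ h hd
    classical
    have hmin : ∀ p ∈ minimalPrimes R, ¬ maximalIdeal R ≤ p := by
      intro p hp hle
      haveI : p.IsPrime := hp.1.1
      have : p.height = 0 := by
        exact Ideal.height_eq_zero_iff.2 hp
      have h2 := hd.trans (Ideal.height_mono hle)
      rw [this] at h2
      simp at h2
    have hsq : ¬ maximalIdeal R ≤ maximalIdeal R ^ 2 := by
      intro hle
      have hbot : maximalIdeal R = ⊥ := by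
        refine Submodule.eq_bot_of_le_smul_of_le_jacobson_bot (maximalIdeal R) _
          (IsNoetherian.noetherian _) ?_ (by rw [IsLocalRing.jacobson_eq_maximalIdeal ⊥ bot_ne_top])
        rwa [smul_eq_mul, ← pow_two]
      have hfield := isField_iff_maximalIdeal_eq.2 hbot
      haveI := hfield.isDomain
      rw [hbot] at hd
      simp at hd
    have hfin := minimalPrimes.finite_of_isNoetherianRing R
    -- Prime avoidance produces `x` outside the square of the maximal ideal and outside all minimal
    -- primes. The lemma admits two ideals that need not be prime; the square fills both places.
    have hn : ¬ ((maximalIdeal R : Set R) ⊆ ↑(maximalIdeal R ^ 2) ∪ ↑(maximalIdeal R ^ 2) ∪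
        ⋃ p ∈ (hfin.toFinset : Set (Ideal R)), (p : Set R)) := by
      rw [Ideal.subset_union_prime' (f := fun p : Ideal R => p)
        (fun p hp => (show p ∈ minimalPrimes R by simpa using hp).1.1)]
      rintro (h | h | ⟨p, hp, h⟩)
      exacts [hsq h, hsq h, hmin p (by simpa using hp) h]
    obtain ⟨x, hx, hxn⟩ := Set.not_subset.1 hn
    simp only [Set.mem_union, Set.mem_iUnion, not_or, not_exists, or_self] at hxn
    obtain ⟨hxsq, hxmin⟩ := hxn
    replace hxmin : ∀ p ∈ minimalPrimes R, x ∉ p := fun p hp => hxmin p (by simpa using hp)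
    have hx' : x ∈ maximalIdeal R := hx
    let S := R ⧸ Ideal.span {x}
    haveI : Nontrivial S := Ideal.Quotient.nontrivial_iff.2 fun htop => by
      have := (Ideal.span_singleton_le_iff_mem _).2 hx'
      rw [htop, top_le_iff] at this
      exact (maximalIdeal.isMaximal R).ne_top this
    have hsurj : Function.Surjective (Ideal.Quotient.mk (Ideal.span {x})) :=
      Ideal.Quotient.mk_surjective
    haveI : IsLocalRing S := IsLocalRing.of_surjective' _ hsurj
    haveI : IsLocalHom (Ideal.Quotient.mk (Ideal.span {x})) := IsLocalHom.of_surjective _ hsurj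
    have hmap : (maximalIdeal R).map (Ideal.Quotient.mk (Ideal.span {x})) = maximalIdeal S := by
      refine le_antisymm (((local_hom_TFAE (Ideal.Quotient.mk (Ideal.span {x}))).out 0 2).1 ‹_›) ?_
      intro s hs
      obtain ⟨r, rfl⟩ := hsurj s
      exact Ideal.mem_map_of_mem _ (by
        have := ((local_hom_TFAE (Ideal.Quotient.mk (Ideal.span {x}))).out 0 4).1 ‹_›
        rw [← this]; exact hs)
    have hheight : (d : ℕ∞) ≤ (maximalIdeal S).height := by
      have := hd.trans (Ideal.height_le_height_add_one_of_mem hx')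
      rw [hmap] at this
      push_cast at this
      exact (ENat.add_le_add_iff_right (by simp)).1 this
    -- Since `x` is not in the square, its class belongs to a basis of the cotangent space. Lifts of
    -- the basis generate the maximal ideal, and modulo `x` one generator becomes superfluous.
    have hspan : (maximalIdeal S).spanFinrank ≤ d := by
      let V := CotangentSpace R
      let xb : V := (maximalIdeal R).toCotangent ⟨x, hx'⟩
      have hxb : xb ≠ 0 := fun h0 => hxsq ((Ideal.toCotangent_eq_zero _ _).1 h0)
      have hli : LinearIndepOn (ResidueField R) id ({xb} : Set V) := by
        simpa using LinearIndepOn.singleton (R := ResidueField R) (v := (id : V → V)) (i := xb) hxb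
      have hbm : xb ∈ hli.extend (Set.subset_univ _) := hli.subset_extend _ rfl
      set I := hli.extend (Set.subset_univ ({xb} : Set V)) with hI
      obtain ⟨b, hb⟩ : ∃ b : Module.Basis I (ResidueField R) V, Set.range b = I :=
        ⟨Module.Basis.extend hli, Module.Basis.range_extend hli⟩
      haveI : Finite I := Module.Finite.finite_basis b
      have hcard : I.ncard ≤ d + 1 := by
        rw [spanFinrank_maximalIdeal_eq_finrank_cotangentSpace,
          Module.finrank_eq_nat_card_basis b] at h
        exact h
      choose lift hlift using (maximalIdeal R).toCotangent_surjective
      let t : Set (maximalIdeal R) := insert ⟨x, hx'⟩ (lift '' (I \ {xb}))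
      have ht : Submodule.span R t = ⊤ := by
        rw [← CotangentSpace.span_image_eq_top_iff, eq_top_iff]
        have h2 : Submodule.span (ResidueField R) I = ⊤ := by
          have := b.span_eq
          rwa [hb] at this
        rw [← h2, Submodule.span_le]
        intro v hv
        apply Submodule.subset_span
        by_cases hvx : v = xb
        · exact ⟨_, Set.mem_insert _ _, hvx.symm⟩
        · exact ⟨lift v, Set.mem_insert_of_mem _ ⟨v, ⟨hv, hvx⟩, rfl⟩, hlift v⟩
      have hm : maximalIdeal S = Ideal.span
          ((fun v => Ideal.Quotient.mk (Ideal.span {x}) (lift v : R)) '' (I \ {xb})) := by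
        have h3 : maximalIdeal R = Ideal.span ((↑) '' t : Set R) := by
          have := congrArg (Submodule.map (maximalIdeal R).subtype) ht
          rw [Submodule.map_span, Submodule.map_subtype_top] at this
          exact this.symm
        have h4 : maximalIdeal S = (Ideal.span ((↑) '' t : Set R)).map
            (Ideal.Quotient.mk (Ideal.span {x})) := by rw [← h3, hmap]
        rw [h4, Ideal.map_span, Set.image_image, Set.image_insert_eq, Set.image_image,
          Ideal.Quotient.eq_zero_iff_mem.2 (Ideal.mem_span_singleton_self x), Ideal.span_insert_zero]
      rw [hm]
      refine (Submodule.spanFinrank_span_le_ncard_of_finite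
        ((Set.toFinite I).sdiff.image _)).trans ((Set.ncard_image_le (Set.toFinite I).sdiff).trans ?_)
      have := Set.ncard_sdiff_singleton_add_one hbm (Set.toFinite I)
      omega
    obtain ⟨hdom, hreg⟩ := ih S hspan hheight
    have hxprime : (Ideal.span {x}).IsPrime := (Ideal.Quotient.isDomain_iff_prime _).1 hdom
    obtain ⟨q, hq, hqx⟩ := Ideal.exists_minimalPrimes_le (I := (⊥ : Ideal R)) (J := Ideal.span {x})
      bot_le
    -- A minimal prime `q` below `(x)` does not contain `x`, so `q = x q`, and Nakayama gives `q =
    -- 0`.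
    have hqbot : q = ⊥ := by
      refine Submodule.eq_bot_of_le_smul_of_le_jacobson_bot (Ideal.span {x}) q
        (IsNoetherian.noetherian _) ?_ (by
          rw [IsLocalRing.jacobson_eq_maximalIdeal ⊥ bot_ne_top, Ideal.span_singleton_le_iff_mem]
          exact hx')
      intro a ha
      obtain ⟨b, rfl⟩ := Ideal.mem_span_singleton'.1 (hqx ha)
      rw [mul_comm]
      exact Submodule.smul_mem_smul (Ideal.mem_span_singleton_self x)
        ((hq.1.1.mem_or_mem ha).resolve_right (hxmin q hq))
    haveI : (⊥ : Ideal R).IsPrime := hqbot ▸ hq.1.1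
    haveI hR : IsDomain R := IsDomain.of_bot_isPrime R
    refine ⟨hR, hasRegularSequence_succ.2 ⟨x, hx', ?_, ?_⟩⟩
    · exact fun a b h => mul_left_cancel₀ (by rintro rfl; exact hxsq (zero_mem _)) h
    · obtain ⟨rs, hl, hm, hr⟩ := hreg
      choose lift hlift using hsurj
      have he : QuotSMulTop x R ≃ₗ[R] S := Submodule.quotEquivOfEq _ _ (by
        ext; simp [Submodule.mem_smul_pointwise_iff_exists, Ideal.mem_span_singleton', mul_comm])
      refine HasRegularSequence.congr he.symm ⟨rs.map lift, by simpa using hl, ?_, ?_⟩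
      · intro r hr'
        obtain ⟨s, hs, rfl⟩ := List.mem_map.1 hr'
        have := ((local_hom_TFAE (Ideal.Quotient.mk (Ideal.span {x}))).out 0 4).1 ‹_›
        rw [← this, Ideal.mem_comap, hlift]
        exact hm s hs
      · rw [← isWeaklyRegular_map_algebraMap_iff S S, List.map_map,
          show List.map (algebraMap R S ∘ lift) rs = rs from
          (List.map_congr_left fun s _ => hlift s).trans (List.map_id rs)]
        exact hr

/-- A regular local ring is a domain. -/
theorem IsRegularLocalRing.isDomain (R : Type u) [CommRing R] [IsRegularLocalRing R] :
    IsDomain R ∧ ∃ d : ℕ, (d : ℕ∞) = (maximalIdeal R).height ∧ HasRegularSequence R d R := by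
  have h := IsRegularLocalRing.spanFinrank_maximalIdeal (R := R)
  rw [← IsLocalRing.maximalIdeal_height_eq_ringKrullDim] at h
  have h' : ((maximalIdeal R).spanFinrank : ℕ∞) = (maximalIdeal R).height := by exact_mod_cast h
  obtain ⟨h1, h2⟩ := isDomain_and_hasRegularSequence _ R le_rfl h'.le
  exact ⟨h1, _, h', h2⟩

/-! ### Ideals of a regular local ring whose quotients have associated primes of small height. -/

/-- Every nonzero element of `R ⧸ I` has annihilator contained in a prime of height at most `n`. -/
def AssHeightLE {R : Type u} [CommRing R] (I : Ideal R) (n : ℕ∞) : Prop :=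
  ∀ r ∉ I, ∃ q : Ideal R, q.IsPrime ∧ q.height ≤ n ∧ ∀ s, s * r ∈ I → s ∈ q

theorem assHeightLE_bot {R : Type u} [CommRing R] [IsDomain R] : AssHeightLE (⊥ : Ideal R) 0 := by
  intro r hr
  refine ⟨⊥, inferInstance, by simp, fun s hs => ?_⟩
  rw [Ideal.mem_bot] at hs hr ⊢
  exact (mul_eq_zero.1 hs).resolve_right hr

theorem AssHeightLE.mono {R : Type u} [CommRing R] {I : Ideal R} {n m : ℕ∞} (h : AssHeightLE I n)
    (hnm : n ≤ m) : AssHeightLE I m := fun r hr =>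
  let ⟨q, h1, h2, h3⟩ := h r hr
  ⟨q, h1, h2.trans hnm, h3⟩

section

variable {R : Type u} [CommRing R]

theorem quotSMulTop_mk_self_eq_zero_iff {x r : R} :
    (Submodule.Quotient.mk r : QuotSMulTop x R) = 0 ↔ r ∈ Ideal.span {x} := by
  rw [Submodule.Quotient.mk_eq_zero, Submodule.mem_smul_pointwise_iff_exists,
    Ideal.mem_span_singleton']
  simp [mul_comm]

theorem quotSMulTop_quotSMulTop_mk_eq_zero_iff {x y r : R} :
    (Submodule.Quotient.mk (Submodule.Quotient.mk r) : QuotSMulTop y (QuotSMulTop x R)) = 0 ↔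
      r ∈ Ideal.span {x, y} := by
  rw [Submodule.Quotient.mk_eq_zero, Submodule.mem_smul_pointwise_iff_exists,
    Ideal.mem_span_pair]
  constructor
  · rintro ⟨b, -, hb⟩
    obtain ⟨b, rfl⟩ := Submodule.Quotient.mk_surjective _ b
    rw [← Submodule.Quotient.mk_smul, eq_comm, ← sub_eq_zero, ← Submodule.Quotient.mk_sub,
      quotSMulTop_mk_self_eq_zero_iff, Ideal.mem_span_singleton'] at hb
    obtain ⟨a, ha⟩ := hb
    exact ⟨a, b, by rw [ha, smul_eq_mul]; ring⟩
  · rintro ⟨a, b, rfl⟩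
    refine ⟨Submodule.Quotient.mk b, trivial, ?_⟩
    rw [← Submodule.Quotient.mk_smul, eq_comm, ← sub_eq_zero, ← Submodule.Quotient.mk_sub,
      quotSMulTop_mk_self_eq_zero_iff, Ideal.mem_span_singleton']
    exact ⟨a, by rw [smul_eq_mul]; ring⟩

theorem isSMulRegular_quotSMulTop_iff {x y : R} :
    IsSMulRegular (QuotSMulTop x R) y ↔
      ∀ r, y * r ∈ Ideal.span {x} → r ∈ Ideal.span {x} := by
  constructor
  · intro h r hr
    rw [← quotSMulTop_mk_self_eq_zero_iff] at hr ⊢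
    apply h
    change y • _ = y • _
    rw [smul_zero, ← hr]
    rfl
  · intro h
    refine isSMulRegular_iff_right_eq_zero_of_smul.2 fun m hm => ?_
    obtain ⟨m, rfl⟩ := Submodule.Quotient.mk_surjective _ m
    rw [← Submodule.Quotient.mk_smul] at hm
    exact quotSMulTop_mk_self_eq_zero_iff.2 (h m (quotSMulTop_mk_self_eq_zero_iff.1 hm))

variable [IsRegularLocalRing R]

/-- The depth of `R/(x)` is at least `d - 1`, where `d` is the height of the maximal ideal, so
`IsAssociatedPrime.height_add_le` bounds the height of associated primes by 1. For `d = 0` the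
maximal ideal itself serves as the prime. -/
theorem assHeightLE_span_singleton {x : R} (hx : x ≠ 0) : AssHeightLE (Ideal.span {x}) 1 := by
  obtain ⟨hdom, d, hd, hreg⟩ := IsRegularLocalRing.isDomain R
  intro r hr
  have hxm : x ∈ maximalIdeal R := fun hu =>
    hr (by rw [Ideal.span_singleton_eq_top.2 hu]; trivial)
  rcases d with _ | k
  · refine ⟨maximalIdeal R, inferInstance, by simp [← hd], fun s hs => ?_⟩
    exact fun hu => hr ((Ideal.unit_mul_mem_iff_mem _ hu).1 hs)
  have h1 : HasRegularSequence R k (QuotSMulTop x R) :=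
    hreg.quotSMulTop hxm fun a b h => mul_left_cancel₀ hx h
  have hr' := (quotSMulTop_mk_self_eq_zero_iff (x := x) (r := r)).not.2 hr
  obtain ⟨q, hq, hle⟩ := exists_le_isAssociatedPrime_of_isNoetherianRing R _ hr'
  have h2 := IsAssociatedPrime.height_add_le h1 q hq
  rw [← hd] at h2
  refine ⟨q, hq.isPrime, ?_, fun s hs => hle ?_⟩
  · push_cast at h2
    rw [add_comm (k : ℕ∞)] at h2
    exact (ENat.add_le_add_iff_right (by simp)).1 h2
  · rw [Submodule.mem_colon_singleton, Submodule.mem_bot, ← Submodule.Quotient.mk_smul]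
    exact quotSMulTop_mk_self_eq_zero_iff.2 hs

/-- Two successive quotients lower the depth by at most two each time in total, which bounds the
height of associated primes by 2. When the maximal ideal already has height at most 2, it serves as
the prime. -/
theorem assHeightLE_span_pair {x y : R} (hx : x ≠ 0)
    (hy : ∀ r, y * r ∈ Ideal.span {x} → r ∈ Ideal.span {x}) : AssHeightLE (Ideal.span {x, y}) 2 := by
  obtain ⟨hdom, d, hd, hreg⟩ := IsRegularLocalRing.isDomain R
  intro r hr
  have hxm : x ∈ maximalIdeal R := fun hu => hr ((Ideal.span_mono (by simp)
    : Ideal.span {x} ≤ Ideal.span {x, y}) (by rw [Ideal.span_singleton_eq_top.2 hu]; trivial))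
  have hym : y ∈ maximalIdeal R := fun hu => hr ((Ideal.span_mono (by simp)
    : Ideal.span {y} ≤ Ideal.span {x, y}) (by rw [Ideal.span_singleton_eq_top.2 hu]; trivial))
  by_cases hd2 : d ≤ 2
  · refine ⟨maximalIdeal R, inferInstance, by rw [← hd]; exact_mod_cast hd2, fun s hs => ?_⟩
    exact fun hu => hr ((Ideal.unit_mul_mem_iff_mem _ hu).1 hs)
  obtain ⟨k, rfl⟩ : ∃ k, d = k + 2 := ⟨d - 2, by omega⟩
  have h1 : HasRegularSequence R (k + 1) (QuotSMulTop x R) :=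
    hreg.quotSMulTop hxm fun a b h => mul_left_cancel₀ hx h
  have h1' := h1.quotSMulTop hym (isSMulRegular_quotSMulTop_iff.2 hy)
  have hr' := (quotSMulTop_quotSMulTop_mk_eq_zero_iff (x := x) (y := y) (r := r)).not.2 hr
  obtain ⟨q, hq, hle⟩ := exists_le_isAssociatedPrime_of_isNoetherianRing R _ hr'
  have h2 := IsAssociatedPrime.height_add_le h1' q hq
  rw [← hd] at h2
  refine ⟨q, hq.isPrime, ?_, fun s hs => hle ?_⟩
  · push_cast at h2
    rw [add_comm (k : ℕ∞)] at h2
    exact (ENat.add_le_add_iff_right (by simp)).1 h2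
  · rw [Submodule.mem_colon_singleton, Submodule.mem_bot, ← Submodule.Quotient.mk_smul,
      ← Submodule.Quotient.mk_smul]
    exact quotSMulTop_quotSMulTop_mk_eq_zero_iff.2 hs

/-- An ideal not contained in any prime of height at most one contains a regular sequence of
length two, whose first element can be prescribed. -/
theorem exists_regular_mod {x : R} (hx : x ≠ 0) (a : Ideal R)
    (ha : ∀ q : Ideal R, q.IsPrime → q.height ≤ 1 → ¬ a ≤ q) :
    ∃ y ∈ a, ∀ r, y * r ∈ Ideal.span {x} → r ∈ Ideal.span {x} := by
  -- If all of `a` consists of zero divisors modulo `x`, prime avoidance puts `a` inside one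
  -- associated prime of `R/(x)`, and hence inside a prime of height at most 1.
  by_contra! hcon
  have hfin := associatedPrimes.finite R (QuotSMulTop x R)
  have hsub : (a : Set R) ⊆ ⋃ p ∈ (hfin.toFinset : Set (Ideal R)), (p : Set R) := by
    intro y hy
    obtain ⟨r, h1, h2⟩ := hcon y hy
    have : y ∈ ({r | IsSMulRegular (QuotSMulTop x R) r} : Set R)ᶜ := fun h =>
      h2 (isSMulRegular_quotSMulTop_iff.1 h r h1)
    rw [← biUnion_associatedPrimes_eq_compl_regular] at this
    simpa using this
  rw [Ideal.subset_union_prime (f := fun p : Ideal R => p) ⊤ ⊤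
    (fun p hp _ _ => (show p ∈ associatedPrimes R _ by simpa using hp).isPrime)] at hsub
  obtain ⟨p, hp, hle⟩ := hsub
  have hp' : IsAssociatedPrime p (QuotSMulTop x R) := (show p ∈ associatedPrimes R (QuotSMulTop x R) by simpa using hp)
  obtain ⟨hpp, u, hu⟩ := isAssociatedPrime_iff.1 hp'
  obtain ⟨r, rfl⟩ := Submodule.Quotient.mk_surjective _ u
  have hmem : ∀ s, s ∈ p ↔ s * r ∈ Ideal.span {x} := by
    intro s
    rw [hu, Submodule.mem_colon_singleton, Submodule.mem_bot, ← Submodule.Quotient.mk_smul]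
    exact quotSMulTop_mk_self_eq_zero_iff
  have hr : r ∉ Ideal.span {x} := fun hr => hpp.ne_top
    ((Ideal.eq_top_iff_one _).2 ((hmem 1).2 (by rwa [one_mul])))
  obtain ⟨q, hq, hq1, hq2⟩ := assHeightLE_span_singleton hx r hr
  exact ha q hq hq1 (hle.trans fun s hs => hq2 s ((hmem s).1 hs))

end

end

noncomputable section

namespace HighestWeight

/-! ### Filtrations by a family of modules -/

section Filtration

variable (A : Type u) [Ring A] {L : Type v} (Δ : L → Type u) [∀ i, AddCommGroup (Δ i)]
  [∀ i, Module A (Δ i)]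

/-- `X` has a filtration with successive quotients, from top to bottom, `Δ i` for `i` in the
given list. -/
def FiltBy : List L → ∀ (X : Type u) [AddCommGroup X] [Module A X], Prop
  | [], X, _, _ => Subsingleton X
  | i :: l, X, _, _ => ∃ g : X →ₗ[A] Δ i, Function.Surjective g ∧ FiltBy l (LinearMap.ker g)

/-- Every extension of `X` by `N` splits, in the form that homomorphisms to `N` extend. -/
def ExtVanish (X N : Type u) [AddCommGroup X] [Module A X] [AddCommGroup N] [Module A N] : Prop :=
  ∀ (E : Type u) [AddCommGroup E] [Module A E] (g : E →ₗ[A] X), Function.Surjective g →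
    ∀ h : LinearMap.ker g →ₗ[A] N, ∃ h' : E →ₗ[A] N, ∀ x : LinearMap.ker g, h' x = h x

variable {A Δ}
variable {X Y N : Type u} [AddCommGroup X] [Module A X] [AddCommGroup Y] [Module A Y]
  [AddCommGroup N] [Module A N]

theorem FiltBy.congr {l : List L} : ∀ {X Y : Type u} [AddCommGroup X] [Module A X]
    [AddCommGroup Y] [Module A Y] (_ : X ≃ₗ[A] Y), FiltBy A Δ l X → FiltBy A Δ l Y := by
  induction l with
  | nil => intro X Y _ _ _ _ e h; exact @Equiv.subsingleton _ _ e.symm.toEquiv h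
  | cons i l ih =>
    rintro X Y _ _ _ _ e ⟨g, hg, h⟩
    refine ⟨g ∘ₗ e.symm.toLinearMap, hg.comp e.symm.surjective, ih ?_ h⟩
    exact LinearEquiv.ofSubmodules e _ _ (by
      rw [LinearMap.ker_comp]
      exact Submodule.map_equiv_eq_comap_symm e _)

theorem FiltBy.cons {l : List L} {i : L} (f : X →ₗ[A] Y) (g : Y →ₗ[A] Δ i)
    (hf : Function.Injective f) (hg : Function.Surjective g) (hfg : Function.Exact f g)
    (h : FiltBy A Δ l X) : FiltBy A Δ (i :: l) Y := by
  refine ⟨g, hg, h.congr ((LinearEquiv.ofInjective f hf).trans (LinearEquiv.ofEq _ _ ?_))⟩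
  exact (LinearMap.exact_iff.1 hfg).symm

theorem FiltBy.singleton (i : L) : FiltBy A Δ [i] (Δ i) := by
  refine ⟨LinearMap.id, Function.surjective_id, ?_⟩
  rw [LinearMap.ker_id]
  exact (inferInstance : Subsingleton (⊥ : Submodule A (Δ i)))

theorem FiltBy.append {l₁ l₃ : List L} : ∀ {X Y Z : Type u} [AddCommGroup X] [Module A X]
    [AddCommGroup Y] [Module A Y] [AddCommGroup Z] [Module A Z] (f : X →ₗ[A] Y) (g : Y →ₗ[A] Z)
    (_ : Function.Injective f) (_ : Function.Surjective g) (_ : Function.Exact f g),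
    FiltBy A Δ l₁ X → FiltBy A Δ l₃ Z → FiltBy A Δ (l₃ ++ l₁) Y := by
  induction l₃ with
  | nil =>
    intro X Y Z _ _ _ _ _ _ f g hf hg hfg h₁ h₃
    haveI : Subsingleton Z := h₃
    refine h₁.congr (LinearEquiv.ofBijective f ⟨hf, fun y => ?_⟩)
    exact (hfg y).1 (Subsingleton.elim _ _)
  | cons i l ih =>
    rintro X Y Z _ _ _ _ _ _ f g hf hg hfg h₁ ⟨p, hp, h₃⟩
    refine ⟨p ∘ₗ g, hp.comp hg, ?_⟩
    refine ih (f.codRestrict (LinearMap.ker (p ∘ₗ g)) fun x => ?_)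
      (g.restrict (p := LinearMap.ker (p ∘ₗ g)) (q := LinearMap.ker p) fun x hx => hx)
      ?_ ?_ ?_ h₁ h₃
    · rw [LinearMap.mem_ker, LinearMap.comp_apply, hfg.apply_apply_eq_zero, map_zero]
    · exact fun x y h => hf (congrArg Subtype.val h)
    · rintro ⟨z, hz⟩
      obtain ⟨y, rfl⟩ := hg z
      exact ⟨⟨y, hz⟩, rfl⟩
    · rintro ⟨y, hy⟩
      constructor
      · intro h
        obtain ⟨x, hx⟩ := (hfg y).1 (congrArg Subtype.val h)
        exact ⟨x, Subtype.ext hx⟩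
      · rintro ⟨x, hx⟩
        apply Subtype.ext
        have : f x = y := congrArg Subtype.val hx
        exact (hfg y).2 ⟨x, this⟩

theorem FiltBy.prod {l₁ l₂ : List L} (h₁ : FiltBy A Δ l₁ X) (h₂ : FiltBy A Δ l₂ Y) :
    FiltBy A Δ (l₂ ++ l₁) (X × Y) :=
  FiltBy.append (LinearMap.inl A X Y) (LinearMap.snd A X Y) LinearMap.inl_injective
    Prod.snd_surjective .inl_snd h₁ h₂

theorem FiltBy.finite [∀ i, Module.Finite A (Δ i)] {l : List L} : ∀ {X : Type u} [AddCommGroup X]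
    [Module A X], FiltBy A Δ l X → Module.Finite A X := by
  induction l with
  | nil => intro X _ _ h; haveI : Subsingleton X := h; infer_instance
  | cons i l ih =>
    rintro X _ _ ⟨g, hg, h⟩
    haveI := ih h
    haveI : Module.Finite A (X ⧸ LinearMap.ker g) :=
      Module.Finite.equiv (g.quotKerEquivOfSurjective hg).symm
    exact Module.Finite.of_submodule_quotient (LinearMap.ker g)

theorem FiltBy.hom_eq_zero {l : List L} (hl : ∀ i ∈ l, ∀ f : Δ i →ₗ[A] N, f = 0) :
    ∀ {X : Type u} [AddCommGroup X] [Module A X], FiltBy A Δ l X → ∀ f : X →ₗ[A] N, f = 0 := by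
  induction l with
  | nil => intro X _ _ h f; haveI : Subsingleton X := h; exact Subsingleton.elim _ _
  | cons i l ih =>
    rintro X _ _ ⟨g, hg, h⟩ f
    have h0 := ih (fun j hj => hl j (List.mem_cons_of_mem i hj)) h (f ∘ₗ (LinearMap.ker g).subtype)
    have hle : LinearMap.ker g ≤ LinearMap.ker f := fun x hx => LinearMap.congr_fun h0 ⟨x, hx⟩
    have h1 := hl i List.mem_cons_self
      ((LinearMap.ker g).liftQ f hle ∘ₗ (g.quotKerEquivOfSurjective hg).symm.toLinearMap)
    ext x
    have := LinearMap.congr_fun h1 (g x)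
    have h2 : (g.quotKerEquivOfSurjective hg).symm (g x) = Submodule.Quotient.mk x := by
      rw [LinearEquiv.symm_apply_eq]; rfl
    simpa [h2] using this

/-- A homomorphism vanishing on the kernel of a surjection factors through it. -/
theorem exists_factor {g : X →ₗ[A] Y} (hg : Function.Surjective g) (f : X →ₗ[A] N)
    (h : ∀ x, g x = 0 → f x = 0) : ∃ f' : Y →ₗ[A] N, ∀ x, f' (g x) = f x := by
  refine ⟨(LinearMap.ker g).liftQ f h ∘ₗ (g.quotKerEquivOfSurjective hg).symm.toLinearMap, fun x => ?_⟩
  have h2 : (g.quotKerEquivOfSurjective hg).symm (g x) = Submodule.Quotient.mk x := by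
    rw [LinearEquiv.symm_apply_eq]; rfl
  change (LinearMap.ker g).liftQ f h ((g.quotKerEquivOfSurjective hg).symm (g x)) = f x
  rw [h2]
  exact Submodule.liftQ_apply _ _ _

/-- Any extension `E` of `X` receives a lift `q` of the presentation `p`, and `ker g × P → E` is
surjective. The homomorphism `k` on `ker g` and an extension to `P` of its pullback along `q` agree
on the relations, so they glue to a homomorphism on `E`. -/
theorem extVanish_of_projective {P : Type u} [AddCommGroup P] [Module A P] [Module.Projective A P]
    (p : P →ₗ[A] X) (hp : Function.Surjective p)
    (h : ∀ k : LinearMap.ker p →ₗ[A] N, ∃ k' : P →ₗ[A] N, ∀ x : LinearMap.ker p, k' x = k x) :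
    ExtVanish A X N := by
  intro E _ _ g hg k
  obtain ⟨q, hq⟩ := Module.projective_lifting_property g p hg
  have hq' : ∀ x, g (q x) = p x := fun x => LinearMap.congr_fun hq x
  obtain ⟨k', hk'⟩ := h (k ∘ₗ q.restrict (p := LinearMap.ker p) (q := LinearMap.ker g)
    fun x hx => by rw [LinearMap.mem_ker, hq']; exact hx)
  have hs : Function.Surjective ((LinearMap.ker g).subtype.coprod q) := by
    intro e
    obtain ⟨x, hx⟩ := hp (g e)
    refine ⟨(⟨e - q x, by rw [LinearMap.mem_ker, map_sub, hq', hx, sub_self]⟩, x), ?_⟩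
    simp
  obtain ⟨f, hf⟩ := exists_factor hs (k.coprod k') (by
    rintro ⟨a, x⟩ hax
    simp only [LinearMap.coprod_apply, Submodule.subtype_apply] at hax ⊢
    have hx : x ∈ LinearMap.ker p := by
      have := congrArg g hax
      rw [map_add, hq', map_zero, LinearMap.mem_ker.1 a.2, zero_add] at this
      exact this
    have h1 := hk' ⟨x, hx⟩
    simp only at h1
    rw [h1, LinearMap.comp_apply, ← map_add]
    convert map_zero k
    exact Subtype.ext hax)
  refine ⟨f, fun x => ?_⟩
  simpa using hf (x, 0)

/-- Adjacent factors of a filtration can be exchanged when extensions split. -/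
theorem FiltBy.swap {i j : L} {l : List L} (hij : ExtVanish A (Δ i) (Δ j))
    (h : FiltBy A Δ (i :: j :: l) X) : FiltBy A Δ (j :: i :: l) X := by
  obtain ⟨g, hg, f, hf, h⟩ := h
  -- The extension `k` of `f` to all of `X` makes `(g, k)` a surjection onto the product of both
  -- factors with kernel that of `f`; either component may then be taken first.
  obtain ⟨k, hk⟩ := hij X g hg f
  have hks : Function.Surjective k := fun y => by
    obtain ⟨x, rfl⟩ := hf y
    exact ⟨x, hk x⟩
  refine ⟨k, hks, FiltBy.cons
    ((((LinearMap.ker g).subtype ∘ₗ (LinearMap.ker f).subtype).codRestrict (LinearMap.ker k)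
      fun x => (hk x.1).trans x.2)) (g ∘ₗ (LinearMap.ker k).subtype) ?_ ?_ ?_ h⟩
  · exact fun x y hxy => by
      have h0 := Subtype.ext_iff.1 hxy
      have h1 : (x.1 : X) = y.1 := h0
      exact Subtype.ext (Subtype.ext h1)
  · intro y
    obtain ⟨x, rfl⟩ := hg y
    obtain ⟨z, hz⟩ := hf (k x)
    refine ⟨⟨x - z, ?_⟩, ?_⟩
    · rw [LinearMap.mem_ker, map_sub, hk, hz, sub_self]
    · change g (x - z) = g x
      rw [map_sub, LinearMap.mem_ker.1 z.2, sub_zero]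
  · rintro ⟨x, hx⟩
    constructor
    · intro h0
      refine ⟨⟨⟨x, h0⟩, ?_⟩, rfl⟩
      rw [LinearMap.mem_ker, ← hk]
      exact hx
    · rintro ⟨y, hy⟩
      have : (y.1 : X) = x := congrArg Subtype.val hy
      change g x = 0
      rw [← this]
      exact y.1.2

/-- A minimal label can be moved to the top of a filtration. -/
theorem FiltBy.exists_top {i : L} {l : List L} (hi : i ∈ l)
    (hl : ∀ j ∈ l, ExtVanish A (Δ j) (Δ i)) : ∀ {X : Type u} [AddCommGroup X] [Module A X],
    FiltBy A Δ l X → ∃ l', l.Perm (i :: l') ∧ FiltBy A Δ (i :: l') X := by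
  induction l with
  | nil => simp at hi
  | cons j l ih =>
    intro X _ _ h
    rcases List.mem_cons.1 hi with rfl | hi
    · exact ⟨l, .refl _, h⟩
    · obtain ⟨g, hg, h⟩ := h
      obtain ⟨l', hp, h'⟩ := ih hi (fun k hk => hl k (List.mem_cons_of_mem j hk)) h
      exact ⟨j :: l', (hp.cons j).trans (List.Perm.swap i j l'),
        FiltBy.swap (hl j List.mem_cons_self) ⟨g, hg, h'⟩⟩

end Filtration

end HighestWeight

end

noncomputable section

namespace HighestWeight

/-! ### The functor `B ⊗_A -` on modules -/

section Tensor

variable {A' A B : Type u} [Ring A'] [Ring A] [AddCommGroup B] [Module A' B] [Module Aᵐᵒᵖ B]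
variable {X Y Z W : Type u} [AddCommGroup X] [Module A X] [AddCommGroup Y] [Module A Y]
  [AddCommGroup Z] [Module A Z] [AddCommGroup W] [Module A' W]

/-- The element `b ⊗ x` of `B ⊗_A X`. -/
def BTensor.tmul (A' A : Type u) {B X : Type u} [Ring A'] [Ring A] [AddCommGroup B] [Module A' B]
    [Module Aᵐᵒᵖ B] [AddCommGroup X] [Module A X] (b : B) (x : X) : BTensor A' A B X :=
  Submodule.Quotient.mk (b ⊗ₜ[ℤ] x)

namespace BTensor

theorem induction_on {p : BTensor A' A B X → Prop} (z : BTensor A' A B X)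
    (zero : p 0) (tmul : ∀ b x, p (tmul A' A b x)) (add : ∀ x y, p x → p y → p (x + y)) : p z := by
  obtain ⟨z, rfl⟩ := Submodule.Quotient.mk_surjective _ z
  induction z using TensorProduct.induction_on with
  | zero => exact zero
  | tmul b x => exact tmul b x
  | add x y hx hy => exact add _ _ hx hy

theorem tmul_add (b : B) (x y : X) : tmul A' A b (x + y) = tmul A' A b x + tmul A' A b y :=
  congrArg Submodule.Quotient.mk (TensorProduct.tmul_add b x y)

theorem add_tmul (b c : B) (x : X) : tmul A' A (b + c) x = tmul A' A b x + tmul A' A c x :=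
  congrArg Submodule.Quotient.mk (TensorProduct.add_tmul b c x)

theorem smul_tmul (a : A') (b : B) (x : X) : a • tmul A' A b x = tmul A' A (a • b) x := rfl

theorem op_smul_tmul (a : A) (b : B) (x : X) :
    tmul A' A (MulOpposite.op a • b) x = tmul A' A b (a • x) :=
  (Submodule.Quotient.eq _).2 (Submodule.subset_span ⟨b, a, x, rfl⟩)

/-- `b ⊗ x` as a homomorphism in `b`. -/
def unit (A' A : Type u) (B : Type u) {X : Type u} [Ring A'] [Ring A] [AddCommGroup B] [Module A' B]
    [Module Aᵐᵒᵖ B] [AddCommGroup X] [Module A X] : X →+ (B →ₗ[A'] BTensor A' A B X) where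
  toFun x :=
    { toFun := fun b => tmul A' A b x
      map_add' := fun b c => add_tmul b c x
      map_smul' := fun _ _ => rfl }
  map_zero' := LinearMap.ext fun b =>
    (by simpa using tmul_add (A' := A') (A := A) b (0 : X) 0 : tmul A' A b (0 : X) = 0)
  map_add' x y := LinearMap.ext fun b => tmul_add b x y

@[simp] theorem unit_apply (x : X) (b : B) : unit A' A B x b = tmul A' A b x := rfl

@[simp] theorem tmul_zero (b : B) : tmul A' A b (0 : X) = 0 :=
  LinearMap.congr_fun (map_zero (unit A' A B)) b

@[simp] theorem zero_tmul (x : X) : tmul A' A (0 : B) x = 0 := map_zero (unit A' A B x)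

theorem tmul_sub (b : B) (x y : X) : tmul A' A b (x - y) = tmul A' A b x - tmul A' A b y :=
  LinearMap.congr_fun (map_sub (unit A' A B) x y) b

@[simp] theorem map_tmul (f : X →ₗ[A] Y) (b : B) (x : X) :
    map A' A B f (tmul A' A b x) = tmul A' A b (f x) := rfl

theorem map_id : map A' A B (LinearMap.id : X →ₗ[A] X) = LinearMap.id :=
  hom_ext A' A B fun _ _ => rfl

theorem map_comp (g : Y →ₗ[A] Z) (f : X →ₗ[A] Y) :
    map A' A B (g ∘ₗ f) = map A' A B g ∘ₗ map A' A B f :=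
  hom_ext A' A B fun _ _ => rfl

theorem map_map (g : Y →ₗ[A] Z) (f : X →ₗ[A] Y) (z) :
    map A' A B g (map A' A B f z) = map A' A B (g ∘ₗ f) z := by rw [map_comp]; rfl

theorem map_add (f g : X →ₗ[A] Y) : map A' A B (f + g) = map A' A B f + map A' A B g :=
  hom_ext A' A B fun b x => tmul_add b (f x) (g x)

theorem map_zero : map A' A B (0 : X →ₗ[A] Y) = 0 :=
  hom_ext A' A B fun b _ => tmul_zero b

theorem ext {f g : BTensor A' A B X →ₗ[A'] W}
    (h : ∀ (b : B) (x : X), f (tmul A' A b x) = g (tmul A' A b x)) : f = g :=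
  hom_ext A' A B h

/-- The universal property of `B ⊗_A X`. -/
def lift (φ : X →+ (B →ₗ[A'] W))
    (h : ∀ (a : A) (x : X) (b : B), φ (a • x) b = φ x (MulOpposite.op a • b)) :
    BTensor A' A B X →ₗ[A'] W :=
  Submodule.liftQ _ (TensorProduct.AlgebraTensorModule.lift
    { toFun := fun b => ({ toFun := fun x => φ x b
                           map_zero' := by simp
                           map_add' := fun x y => by simp } : X →+ W).toIntLinearMap
      map_add' := fun b c => LinearMap.ext fun x => (φ x).map_add b c
      map_smul' := fun a b => LinearMap.ext fun x => (φ x).map_smul a b }) (by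
    rw [tensorRel, Submodule.span_le]
    rintro _ ⟨b, a, x, rfl⟩
    change _ = _
    rw [_root_.map_sub, sub_eq_zero]
    exact (h a x b).symm)

theorem map_surjective {f : X →ₗ[A] Y} (hf : Function.Surjective f) :
    Function.Surjective (map A' A B f) := by
  intro z
  induction z using induction_on with
  | zero => exact ⟨0, _root_.map_zero _⟩
  | tmul b y =>
    obtain ⟨x, rfl⟩ := hf y
    exact ⟨tmul A' A b x, rfl⟩
  | add x y hx hy =>
    obtain ⟨x, rfl⟩ := hx
    obtain ⟨y, rfl⟩ := hy
    exact ⟨x + y, _root_.map_add _ _ _⟩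

/-- Let `s` be a set-theoretic section of `g`. Modulo the image of `B ⊗ X`, the class of `b ⊗ s z`
does not depend on the chosen preimage, so it defines a map `ψ` from `B ⊗ Z` to the cokernel through
which the projection `q` factors. -/
theorem map_exact {f : X →ₗ[A] Y} {g : Y →ₗ[A] Z} (hg : Function.Surjective g)
    (hfg : Function.Exact f g) : Function.Exact (map A' A B f) (map A' A B g) := by
  have hcomp : g ∘ₗ f = 0 := LinearMap.ext fun x => hfg.apply_apply_eq_zero x
  let q := (LinearMap.range (map A' A B f)).mkQ
  have hwd : ∀ (b : B) (y y' : Y), g y = g y' → q (tmul A' A b y) = q (tmul A' A b y') := by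
    intro b y y' hy
    obtain ⟨x, hx⟩ := (hfg (y - y')).1 (by rw [_root_.map_sub, hy, sub_self])
    rw [← sub_eq_zero, ← _root_.map_sub, ← tmul_sub, ← hx]
    exact (Submodule.Quotient.mk_eq_zero _).2 ⟨tmul A' A b x, rfl⟩
  let s := Function.surjInv hg
  have hs : ∀ z, g (s z) = z := Function.surjInv_eq hg
  let ψ : BTensor A' A B Z →ₗ[A'] (BTensor A' A B Y ⧸ LinearMap.range (map A' A B f)) := lift
    { toFun := fun z => q ∘ₗ unit A' A B (s z)
      map_zero' := LinearMap.ext fun b => (hwd b _ 0 (by rw [hs, _root_.map_zero])).trans (by simp)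
      map_add' := fun z z' => LinearMap.ext fun b =>
        (hwd b _ (s z + s z') (by simp [hs])).trans (by simp [tmul_add]) }
    (fun a z b => (hwd b _ (a • s z) (by simp [hs])).trans (by
      change _ = q (tmul A' A _ _)
      rw [op_smul_tmul]))
  have hψ : ψ ∘ₗ map A' A B g = q := ext fun b y => hwd b _ y (hs _)
  intro y
  constructor
  · intro hy
    have := LinearMap.congr_fun hψ y
    rw [LinearMap.comp_apply, hy, _root_.map_zero] at this
    exact (Submodule.Quotient.mk_eq_zero _).1 this.symm
  · rintro ⟨x, rfl⟩
    rw [map_map, hcomp, map_zero]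
    rfl

variable (A' A B X) in
/-- The unit `X → Hom (B, B ⊗_A X)` is bijective. -/
def IsGood : Prop := Function.Bijective (unit A' A B (X := X))

theorem IsGood.eq_zero (h : IsGood A' A B X) {x : X} (hx : ∀ b : B, tmul A' A b x = 0) : x = 0 :=
  h.1 (LinearMap.ext fun b => (hx b).trans (by simp))

theorem IsGood.exists_eq (h : IsGood A' A B X) (f : B →ₗ[A'] BTensor A' A B X) :
    ∃ x, ∀ b, f b = tmul A' A b x :=
  let ⟨x, hx⟩ := h.2 f
  ⟨x, fun b => by rw [← hx]; rfl⟩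

/-- By adjunction, `Hom(B ⊗ X, B ⊗ Y) = Hom(X, Hom(B, B ⊗ Y))`, so bijectivity of the unit at the
target alone controls homomorphisms from any `X`. This is the injective half; `IsGood.exists_map_eq`
is the surjective one. -/
theorem IsGood.map_injective (h : IsGood A' A B Y) :
    Function.Injective (map A' A B : (X →ₗ[A] Y) → _) := by
  intro f g hfg
  refine LinearMap.ext fun x => h.1 (LinearMap.ext fun b => ?_)
  exact LinearMap.congr_fun hfg (tmul A' A b x)

theorem isGood_of_subsingleton [Subsingleton X] : IsGood A' A B X := by
  haveI : Subsingleton (BTensor A' A B X) := ⟨fun a b => by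
    have h : ∀ z : BTensor A' A B X, z = 0 := fun z => by
      induction z using induction_on with
      | zero => rfl
      | tmul b x => rw [Subsingleton.elim x 0, tmul_zero]
      | add x y hx hy => rw [hx, hy, add_zero]
    rw [h a, h b]⟩
  exact ⟨fun _ _ _ => Subsingleton.elim _ _,
    fun f => ⟨0, LinearMap.ext fun _ => Subsingleton.elim _ _⟩⟩

/-- A five-lemma chase along the units: injectivity of `map f` makes `Hom(B, B ⊗ -)` left exact on
this sequence. -/
theorem IsGood.exact {f : X →ₗ[A] Y} {g : Y →ₗ[A] Z} (hg : Function.Surjective g)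
    (hfg : Function.Exact f g) (hf : Function.Injective (map A' A B f)) (hX : IsGood A' A B X)
    (hZ : IsGood A' A B Z) : IsGood A' A B Y := by
  constructor
  · rw [injective_iff_map_eq_zero]
    intro y hy
    have hy' : ∀ b, tmul A' A b y = 0 := LinearMap.congr_fun hy
    have : g y = 0 := hZ.eq_zero fun b => by
      rw [← map_tmul, hy', _root_.map_zero]
    obtain ⟨x, rfl⟩ := (hfg y).1 this
    have : x = 0 := hX.eq_zero fun b => hf (by rw [map_tmul, hy', _root_.map_zero])
    rw [this, _root_.map_zero]
  · intro h
    obtain ⟨z, hz⟩ := hZ.exists_eq (map A' A B g ∘ₗ h)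
    obtain ⟨y, rfl⟩ := hg z
    have h0 : ∀ b, map A' A B g (h b - tmul A' A b y) = 0 := fun b => by
      rw [_root_.map_sub, map_tmul, ← hz]; exact sub_self _
    let e := LinearEquiv.ofInjective (map A' A B f) hf
    have hmem : ∀ b, (h - unit A' A B y) b ∈ LinearMap.range (map A' A B f) := fun b =>
      ((map_exact hg hfg) _).1 (h0 b)
    obtain ⟨x, hx⟩ := hX.exists_eq (e.symm.toLinearMap ∘ₗ
      (h - unit A' A B y).codRestrict (LinearMap.range (map A' A B f)) hmem)
    refine ⟨y + f x, LinearMap.ext fun b => ?_⟩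
    have h1 := congrArg (fun t => (e t : BTensor A' A B Y)) (hx b)
    simp only [LinearMap.comp_apply, LinearEquiv.coe_coe, LinearEquiv.apply_symm_apply] at h1
    have h2 : h b - tmul A' A b y = tmul A' A b (f x) := h1
    rw [unit_apply, tmul_add, ← h2, add_sub_cancel]

theorem IsGood.retract (hY : IsGood A' A B Y) (i : X →ₗ[A] Y) (r : Y →ₗ[A] X)
    (h : ∀ x, r (i x) = x) : IsGood A' A B X := by
  constructor
  · rw [injective_iff_map_eq_zero]
    intro x hx
    have hx' : ∀ b, tmul A' A b x = 0 := LinearMap.congr_fun hx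
    have : i x = 0 := hY.eq_zero fun b => by rw [← map_tmul, hx', _root_.map_zero]
    rw [← h x, this, _root_.map_zero]
  · intro f
    obtain ⟨y, hy⟩ := hY.exists_eq (map A' A B i ∘ₗ f)
    refine ⟨r y, LinearMap.ext fun b => ?_⟩
    rw [unit_apply, ← map_tmul, ← hy, LinearMap.comp_apply, map_map,
      show r ∘ₗ i = LinearMap.id from LinearMap.ext h, map_id]
    rfl

theorem IsGood.congr (hY : IsGood A' A B Y) (e : X ≃ₗ[A] Y) : IsGood A' A B X :=
  hY.retract e.toLinearMap e.symm.toLinearMap e.symm_apply_apply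

theorem IsGood.prod (hX : IsGood A' A B X) (hY : IsGood A' A B Y) : IsGood A' A B (X × Y) := by
  refine IsGood.exact (f := LinearMap.inl A X Y) (g := LinearMap.snd A X Y) Prod.snd_surjective
    .inl_snd ?_ hX hY
  refine Function.LeftInverse.injective (g := map A' A B (LinearMap.fst A X Y)) fun z => ?_
  rw [map_map, LinearMap.fst_comp_inl, map_id]
  rfl

/-- The equivalence induced by an isomorphism of modules. -/
def congr (e : X ≃ₗ[A] Y) : BTensor A' A B X ≃ₗ[A'] BTensor A' A B Y :=
  LinearEquiv.ofLinearMap (map A' A B e.toLinearMap) (map A' A B e.symm.toLinearMap)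
    (ext fun b x => by simp) (ext fun b x => by simp)

/-- `B ⊗_A -` commutes with products. -/
def prodEquiv : BTensor A' A B (X × Y) ≃ₗ[A'] BTensor A' A B X × BTensor A' A B Y :=
  LinearEquiv.ofLinearMap
    ((map A' A B (LinearMap.fst A X Y)).prod (map A' A B (LinearMap.snd A X Y)))
    ((map A' A B (LinearMap.inl A X Y)).coprod (map A' A B (LinearMap.inr A X Y)))
    (by
      refine LinearMap.prod_ext (ext fun b x => ?_) (ext fun b x => ?_) <;> simp)
    (ext fun b x => by simp [← tmul_add])

section

variable [SMulCommClass A' Aᵐᵒᵖ B]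

theorem IsGood.exists_map_eq (h : IsGood A' A B Y)
    (φ : BTensor A' A B X →ₗ[A'] BTensor A' A B Y) : ∃ g : X →ₗ[A] Y, map A' A B g = φ := by
  choose g hg using fun x => h.exists_eq (φ ∘ₗ unit A' A B x)
  have hg' : ∀ x b, φ (tmul A' A b x) = tmul A' A b (g x) := hg
  refine ⟨{ toFun := g, map_add' := fun x y => ?_, map_smul' := fun a x => ?_ }, ext fun b x => ?_⟩
  · rw [← sub_eq_zero]
    refine h.eq_zero fun b => ?_
    rw [tmul_sub, tmul_add, ← hg', ← hg', ← hg', tmul_add, _root_.map_add, sub_self]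
  · rw [← sub_eq_zero]
    refine h.eq_zero fun b => ?_
    rw [RingHom.id_apply, tmul_sub, ← op_smul_tmul, ← hg', ← hg', op_smul_tmul, sub_self]
  · exact (hg' x b).symm

/-- `B ⊗_A A = B`. -/
def rid (A' A B : Type u) [Ring A'] [Ring A] [AddCommGroup B] [Module A' B] [Module Aᵐᵒᵖ B]
    [SMulCommClass A' Aᵐᵒᵖ B] : BTensor A' A B A ≃ₗ[A'] B :=
  LinearEquiv.ofLinearMap
    (lift
      { toFun := fun a =>
          { toFun := fun b => MulOpposite.op a • b
            map_add' := smul_add _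
            map_smul' := fun r b => (smul_comm r _ b).symm }
        map_zero' := by ext; simp
        map_add' := fun a c => by ext; simp [add_smul] }
      (fun a c b => by
        change MulOpposite.op (a * c) • b = MulOpposite.op c • MulOpposite.op a • b
        rw [MulOpposite.op_mul, mul_smul]))
    (unit A' A B 1)
    (LinearMap.ext fun b => one_smul _ b)
    (ext fun b a => by
      change tmul A' A (MulOpposite.op a • b) (1 : A) = tmul A' A b a
      rw [op_smul_tmul, smul_eq_mul, mul_one])

@[simp] theorem rid_tmul (b : B) (a : A) : rid A' A B (tmul A' A b a) = MulOpposite.op a • b := rfl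

end

section

variable (A' A B) (W) in
/-- The right adjoint of `B ⊗_A -`. -/
def CoInd : Type u := B →ₗ[A'] W

instance : AddCommGroup (CoInd A' B W) := inferInstanceAs (AddCommGroup (B →ₗ[A'] W))

variable [SMulCommClass A' Aᵐᵒᵖ B]

variable (A' B) in
/-- Right multiplication on a bimodule. -/
def rmul : Aᵐᵒᵖ →+* Module.End A' B :=
  haveI := SMulCommClass.symm A' Aᵐᵒᵖ B
  Module.toModuleEnd A' B

theorem rmul_apply (a : A) (b : B) : rmul A' B (MulOpposite.op a) b = MulOpposite.op a • b := rfl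

instance : Module A (CoInd A' B W) where
  smul a f := LinearMap.comp (f : B →ₗ[A'] W) (rmul A' B (MulOpposite.op a))
  one_smul f := by
    change LinearMap.comp f _ = _
    rw [MulOpposite.op_one, _root_.map_one]
    rfl
  mul_smul a c f := by
    change LinearMap.comp f _ = LinearMap.comp (LinearMap.comp f _) _
    rw [MulOpposite.op_mul, _root_.map_mul]
    rfl
  smul_zero a := rfl
  smul_add a f g := rfl
  add_smul a c f := by
    change LinearMap.comp f _ = LinearMap.comp f _ + LinearMap.comp f _
    rw [MulOpposite.op_add, _root_.map_add]
    exact LinearMap.comp_add _ _ (f : B →ₗ[A'] W)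
  zero_smul f := by
    change LinearMap.comp f _ = _
    rw [MulOpposite.op_zero, _root_.map_zero]
    exact LinearMap.comp_zero (f : B →ₗ[A'] W)

/-- Evaluation of an element of the coinduced module. -/
def CoInd.eval (f : CoInd A' B W) : B →ₗ[A'] W := f

end

end BTensor

end Tensor

end HighestWeight

end

noncomputable section

namespace HighestWeight

/-! ### Base change of modules -/

section BaseChangeMap

variable {R : Type u} [CommRing R] {R' : Type u} [CommRing R'] [Algebra R R']
variable {A A' : Type u} [Ring A] [Algebra R A] [Ring A'] [Algebra R A']
variable {X Y Z : Type u} [AddCommGroup X] [Module R X] [Module A X] [IsScalarTower R A X]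
  [AddCommGroup Y] [Module R Y] [Module A Y] [IsScalarTower R A Y]
  [AddCommGroup Z] [Module R Z] [Module A Z] [IsScalarTower R A Z]

namespace BC

theorem tmul_add (r : R') (x y : X) : tmul R R' r (x + y) = tmul R R' r x + tmul R R' r y :=
  TensorProduct.tmul_add r x y

@[simp] theorem tmul_zero (r : R') : tmul R R' r (0 : X) = 0 := TensorProduct.tmul_zero X r

theorem tmul_smul (s : R) (r : R') (x : X) :
    tmul R R' r (s • x) = algebraMap R R' s • tmul R R' r x := by
  change r ⊗ₜ[R] (s • x) = (algebraMap R R' s * r) ⊗ₜ[R] x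
  rw [← Algebra.smul_def]
  exact TensorProduct.tmul_smul s r x

theorem smul_tmul' (s r : R') (x : X) : s • tmul R R' r x = tmul R R' (s * r) x := rfl

theorem tmul_eq_smul (r : R') (x : X) : tmul R R' r x = r • tmul R R' 1 x := by
  rw [smul_tmul', mul_one]

/-- Additive maps out of `R' ⊗_R X`. -/
def liftAdd {V : Type*} [AddCommGroup V] (φ : R' →+ X →+ V)
    (h : ∀ (s : R) (r : R') (x : X), φ (s • r) x = φ r (s • x)) : BC R R' X →+ V :=
  TensorProduct.liftAddHom (R := R) (M := R') (N := X) φ h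

/-- Linearity of additive maps out of `R' ⊗_R X` can be tested on pure tensors. -/
def linearOfAdd (A : Type u) [Ring A] [Algebra R A] [Module A X] [IsScalarTower R A X]
    {V : Type*} [AddCommGroup V] [Module (R' ⊗[R] A) V] (f : BC R R' X →+ V)
    (h : ∀ (r : R') (a : A) (s : R') (x : X),
      f (tmul R R' (r * s) (a • x)) = (r ⊗ₜ[R] a : R' ⊗[R] A) • f (tmul R R' s x)) :
    BC R R' X →ₗ[R' ⊗[R] A] V where
  toFun := f
  map_add' := map_add f
  map_smul' z x := by
    rw [RingHom.id_apply]
    induction z using TensorProduct.induction_on with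
    | zero => rw [zero_smul, zero_smul, map_zero]
    | add y z hy hz => rw [add_smul, map_add, hy, hz, ← add_smul]
    | tmul r a =>
      induction x using BC.induction_on with
      | zero => rw [smul_zero, map_zero, smul_zero]
      | add x y hx hy => rw [smul_add, map_add, hx, hy, ← smul_add, ← map_add]
      | tmul s x => exact h r a s x

/-- The base change of a linear map. -/
def map (R R' : Type u) [CommRing R] [CommRing R'] [Algebra R R'] {A : Type u} [Ring A]
    [Algebra R A] {X Y : Type u} [AddCommGroup X] [Module R X] [Module A X] [IsScalarTower R A X]
    [AddCommGroup Y] [Module R Y] [Module A Y] [IsScalarTower R A Y]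
    (f : X →ₗ[A] Y) : BC R R' X →ₗ[R' ⊗[R] A] BC R R' Y :=
  linearOfAdd A ((f.restrictScalars R).lTensor R').toAddMonoidHom fun r a s x => by
    change (r * s) ⊗ₜ[R] f (a • x) = (r * s) ⊗ₜ[R] (a • f x)
    rw [map_smul]

@[simp] theorem map_tmul (f : X →ₗ[A] Y) (r : R') (x : X) :
    map R R' f (tmul R R' r x) = tmul R R' r (f x) := rfl

theorem hom_ext {V : Type*} [AddCommGroup V] [Module (R' ⊗[R] A) V]
    {f g : BC R R' X →ₗ[R' ⊗[R] A] V} (h : ∀ x, f (tmul R R' 1 x) = g (tmul R R' 1 x)) :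
    f = g := by
  refine LinearMap.ext fun z => ?_
  induction z using BC.induction_on with
  | zero => simp
  | add x y hx hy => rw [map_add, map_add, hx, hy]
  | tmul r x =>
    have : tmul R R' r x = (r ⊗ₜ[R] (1 : A)) • tmul R R' 1 x := by
      rw [BC.smul_tmul, mul_one, one_smul]
    rw [this, map_smul, map_smul, h]

theorem map_surjective {f : X →ₗ[A] Y} (hf : Function.Surjective f) :
    Function.Surjective (map R R' f) :=
  LinearMap.lTensor_surjective R' (g := f.restrictScalars R) hf

theorem map_exact {f : X →ₗ[A] Y} {g : Y →ₗ[A] Z} (hg : Function.Surjective g)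
    (hfg : Function.Exact f g) : Function.Exact (map R R' f) (map R R' g) :=
  lTensor_exact R' (f := f.restrictScalars R) (g := g.restrictScalars R) hfg hg

/-- The sequence splits over `R`, though not necessarily over `A`. Injectivity after base change
does not involve the action of `A`. -/
theorem map_injective [Module.Projective R Z] {f : X →ₗ[A] Y} {g : Y →ₗ[A] Z}
    (hf : Function.Injective f) (hg : Function.Surjective g) (hfg : Function.Exact f g) :
    Function.Injective (map R R' f) := by
  obtain ⟨s, hs⟩ := Module.projective_lifting_property (g.restrictScalars R) LinearMap.id hg
  have hfg' : Function.Exact (f.restrictScalars R) (g.restrictScalars R) := hfg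
  have hex : ∃ l, l ∘ₗ f.restrictScalars R = LinearMap.id :=
    ((hfg'.split_tfae hf hg).out 0 1 rfl rfl).1 ⟨s, hs⟩
  obtain ⟨t, ht⟩ := hex
  intro x y hxy
  have h2 : (t.lTensor R') ∘ₗ ((f.restrictScalars R).lTensor R') = LinearMap.id := by
    rw [← LinearMap.lTensor_comp, ht, LinearMap.lTensor_id]
  have h3 := congrArg (t.lTensor R') hxy
  exact (LinearMap.congr_fun h2 x).symm.trans (h3.trans (LinearMap.congr_fun h2 y))

end BC

/-- Base change of a filtration with factors projective over the base. -/
theorem FiltBy.baseChange {L : Type v} {Δ : L → Type u} [∀ i, AddCommGroup (Δ i)]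
    [∀ i, Module R (Δ i)] [∀ i, Module A (Δ i)] [∀ i, IsScalarTower R A (Δ i)]
    [∀ i, Module.Projective R (Δ i)] {l : List L} :
    ∀ {X : Type u} [AddCommGroup X] [Module R X] [Module A X] [IsScalarTower R A X],
    FiltBy A Δ l X → FiltBy (R' ⊗[R] A) (fun i => BC R R' (Δ i)) l (BC R R' X) := by
  induction l with
  | nil =>
    intro X _ _ _ _ h
    haveI : Subsingleton X := h
    exact inferInstanceAs (Subsingleton (R' ⊗[R] X))
  | cons i l ih =>
    rintro X _ _ _ _ ⟨g, hg, h⟩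
    have hex : Function.Exact (LinearMap.ker g).subtype g := g.exact_subtype_ker_map
    exact FiltBy.cons (BC.map R R' (LinearMap.ker g).subtype) (BC.map R R' g)
      (BC.map_injective (Subtype.val_injective) hg hex)
      (BC.map_surjective hg) (BC.map_exact hg hex) (ih h)

end BaseChangeMap

/-! ### Base change and bimodule tensor products -/

section BaseChangeTensor

variable {R : Type u} [CommRing R] {R' : Type u} [CommRing R'] [Algebra R R']
variable {A A' B : Type u} [Ring A] [Algebra R A] [Ring A'] [Algebra R A'] [AddCommGroup B]
  [Module A' B] [Module Aᵐᵒᵖ B] [Module R B] [IsScalarTower R A' B] [IsScalarTower R Aᵐᵒᵖ B]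
variable {X Y : Type u} [AddCommGroup X] [Module R X] [Module A X] [IsScalarTower R A X]
  [AddCommGroup Y] [Module R Y] [Module A Y] [IsScalarTower R A Y]

theorem BTensor.tmul_smul_base (r : R) (b : B) (x : X) :
    BTensor.tmul A' A b (r • x) = r • BTensor.tmul A' A b x := by
  rw [← one_smul A x, ← smul_assoc, ← BTensor.op_smul_tmul, MulOpposite.op_smul,
    MulOpposite.op_one, smul_assoc, one_smul, one_smul]
  rfl

/-- The universal property of base change. -/
def BC.lift {W V : Type u} [AddCommGroup W] [Module R W] [Module A' W] [IsScalarTower R A' W]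
    [AddCommGroup V] [Module (R' ⊗[R] A') V] (φ : W →+ V)
    (h : ∀ (a : A') (w : W), φ (a • w) = ((1 : R') ⊗ₜ[R] a : R' ⊗[R] A') • φ w) :
    BC R R' W →ₗ[R' ⊗[R] A'] V :=
  BC.linearOfAdd A' (BC.liftAdd
    { toFun := fun r => (DistribSMul.toAddMonoidHom V (r ⊗ₜ[R] (1 : A') : R' ⊗[R] A')).comp φ
      map_zero' := by
        ext w
        change ((0 : R') ⊗ₜ[R] (1 : A') : R' ⊗[R] A') • φ w = 0
        rw [TensorProduct.zero_tmul, zero_smul]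
      map_add' := fun r s => by
        ext w
        change ((r + s) ⊗ₜ[R] (1 : A') : R' ⊗[R] A') • φ w = (r ⊗ₜ[R] (1 : A') : R' ⊗[R] A') • φ w +
          (s ⊗ₜ[R] (1 : A') : R' ⊗[R] A') • φ w
        rw [TensorProduct.add_tmul, add_smul] }
    (fun s r w => by
      change ((s • r) ⊗ₜ[R] (1 : A') : R' ⊗[R] A') • φ w =
        (r ⊗ₜ[R] (1 : A') : R' ⊗[R] A') • φ (s • w)
      rw [show s • w = (s • (1 : A')) • w by rw [smul_assoc, one_smul], h, ← mul_smul,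
        Algebra.TensorProduct.tmul_mul_tmul, one_mul, mul_one, TensorProduct.smul_tmul]))
    (fun r a s x => by
      change ((r * s) ⊗ₜ[R] (1 : A') : R' ⊗[R] A') • φ (a • x) =
        (r ⊗ₜ[R] a : R' ⊗[R] A') • (s ⊗ₜ[R] (1 : A') : R' ⊗[R] A') • φ x
      rw [h, ← mul_smul, ← mul_smul, Algebra.TensorProduct.tmul_mul_tmul,
        Algebra.TensorProduct.tmul_mul_tmul, one_mul, mul_one, mul_one])

theorem BC.lift_tmul {W V : Type u} [AddCommGroup W] [Module R W] [Module A' W]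
    [IsScalarTower R A' W] [AddCommGroup V] [Module (R' ⊗[R] A') V] (φ : W →+ V)
    (h : ∀ (a : A') (w : W), φ (a • w) = ((1 : R') ⊗ₜ[R] a : R' ⊗[R] A') • φ w) (r : R') (w : W) :
    BC.lift φ h (BC.tmul R R' r w) = (r ⊗ₜ[R] (1 : A') : R' ⊗[R] A') • φ w := rfl

/-- The right action of `R'` on `R' ⊗_R B` agrees with the left one. -/
theorem BC.op_algebraMap_smul (r : R') (z : BC R R' B) :
    MulOpposite.op (r ⊗ₜ[R] (1 : A) : R' ⊗[R] A) • z = r • z := by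
  induction z using BC.induction_on with
  | zero => simp
  | add x y hx hy => rw [smul_add, hx, hy, smul_add]
  | tmul s x => rw [BC.op_smul_tmul, MulOpposite.op_one, one_smul]; rfl

theorem BC.smul_eq_tmul_one_smul (r : R') (z : BC R R' X) :
    (r ⊗ₜ[R] (1 : A) : R' ⊗[R] A) • z = r • z := by
  induction z using BC.induction_on with
  | zero => simp
  | add x y hx hy => rw [smul_add, hx, hy, smul_add]
  | tmul s x => rw [BC.smul_tmul, one_smul]; rfl

variable [SMulCommClass A' Aᵐᵒᵖ B]

variable (R R' A A' B X) in
/-- The comparison map on `B ⊗_A X`. -/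
def baseChangeTensorAdd : BTensor A' A B X →+
    BTensor (R' ⊗[R] A') (R' ⊗[R] A) (BC R R' B) (BC R R' X) :=
  letI V := BTensor (R' ⊗[R] A') (R' ⊗[R] A) (BC R R' B) (BC R R' X)
  letI : Module A' V := Module.compHom V
    (Algebra.TensorProduct.includeRight : A' →ₐ[R] R' ⊗[R] A').toRingHom
  (BTensor.lift (W := V)
    { toFun := fun x =>
        { toFun := fun b => BTensor.tmul (R' ⊗[R] A') (R' ⊗[R] A) (BC.tmul R R' 1 b)
            (BC.tmul R R' 1 x)
          map_add' := fun b c => by rw [BC.tmul_add, BTensor.add_tmul]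
          map_smul' := fun a b => by
            change _ = ((1 : R') ⊗ₜ[R] a : R' ⊗[R] A') • BTensor.tmul _ _ _ _
            rw [BTensor.smul_tmul, BC.smul_tmul, one_mul] }
      map_zero' := LinearMap.ext fun b => by
        change BTensor.tmul _ _ _ _ = 0
        rw [BC.tmul_zero]
        exact BTensor.tmul_zero _
      map_add' := fun x y => LinearMap.ext fun b =>
        (congrArg (BTensor.tmul (R' ⊗[R] A') (R' ⊗[R] A) (BC.tmul R R' 1 b))
          (BC.tmul_add (R := R) 1 x y)).trans (BTensor.tmul_add _ _ _) }
    (fun a x b => by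
      change BTensor.tmul _ _ _ _ = BTensor.tmul _ _ _ _
      have h1 : BC.tmul R R' 1 (a • x) = ((1 : R') ⊗ₜ[R] a : R' ⊗[R] A) • BC.tmul R R' 1 x := by
        rw [BC.smul_tmul, one_mul]
      have h2 : BC.tmul R R' 1 (MulOpposite.op a • b) =
          MulOpposite.op ((1 : R') ⊗ₜ[R] a : R' ⊗[R] A) • BC.tmul R R' 1 b := by
        rw [BC.op_smul_tmul, one_mul]
      rw [h1, h2, BTensor.op_smul_tmul])).toAddMonoidHom

theorem baseChangeTensorAdd_tmul (b : B) (x : X) :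
    baseChangeTensorAdd R R' A A' B X (BTensor.tmul A' A b x) =
      BTensor.tmul (R' ⊗[R] A') (R' ⊗[R] A) (BC.tmul R R' 1 b) (BC.tmul R R' 1 x) := rfl

variable (R R' A A' B X) in
/-- The comparison map `R' ⊗ (B ⊗_A X) → (R' ⊗ B) ⊗_{R' ⊗ A} (R' ⊗ X)`. -/
def baseChangeTensorHom : BC R R' (BTensor A' A B X) →ₗ[R' ⊗[R] A']
    BTensor (R' ⊗[R] A') (R' ⊗[R] A) (BC R R' B) (BC R R' X) :=
  BC.lift (baseChangeTensorAdd R R' A A' B X) fun a w => by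
    induction w using BTensor.induction_on with
    | zero => rw [smul_zero, map_zero, smul_zero]
    | add x y hx hy => rw [smul_add, map_add, hx, hy, map_add, smul_add]
    | tmul b x =>
      rw [BTensor.smul_tmul, baseChangeTensorAdd_tmul, baseChangeTensorAdd_tmul,
        BTensor.smul_tmul, BC.smul_tmul, one_mul]

theorem baseChangeTensorHom_tmul (r : R') (b : B) (x : X) :
    baseChangeTensorHom R R' A A' B X (BC.tmul R R' r (BTensor.tmul A' A b x)) =
      BTensor.tmul (R' ⊗[R] A') (R' ⊗[R] A) (BC.tmul R R' r b) (BC.tmul R R' 1 x) := by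
  rw [baseChangeTensorHom, BC.lift_tmul, baseChangeTensorAdd_tmul, BTensor.smul_tmul,
    BC.smul_tmul, one_smul, mul_one]

variable (R R' A A' B X) in
/-- The homomorphism `b ↦ s (b ⊗ x)` after base change, additive in `s ⊗ x`. -/
def baseChangeUnit : BC R R' X →+ (BC R R' B →ₗ[R' ⊗[R] A'] BC R R' (BTensor A' A B X)) :=
  haveI : SMulCommClass (R' ⊗[R] A') R' (BC R R' (BTensor A' A B X)) :=
    IsScalarTower.to_smulCommClass'
  BC.liftAdd
    { toFun := fun r =>
        { toFun := fun x => r • BC.map R R' (BTensor.unit A' A B x)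
          map_zero' := by
            rw [map_zero, show BC.map R R' (0 : B →ₗ[A'] BTensor A' A B X) = 0 from
              BC.hom_ext fun x => BC.tmul_zero _, smul_zero]
          map_add' := fun x y => by
            rw [map_add, show BC.map R R' (BTensor.unit A' A B x + BTensor.unit A' A B y) =
              BC.map R R' (BTensor.unit A' A B x) + BC.map R R' (BTensor.unit A' A B y) from
              BC.hom_ext fun b => BC.tmul_add _ (BTensor.tmul A' A b x) (BTensor.tmul A' A b y),
              smul_add] }
      map_zero' := by ext1 x; exact zero_smul R' (BC.map R R' (BTensor.unit A' A B x))
      map_add' := fun r s => by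
        ext1 x; exact add_smul r s (BC.map R R' (BTensor.unit A' A B x)) }
    (fun s r x => BC.hom_ext fun b => by
      change (s • r) • BC.tmul R R' 1 (BTensor.tmul A' A b x) =
        r • BC.tmul R R' 1 (BTensor.tmul A' A b (s • x))
      rw [BTensor.tmul_smul_base, BC.tmul_smul, smul_smul, mul_comm, Algebra.smul_def])

theorem baseChangeUnit_tmul (r t : R') (b : B) (x : X) :
    baseChangeUnit R R' A A' B X (BC.tmul R R' r x) (BC.tmul R R' t b) =
      BC.tmul R R' (r * t) (BTensor.tmul A' A b x) := rfl

theorem baseChangeUnit_balanced (z : R' ⊗[R] A) (x : BC R R' X) (b : BC R R' B) :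
    baseChangeUnit R R' A A' B X (z • x) b =
      baseChangeUnit R R' A A' B X x (MulOpposite.op z • b) := by
  induction z using TensorProduct.induction_on with
  | zero => rw [zero_smul, MulOpposite.op_zero, zero_smul, map_zero, map_zero, LinearMap.zero_apply]
  | add y z hy hz =>
    rw [add_smul, map_add, LinearMap.add_apply, hy, hz, ← map_add, MulOpposite.op_add, add_smul]
  | tmul r a =>
    induction b using BC.induction_on with
    | zero => rw [map_zero, smul_zero, map_zero]
    | add b c hb hc => rw [map_add, hb, hc, smul_add, map_add]
    | tmul t b =>
      induction x using BC.induction_on with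
      | zero => rw [smul_zero, map_zero, LinearMap.zero_apply, LinearMap.zero_apply]
      | add x y hx hy =>
        rw [smul_add, map_add, LinearMap.add_apply, hx, hy, map_add, LinearMap.add_apply]
      | tmul s x =>
        rw [BC.smul_tmul, BC.op_smul_tmul, baseChangeUnit_tmul, baseChangeUnit_tmul,
          BTensor.op_smul_tmul]
        congr 1
        ring

variable (R R' A A' B X) in
/-- The inverse of the comparison map. -/
def baseChangeTensorInv : BTensor (R' ⊗[R] A') (R' ⊗[R] A) (BC R R' B) (BC R R' X) →ₗ[R' ⊗[R] A']
    BC R R' (BTensor A' A B X) :=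
  BTensor.lift (baseChangeUnit R R' A A' B X) baseChangeUnit_balanced

theorem baseChangeTensorInv_tmul (r s : R') (b : B) (x : X) :
    baseChangeTensorInv R R' A A' B X (BTensor.tmul (R' ⊗[R] A') (R' ⊗[R] A) (BC.tmul R R' r b) (BC.tmul R R' s x)) =
      BC.tmul R R' (s * r) (BTensor.tmul A' A b x) := rfl

variable (R R' A A' B X) in
/-- `R' ⊗ (B ⊗_A X) = (R' ⊗ B) ⊗_{R' ⊗ A} (R' ⊗ X)`. -/
def baseChangeTensor : BC R R' (BTensor A' A B X) ≃ₗ[R' ⊗[R] A']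
    BTensor (R' ⊗[R] A') (R' ⊗[R] A) (BC R R' B) (BC R R' X) :=
  LinearEquiv.ofLinearMap (baseChangeTensorHom R R' A A' B X) (baseChangeTensorInv R R' A A' B X)
    (by
      refine BTensor.ext fun b x => ?_
      induction b using BC.induction_on with
      | zero => simp
      | add b c hb hc => rw [BTensor.add_tmul, map_add, hb, hc, map_add]
      | tmul r b =>
        induction x using BC.induction_on with
        | zero => simp
        | add x y hx hy => rw [BTensor.tmul_add, map_add, hx, hy, map_add]
        | tmul s x =>
          rw [LinearMap.comp_apply, baseChangeTensorInv_tmul, baseChangeTensorHom_tmul,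
            LinearMap.id_apply]
          have h1 : BC.tmul R R' (s * r) b =
              MulOpposite.op (s ⊗ₜ[R] (1 : A) : R' ⊗[R] A) • BC.tmul R R' r b := by
            rw [BC.op_smul_tmul, MulOpposite.op_one, one_smul]
          rw [h1, BTensor.op_smul_tmul, BC.smul_tmul, mul_one, one_smul])
    (by
      refine BC.hom_ext fun w => ?_
      induction w using BTensor.induction_on with
      | zero => simp
      | add x y hx hy => rw [BC.tmul_add, map_add, hx, hy, map_add]
      | tmul b x =>
        rw [LinearMap.comp_apply, baseChangeTensorHom_tmul, baseChangeTensorInv_tmul, mul_one,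
          LinearMap.id_apply])

@[simp] theorem baseChangeTensor_tmul (r : R') (b : B) (x : X) :
    baseChangeTensor R R' A A' B X (BC.tmul R R' r (BTensor.tmul A' A b x)) =
      BTensor.tmul (R' ⊗[R] A') (R' ⊗[R] A) (BC.tmul R R' r b) (BC.tmul R R' 1 x) :=
  baseChangeTensorHom_tmul r b x

end BaseChangeTensor

end HighestWeight

end

noncomputable section

namespace HighestWeight

/-! ### Localization of modules -/

section Localization

variable {R : Type u} [CommRing R] {R' : Type u} [CommRing R'] [Algebra R R']
variable {A : Type u} [Ring A] [Algebra R A]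
variable {X Y : Type u} [AddCommGroup X] [Module R X] [Module A X] [IsScalarTower R A X]
  [AddCommGroup Y] [Module R Y] [Module A Y] [IsScalarTower R A Y]

namespace BC

theorem exists_smul_eq {X : Type u} [AddCommGroup X] [Module R X] (S : Submonoid R)
    [IsLocalization S R'] (z : BC R R' X) :
    ∃ s ∈ S, ∃ x : X, algebraMap R R' s • z = tmul R R' 1 x := by
  obtain ⟨⟨x, s⟩, h⟩ := IsLocalizedModule.surj S (TensorProduct.mk R R' X 1) z
  refine ⟨s, s.2, x, ?_⟩
  exact (algebraMap_smul (M := R' ⊗[R] X) R' (s : R) z).trans h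

theorem tmul_one_injective {X : Type u} [AddCommGroup X] [Module R X] (S : Submonoid R)
    [IsLocalization S R'] (h : ∀ s ∈ S, ∀ x : X, s • x = 0 → x = 0) :
    Function.Injective (tmul R R' (M := X) 1) := by
  intro x y hxy
  obtain ⟨s, hs⟩ := (IsLocalizedModule.eq_iff_exists S (TensorProduct.mk R R' X 1)).1 hxy
  rw [← sub_eq_zero]
  exact h s s.2 _ (by rw [smul_sub, sub_eq_zero]; exact hs)

/-- Over a localization, a homomorphism from a finite module becomes defined over the base after
multiplication by a denominator. -/
theorem exists_smul_hom_eq (S : Submonoid R) [IsLocalization S R'] [Module.Finite A X]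
    (h : ∀ s ∈ S, ∀ y : Y, s • y = 0 → y = 0)
    (f : BC R R' X →ₗ[R' ⊗[R] A] BC R R' Y) :
    ∃ s ∈ S, ∃ g : X →ₗ[A] Y, ∀ x, algebraMap R R' s • f (tmul R R' 1 x) = tmul R R' 1 (g x) := by
  classical
  have hinj := tmul_one_injective (R' := R') S h
  obtain ⟨t, ht⟩ := Module.Finite.fg_top (R := A) (M := X)
  have h1 : ∀ t : Finset X, ∃ s ∈ S, ∀ x ∈ t, ∃ y : Y,
      algebraMap R R' s • f (tmul R R' 1 x) = tmul R R' 1 y := by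
    intro t
    induction t using Finset.induction_on with
    | empty => exact ⟨1, S.one_mem, by simp⟩
    | insert x t _ ih =>
      obtain ⟨s, hs, hst⟩ := ih
      obtain ⟨s', hs', y, hy⟩ := exists_smul_eq S (f (tmul R R' 1 x))
      refine ⟨s * s', S.mul_mem hs hs', fun z hz => ?_⟩
      rcases Finset.mem_insert.1 hz with rfl | hz
      · exact ⟨s • y, by rw [map_mul, mul_smul, hy, tmul_smul]⟩
      · obtain ⟨y', hy'⟩ := hst z hz
        exact ⟨s' • y', by rw [mul_comm, map_mul, mul_smul, hy', tmul_smul]⟩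
  obtain ⟨s, hs, hst⟩ := h1 t
  have h2 : ∀ x, ∃ y : Y, algebraMap R R' s • f (tmul R R' 1 x) = tmul R R' 1 y := by
    intro x
    have hx : x ∈ Submodule.span A (t : Set X) := ht ▸ Submodule.mem_top
    induction hx using Submodule.span_induction with
    | mem x hx => exact hst x hx
    | zero => exact ⟨0, by rw [tmul_zero, map_zero, smul_zero, tmul_zero]⟩
    | add x y _ _ hx hy =>
      obtain ⟨x', hx'⟩ := hx
      obtain ⟨y', hy'⟩ := hy
      exact ⟨x' + y', by rw [tmul_add, map_add, smul_add, hx', hy', tmul_add]⟩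
    | smul a x _ hx =>
      obtain ⟨x', hx'⟩ := hx
      have h3 : ∀ (M : Type u) [AddCommGroup M] [Module R M] [Module A M] [IsScalarTower R A M]
          (m : M), tmul R R' 1 (a • m) = ((1 : R') ⊗ₜ[R] a : R' ⊗[R] A) • tmul R R' 1 m := by
        intro M _ _ _ _ m
        rw [smul_tmul, one_mul]
      haveI : SMulCommClass R' (R' ⊗[R] A) (BC R R' Y) := IsScalarTower.to_smulCommClass
      exact ⟨a • x', by rw [h3, map_smul, smul_comm, hx', h3]⟩
  -- The hypothesis on torsion makes numerators unique, so the chosen function is automatically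
  -- `A`-linear.
  choose g hg using h2
  refine ⟨s, hs, { toFun := g, map_add' := fun x y => hinj ?_, map_smul' := fun a x => hinj ?_ }, hg⟩
  · rw [tmul_add, ← hg, ← hg, ← hg, tmul_add, map_add, smul_add]
  · have h3 : ∀ (M : Type u) [AddCommGroup M] [Module R M] [Module A M] [IsScalarTower R A M]
        (m : M), tmul R R' 1 (a • m) = ((1 : R') ⊗ₜ[R] a : R' ⊗[R] A) • tmul R R' 1 m := by
      intro M _ _ _ _ m
      rw [smul_tmul, one_mul]
    haveI : SMulCommClass R' (R' ⊗[R] A) (BC R R' Y) := IsScalarTower.to_smulCommClass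
    rw [RingHom.id_apply, h3, ← hg, ← hg, h3, map_smul, smul_comm]

end BC

end Localization

end HighestWeight

end

noncomputable section

namespace HighestWeight

/-! ### Highest weight categories with a functor, in terms of modules -/

/-- A family of modules over a finite algebra, and a bimodule. -/
structure Datum (R A' : Type u) [CommRing R] [Ring A'] [Algebra R A'] (L : Type v) where
  /-- the algebra -/
  A : Type u
  [ringA : Ring A]
  [algebraA : Algebra R A]
  [finiteA : Module.Finite R A]
  /-- the bimodule -/
  B : Type u
  [addB : AddCommGroup B]
  [moduleB : Module A' B]
  [moduleRB : Module R B]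
  [moduleOpB : Module Aᵐᵒᵖ B]
  [towerB : IsScalarTower R A' B]
  [towerOpB : IsScalarTower R Aᵐᵒᵖ B]
  [commB : SMulCommClass A' Aᵐᵒᵖ B]
  [finiteB : Module.Finite A' B]
  /-- the standard modules -/
  Δ : L → Type u
  [addΔ : ∀ i, AddCommGroup (Δ i)]
  [moduleRΔ : ∀ i, Module R (Δ i)]
  [moduleΔ : ∀ i, Module A (Δ i)]
  [towerΔ : ∀ i, IsScalarTower R A (Δ i)]
  [finiteΔ : ∀ i, Module.Finite R (Δ i)]
  [freeΔ : ∀ i, Module.Free R (Δ i)]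

attribute [instance] Datum.ringA Datum.algebraA Datum.finiteA Datum.addB Datum.moduleB
  Datum.moduleRB Datum.moduleOpB Datum.towerB Datum.towerOpB Datum.commB Datum.finiteB
  Datum.addΔ Datum.moduleRΔ Datum.moduleΔ Datum.towerΔ Datum.finiteΔ Datum.freeΔ

namespace Datum

variable {R A' : Type u} [CommRing R] [Ring A'] [Algebra R A'] {L : Type v}

/-- The functor of a datum. -/
abbrev G (D : Datum R A' L) (X : Type u) [AddCommGroup X] [Module D.A X] : Type u :=
  BTensor A' D.A D.B X

/-- The action of the functor of a datum on homomorphisms. -/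
abbrev Gmap (D : Datum R A' L) {X Y : Type u} [AddCommGroup X] [Module D.A X] [AddCommGroup Y]
    [Module D.A Y] (f : X →ₗ[D.A] Y) : D.G X →ₗ[A'] D.G Y :=
  BTensor.map A' D.A D.B f

/-- Modules filtered by standard modules. -/
abbrev Filt (D : Datum R A' L) (l : List L) (X : Type u) [AddCommGroup X] [Module D.A X] : Prop :=
  FiltBy D.A D.Δ l X

section BaseChange

variable (D : Datum R A' L) (R' : Type u) [CommRing R'] [Algebra R R']

/-- The functor of a datum after base change. -/
abbrev GBC (X : Type u) [AddCommGroup X] [Module (R' ⊗[R] D.A) X] : Type u :=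
  BTensor (R' ⊗[R] A') (R' ⊗[R] D.A) (BC R R' D.B) X

/-- The action on homomorphisms of the functor of a datum after base change. -/
abbrev GBCmap {X Y : Type u} [AddCommGroup X] [Module (R' ⊗[R] D.A) X] [AddCommGroup Y]
    [Module (R' ⊗[R] D.A) Y] (f : X →ₗ[R' ⊗[R] D.A] Y) :
    D.GBC R' X →ₗ[R' ⊗[R] A'] D.GBC R' Y :=
  BTensor.map (R' ⊗[R] A') (R' ⊗[R] D.A) (BC R R' D.B) f

/-- Modules filtered by standard modules after base change. -/
abbrev FiltBC (l : List L) (X : Type u) [AddCommGroup X] [Module (R' ⊗[R] D.A) X] : Prop :=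
  FiltBy (R' ⊗[R] D.A) (fun i => BC R R' (D.Δ i)) l X

/-- `b ⊗ x` after base change. -/
abbrev tmulBC {X : Type u} [AddCommGroup X] [Module (R' ⊗[R] D.A) X] (b : BC R R' D.B) (x : X) :
    D.GBC R' X :=
  BTensor.tmul (R' ⊗[R] A') (R' ⊗[R] D.A) b x

end BaseChange

/-- The properties of a highest weight category with a Rouquier–Soergel functor. -/
structure IsRS [LinearOrder L] (D : Datum R A' L) : Prop where
  nontrivial : ∀ i, Nontrivial (D.Δ i)
  hom_le : ∀ i j (f : D.Δ i →ₗ[D.A] D.Δ j), f ≠ 0 → i ≤ j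
  end_eq : ∀ i (f : D.Δ i →ₗ[D.A] D.Δ i), ∃ r : R, ∀ x, f x = r • x
  cover : ∀ i, ∃ (P : Type u) (_ : AddCommGroup P) (_ : Module D.A P) (p : P →ₗ[D.A] D.Δ i),
    Module.Projective D.A P ∧ Module.Finite D.A P ∧ Function.Surjective p ∧
      ∃ l, (∀ j ∈ l, i < j) ∧ D.Filt l (LinearMap.ker p)
  gen : ∀ (M : Type u) [AddCommGroup M] [Module D.A M] [Module.Finite D.A M] [Nontrivial M],
    ∃ (i : L) (f : D.Δ i →ₗ[D.A] M), f ≠ 0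
  freeG : ∀ i, Module.Free R (D.G (D.Δ i))
  exact : ∀ (i : L) (l : List L) (X : Type u) [AddCommGroup X] [Module D.A X]
    (g : X →ₗ[D.A] D.Δ i), Function.Surjective g → D.Filt l (LinearMap.ker g) →
    Function.Injective (D.Gmap (LinearMap.ker g).subtype)
  full : ∀ (X Y : Type u) [AddCommGroup X] [Module (FractionRing R ⊗[R] D.A) X] [AddCommGroup Y]
    [Module (FractionRing R ⊗[R] D.A) Y] [Module.Finite (FractionRing R ⊗[R] D.A) X]
    [Module.Finite (FractionRing R ⊗[R] D.A) Y]
    (φ : D.GBC (FractionRing R) X →ₗ[FractionRing R ⊗[R] A'] D.GBC (FractionRing R) Y),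
    ∃ f, D.GBCmap (FractionRing R) f = φ
  essSurj : ∀ (W : Type u) [AddCommGroup W] [Module (FractionRing R ⊗[R] A') W]
    [Module.Finite (FractionRing R ⊗[R] A') W],
    ∃ (X : Type u) (_ : AddCommGroup X) (_ : Module (FractionRing R ⊗[R] D.A) X),
      Module.Finite (FractionRing R ⊗[R] D.A) X ∧
      Nonempty (D.GBC (FractionRing R) X ≃ₗ[FractionRing R ⊗[R] A'] W)
  subsingleton : ∀ (X : Type u) [AddCommGroup X] [Module (FractionRing R ⊗[R] D.A) X]
    [Module.Finite (FractionRing R ⊗[R] D.A) X], Subsingleton (D.GBC (FractionRing R) X) →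
    Subsingleton X
  faithful : ∀ (q : Ideal R) [q.IsPrime], q.height ≤ 2 → ∀ (X Y : Type u)
    [AddCommGroup X] [Module (q.ResidueField ⊗[R] D.A) X] [AddCommGroup Y]
    [Module (q.ResidueField ⊗[R] D.A) Y] (l l' : List L), D.FiltBC q.ResidueField l X →
    D.FiltBC q.ResidueField l' Y → ∀ f : X →ₗ[q.ResidueField ⊗[R] D.A] Y,
    D.GBCmap q.ResidueField f = 0 → f = 0

variable {D : Datum R A' L}

instance finite_Δ (i : L) : Module.Finite D.A (D.Δ i) :=
  Module.Finite.of_restrictScalars_finite R D.A (D.Δ i)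

theorem finite_G [Module.Finite R A'] (X : Type u) [AddCommGroup X] [Module D.A X]
    [Module.Finite D.A X] : Module.Finite R (D.G X) :=
  haveI := BTensor.finite A' D.A D.B (M := X)
  Module.Finite.trans A' _

theorem isNoetherianRing_A [IsNoetherianRing R] : IsNoetherianRing D.A :=
  IsNoetherianRing.of_finite R D.A

/-! #### Progenerators -/

variable [LinearOrder L]

theorem IsRS.exists_cover (hD : D.IsRS) (i : L) : ∃ (P : Type u) (_ : AddCommGroup P)
    (_ : Module R P) (_ : Module D.A P) (_ : IsScalarTower R D.A P) (p : P →ₗ[D.A] D.Δ i),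
    Module.Projective D.A P ∧ Module.Finite D.A P ∧ Function.Surjective p ∧
      ∃ l, (∀ j ∈ l, i < j) ∧ D.Filt l (LinearMap.ker p) := by
  obtain ⟨P, _, _, p, h⟩ := hD.cover i
  letI : Module R P := Module.restrictScalars R D.A P
  exact ⟨P, _, _, _, IsScalarTower.restrictScalars R D.A P, p, h⟩

/-- Finite modules are quotients of filtered projectives. -/
theorem IsRS.exists_projective [IsNoetherianRing R] (hD : D.IsRS) (M : Type u) [AddCommGroup M]
    [Module D.A M] [Module.Finite D.A M] :
    ∃ (P : Type u) (_ : AddCommGroup P) (_ : Module R P) (_ : Module D.A P)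
      (_ : IsScalarTower R D.A P) (p : P →ₗ[D.A] M),
      Module.Projective D.A P ∧ Module.Finite D.A P ∧ Function.Surjective p ∧
        ∃ l, D.Filt l P := by
  haveI := D.isNoetherianRing_A
  -- Among images of filtered projectives a maximal one `N` exists. If it were proper, a nonzero map
  -- from a standard module to `M/N` would lift to the projective cover of that standard module, and
  -- adding its image would enlarge `N`.
  let S : Set (Submodule D.A M) := {N | ∃ (P : Type u) (_ : AddCommGroup P) (_ : Module R P)
    (_ : Module D.A P) (_ : IsScalarTower R D.A P) (p : P →ₗ[D.A] M),
      Module.Projective D.A P ∧ Module.Finite D.A P ∧ LinearMap.range p = N ∧ ∃ l, D.Filt l P}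
  have hS : S.Nonempty := ⟨⊥, PUnit, inferInstance, inferInstance, inferInstance, inferInstance, 0,
    inferInstance, inferInstance, LinearMap.range_zero, [], (inferInstance : Subsingleton PUnit)⟩
  obtain ⟨N, ⟨P, _, _, _, _, p, hP, hPf, hN, l, hl⟩, hmax⟩ :=
    set_has_maximal_iff_noetherian.2 (inferInstance : IsNoetherian D.A M) S hS
  refine ⟨P, _, _, _, ‹_›, p, hP, hPf, LinearMap.range_eq_top.1 ?_, l, hl⟩
  rw [hN]
  by_contra hne
  haveI : Nontrivial (M ⧸ N) := Submodule.Quotient.nontrivial_iff.2 hne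
  obtain ⟨i, f, hf⟩ := hD.gen (M ⧸ N)
  obtain ⟨Q, _, _, _, _, q, hQ, hQf, hq, l', hl', hQl⟩ := hD.exists_cover i
  obtain ⟨g, hg⟩ := Module.projective_lifting_property N.mkQ (f ∘ₗ q) N.mkQ_surjective
  refine hmax (LinearMap.range (p.coprod g)) ⟨P × Q, _, _, _, inferInstance, p.coprod g,
    inferInstance, inferInstance, rfl, _,
    hl.prod (l₂ := i :: l') ⟨q, hq, hQl⟩⟩ ?_
  refine lt_of_le_of_ne ?_ fun h => hf ?_
  · rw [← hN]
    rintro _ ⟨x, rfl⟩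
    exact ⟨(x, 0), by simp⟩
  · ext x
    obtain ⟨y, rfl⟩ := hq x
    have h1 : g y ∈ N := by rw [h]; exact ⟨(0, y), by simp⟩
    have h2 := LinearMap.congr_fun hg y
    rw [LinearMap.comp_apply, LinearMap.comp_apply, Submodule.mkQ_apply,
      (Submodule.Quotient.mk_eq_zero N).2 h1] at h2
    rw [← h2, LinearMap.zero_apply]

end Datum

/-! ### Orbit maps and denominators -/

section

variable {R : Type u} [CommRing R] {R' : Type u} [CommRing R'] [Algebra R R']
variable {A A' B : Type u} [Ring A] [Algebra R A] [Ring A'] [Algebra R A'] [AddCommGroup B]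
  [Module A' B] [Module Aᵐᵒᵖ B] [Module R B] [IsScalarTower R A' B] [IsScalarTower R Aᵐᵒᵖ B]
variable {X Y : Type u} [AddCommGroup X] [Module (R' ⊗[R] A) X]

/-- An element of `R' ⊗_R X` as an element of the tensor product. -/
def BC.toTensor {X : Type u} [AddCommGroup X] [Module R X] (z : BC R R' X) : R' ⊗[R] X := z

/-- An element of the tensor product as an element of `R' ⊗_R X`. -/
def BC.ofTensor {X : Type u} [AddCommGroup X] [Module R X] (z : R' ⊗[R] X) : BC R R' X := z

theorem BC.smul_self (w z : R' ⊗[R] A) : w • BC.ofTensor z = BC.ofTensor (w * z) := by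
  change BC.actHom R R' A A w z = (w * z : R' ⊗[R] A)
  induction z using TensorProduct.induction_on with
  | zero => rw [map_zero, mul_zero]
  | add x y hx hy => rw [map_add, hx, hy, mul_add]
  | tmul s a =>
    induction w using TensorProduct.induction_on with
    | zero => rw [map_zero, zero_mul]; rfl
    | add x y hx hy => rw [map_add, LinearMap.add_apply, hx, hy, add_mul]
    | tmul r b => rw [Algebra.TensorProduct.tmul_mul_tmul]; rfl

/-- The homomorphism from the regular module, given by an element. -/
def BC.orbit (x : X) : BC R R' A →ₗ[R' ⊗[R] A] X where
  toFun z := BC.toTensor z • x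
  map_add' y z := add_smul _ _ _
  map_smul' w z := by
    change BC.toTensor (w • BC.ofTensor (BC.toTensor z)) • x = _
    rw [BC.smul_self]
    exact mul_smul _ _ _

theorem BC.orbit_apply (x : X) (z : BC R R' A) : BC.orbit x z = BC.toTensor z • x := rfl

variable [SMulCommClass A' Aᵐᵒᵖ B]

theorem BC.tmul_base_smul (c : BC R R' B) (r : R') (x : X) :
    BTensor.tmul (R' ⊗[R] A') (R' ⊗[R] A) c ((r ⊗ₜ[R] (1 : A) : R' ⊗[R] A) • x) =
      (r ⊗ₜ[R] (1 : A') : R' ⊗[R] A') • BTensor.tmul (R' ⊗[R] A') (R' ⊗[R] A) c x := by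
  rw [← BTensor.op_smul_tmul, BC.op_algebraMap_smul, BTensor.smul_tmul, BC.smul_eq_tmul_one_smul]

/-- An element killed by all `1 ⊗ b` is killed by `R' ⊗ B`. -/
theorem BC.tmul_eq_zero {x : X}
    (h : ∀ b : B, BTensor.tmul (R' ⊗[R] A') (R' ⊗[R] A) (BC.tmul R R' 1 b) x = 0)
    (c : BC R R' B) : BTensor.tmul (R' ⊗[R] A') (R' ⊗[R] A) c x = 0 := by
  induction c using BC.induction_on with
  | zero => exact BTensor.zero_tmul x
  | add c d hc hd => rw [BTensor.add_tmul, hc, hd, add_zero]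
  | tmul r b =>
    rw [BC.tmul_eq_smul, ← BC.smul_eq_tmul_one_smul (A := A'), ← BTensor.smul_tmul, h, smul_zero]

/-- `b ⊗ x` as an `R`-linear function of `x`. -/
def BTensor.tmulRight (A' A : Type u) {B : Type u} {X : Type u} [Ring A] [Algebra R A] [Ring A']
    [Algebra R A'] [AddCommGroup B]
    [Module A' B] [Module Aᵐᵒᵖ B] [Module R B] [IsScalarTower R A' B] [IsScalarTower R Aᵐᵒᵖ B]
    [AddCommGroup X] [Module R X] [Module A X] [IsScalarTower R A X] (b : B) :
    X →ₗ[R] BTensor A' A B X where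
  toFun x := BTensor.tmul A' A b x
  map_add' x y := BTensor.tmul_add b x y
  map_smul' r x := BTensor.tmul_smul_base r b x

theorem baseChangeTensor_lTensor {X : Type u} [AddCommGroup X] [Module R X] [Module A X]
    [IsScalarTower R A X] (b : B) (z : R' ⊗[R] X) :
    baseChangeTensor R R' A A' B X (BC.ofTensor ((BTensor.tmulRight A' A b).lTensor R' z)) =
      BTensor.tmul (R' ⊗[R] A') (R' ⊗[R] A) (BC.tmul R R' 1 b) (BC.ofTensor z) := by
  induction z using TensorProduct.induction_on with
  | zero => rw [map_zero]; exact (map_zero _).trans (BTensor.tmul_zero _).symm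
  | add x y hx hy =>
    rw [map_add]
    exact ((map_add _ _ _).trans (congrArg₂ _ hx hy)).trans (BTensor.tmul_add _ _ _).symm
  | tmul r x =>
    rw [LinearMap.lTensor_tmul]
    change baseChangeTensorHom R R' A A' B X (BC.tmul R R' r (BTensor.tmul A' A b x)) = _
    rw [baseChangeTensorHom_tmul]
    change _ = BTensor.tmul _ _ _ (BC.tmul R R' r x)
    rw [BC.tmul_eq_smul r x, ← BC.smul_eq_tmul_one_smul (A := A), BC.tmul_base_smul,
      BTensor.smul_tmul, BC.smul_tmul, one_smul, mul_one]

end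

/-! ### Left inverses modulo a prime -/

section

variable {R : Type u} [CommRing R]

theorem exists_common_denominator (q : Ideal R) [q.IsPrime] {ι : Type*} [Finite ι]
    (w : ι → q.ResidueField) :
    ∃ s ∉ q, ∃ r : ι → R, ∀ i, algebraMap R _ s * w i = algebraMap R _ (r i) := by
  classical
  have h1 : ∀ z : q.ResidueField, ∃ s ∉ q, ∃ r, algebraMap R _ s * z = algebraMap R _ r := by
    intro z
    obtain ⟨⟨a, b⟩, h⟩ := IsLocalization.surj (nonZeroDivisors (R ⧸ q)) z
    obtain ⟨a, rfl⟩ := Ideal.Quotient.mk_surjective a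
    obtain ⟨b, hb⟩ := b
    obtain ⟨b, rfl⟩ := Ideal.Quotient.mk_surjective b
    refine ⟨b, fun hbq => ?_, a, ?_⟩
    · exact nonZeroDivisors.ne_zero hb (Ideal.Quotient.eq_zero_iff_mem.2 hbq)
    · rw [mul_comm]
      exact h
  choose s hs r hr using h1
  cases nonempty_fintype ι
  refine ⟨∏ i, s (w i), ?_, fun i => (∏ j ∈ Finset.univ.erase i, s (w j)) * r (w i), fun i => ?_⟩
  · rw [Ideal.IsPrime.prod_mem_iff]
    push Not
    exact fun i _ => hs _
  · rw [← Finset.prod_erase_mul _ _ (Finset.mem_univ i), map_mul, mul_assoc, hr, ← map_mul]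

/-- Clearing denominators in `W` gives `V'` over `R` with `V' U` equal over the residue field to a
nonzero scalar. Hence `det (V' U) ∉ q`, and multiplying by the adjugate gives an exact identity over
`R`, whose multiplier is this determinant. -/
theorem exists_leftInverse_matrix (q : Ideal R) [q.IsPrime] {m n : Type*} [Fintype m] [Fintype n]
    [DecidableEq n] (U : Matrix m n R) (W : Matrix n m q.ResidueField)
    (h : W * U.map (algebraMap R q.ResidueField) = 1) :
    ∃ s ∉ q, ∃ V : Matrix n m R, V * U = s • (1 : Matrix n n R) := by
  obtain ⟨s, hs, V, hV⟩ := exists_common_denominator q fun p : n × m => W p.1 p.2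
  let V' : Matrix n m R := fun i j => V (i, j)
  have h1 : V'.map (algebraMap R q.ResidueField) = algebraMap R q.ResidueField s • W := by
    ext i j
    exact (hV (i, j)).symm
  have h2 : (V' * U).map (algebraMap R q.ResidueField) =
      algebraMap R q.ResidueField s • (1 : Matrix n n _) := by
    rw [Matrix.map_mul, h1, Matrix.smul_mul, h]
  refine ⟨(V' * U).det, fun hd => ?_, (V' * U).adjugate * V', ?_⟩
  · have h3 : algebraMap R q.ResidueField (V' * U).det = 0 := by
      rwa [Ideal.algebraMap_residueField_eq_zero]
    rw [RingHom.map_det, RingHom.mapMatrix_apply, h2, Matrix.det_smul, Matrix.det_one, mul_one]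
      at h3
    exact hs (Ideal.algebraMap_residueField_eq_zero.1 (eq_zero_of_pow_eq_zero h3))
  · rw [Matrix.mul_assoc, Matrix.adjugate_mul]

/-- A homomorphism of free modules that is injective at a prime is split injective up to a
multiplier outside of the prime. -/
theorem exists_leftInverse_of_injective (q : Ideal R) [q.IsPrime] {M N : Type*} [AddCommGroup M]
    [Module R M] [AddCommGroup N] [Module R N] [Module.Free R M] [Module.Finite R M]
    [Module.Free R N] [Module.Finite R N] (f : M →ₗ[R] N)
    (hf : Function.Injective (f.baseChange q.ResidueField)) :
    ∃ s ∉ q, ∃ g : N →ₗ[R] M, ∀ x, g (f x) = s • x := by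
  classical
  let b := Module.Free.chooseBasis R M
  let c := Module.Free.chooseBasis R N
  obtain ⟨w, hw⟩ := LinearMap.exists_leftInverse_of_injective _ (LinearMap.ker_eq_bot.2 hf)
  have h1 : LinearMap.toMatrix (Algebra.TensorProduct.basis q.ResidueField c)
      (Algebra.TensorProduct.basis q.ResidueField b) w *
      (LinearMap.toMatrix b c f).map (algebraMap R q.ResidueField) = 1 := by
    rw [← LinearMap.toMatrix_baseChange, ← LinearMap.toMatrix_comp, hw, LinearMap.toMatrix_id]
  obtain ⟨s, hs, V, hV⟩ := exists_leftInverse_matrix q _ _ h1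
  refine ⟨s, hs, Matrix.toLin c b V, fun x => ?_⟩
  have h2 : Matrix.toLin c b V ∘ₗ f = s • LinearMap.id := by
    apply (LinearMap.toMatrix b b).injective
    rw [LinearMap.toMatrix_comp b c b, LinearMap.toMatrix_toLin, hV, map_smul, LinearMap.toMatrix_id]
  exact LinearMap.congr_fun h2 x

end

end HighestWeight

end

noncomputable section

namespace HighestWeight

namespace Datum

/-! #### Standard modules at primes of height at most two -/

section

variable {R A' : Type u} [CommRing R] [Ring A'] [Algebra R A'] {L : Type v} [LinearOrder L]
variable {D : Datum R A' L}

/-- Faithfulness is assumed for filtered modules only, so the orbit map of `y` on the regular module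
is first composed with a surjection from a filtered projective. The functor kills the composite, so
it vanishes, and `y` is in its image. -/
theorem IsRS.residue_injective [IsNoetherianRing R] (hD : D.IsRS) (q : Ideal R) [q.IsPrime]
    (hq : q.height ≤ 2) (i : L) (y : BC R q.ResidueField (D.Δ i))
    (h : ∀ b : D.B, D.tmulBC q.ResidueField (BC.tmul R q.ResidueField 1 b) y = 0) : y = 0 := by
  obtain ⟨P, _, _, _, _, p, -, -, hp, l, hl⟩ := hD.exists_projective D.A
  have h0 : BC.orbit y ∘ₗ BC.map R q.ResidueField p = 0 := by
    refine hD.faithful q hq _ _ l [i] hl.baseChange (FiltBy.singleton i) _ (BTensor.ext fun c x => ?_)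
    rw [BTensor.map_tmul, LinearMap.comp_apply, BC.orbit_apply, ← BTensor.op_smul_tmul,
      BC.tmul_eq_zero h, LinearMap.zero_apply]
  obtain ⟨x, hx⟩ := BC.map_surjective (R' := q.ResidueField) hp
    (BC.ofTensor (1 : q.ResidueField ⊗[R] D.A))
  have h1 := LinearMap.congr_fun h0 x
  rw [LinearMap.comp_apply, hx, BC.orbit_apply] at h1
  exact (one_smul _ y).symm.trans h1

theorem tmulBC_eq_zero {R' : Type u} [CommRing R'] [Algebra R R'] {X : Type u} [AddCommGroup X]
    [Module (R' ⊗[R] D.A) X] {y : X} {s : Set D.B} (hs : Submodule.span A' s = ⊤)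
    (h : ∀ b ∈ s, D.tmulBC R' (BC.tmul R R' 1 b) y = 0) (b : D.B) :
    D.tmulBC R' (BC.tmul R R' 1 b) y = 0 := by
  have hb : b ∈ Submodule.span A' s := hs ▸ Submodule.mem_top
  induction hb using Submodule.span_induction with
  | mem x hx => exact h x hx
  | zero => rw [BC.tmul_zero]; exact BTensor.zero_tmul y
  | add b c _ _ hb hc => rw [BC.tmul_add]; exact (BTensor.add_tmul _ _ _).trans ((congrArg₂ _ hb hc).trans (add_zero _))
  | smul a b _ hb =>
    have h1 : BC.tmul R R' 1 (a • b) = ((1 : R') ⊗ₜ[R] a : R' ⊗[R] A') • BC.tmul R R' 1 b := by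
      rw [BC.smul_tmul, one_mul]
    rw [h1]
    exact (congrArg (fun z => ((1 : R') ⊗ₜ[R] a : R' ⊗[R] A') • z) hb).trans (smul_zero _)

/-- For generators `b j` of `B`, the map `x ↦ (b j ⊗ x)_j` joins free `R`-modules and is injective
over the residue field of `q` by `IsRS.residue_injective`. It therefore splits up to a multiplier
outside `q`. -/
theorem IsRS.exists_retraction [IsNoetherianRing R] [Module.Finite R A'] (hD : D.IsRS)
    (q : Ideal R) [q.IsPrime] (hq : q.height ≤ 2) (i : L) :
    ∃ (k : ℕ) (b : Fin k → D.B), ∃ s ∉ q, ∃ v : (Fin k → D.G (D.Δ i)) →ₗ[R] D.Δ i,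
      ∀ x, v (fun j => BTensor.tmul A' D.A (b j) x) = s • x := by
  obtain ⟨k, b, hb⟩ := Module.Finite.exists_fin (R := A') (M := D.B)
  haveI := hD.freeG i
  haveI := D.finite_G (D.Δ i)
  let f : D.Δ i →ₗ[R] (Fin k → D.G (D.Δ i)) :=
    LinearMap.pi fun j => BTensor.tmulRight A' D.A (b j)
  obtain ⟨s, hs, v, hv⟩ := exists_leftInverse_of_injective q f (by
    rw [injective_iff_map_eq_zero]
    intro y hy
    refine hD.residue_injective q hq i (BC.ofTensor y) (tmulBC_eq_zero hb ?_)
    rintro _ ⟨j, rfl⟩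
    have h1 : (BTensor.tmulRight A' D.A (X := D.Δ i) (b j)).lTensor q.ResidueField y = 0 := by
      have h2 : BTensor.tmulRight A' D.A (X := D.Δ i) (b j) = LinearMap.proj j ∘ₗ f := rfl
      rw [h2, LinearMap.lTensor_comp, LinearMap.comp_apply]
      have h3 : f.lTensor q.ResidueField y = 0 := hy
      rw [h3, map_zero]
    rw [tmulBC, ← baseChangeTensor_lTensor, h1]
    exact map_zero _)
  exact ⟨k, b, s, hs, v, hv⟩

end

/-! #### Divisibility is detected by the functor -/

section

variable {R A' : Type u} [CommRing R] [Ring A'] [Algebra R A'] {L : Type v}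

/-- Divisibility by the ideal `I` in `X` is detected after applying the functor. -/
def Detects (D : Datum R A' L) (I : Ideal R) (X : Type u) [AddCommGroup X] [Module R X]
    [Module D.A X] : Prop :=
  ∀ x : X, (∀ b : D.B, BTensor.tmul A' D.A b x ∈ (I • ⊤ : Submodule R (D.G X))) →
    x ∈ (I • ⊤ : Submodule R X)

theorem map_mem_smul_top {M N : Type*} [AddCommGroup M] [Module R M] [AddCommGroup N] [Module R N]
    (f : M →ₗ[R] N) (I : Ideal R) {x : M} (hx : x ∈ (I • ⊤ : Submodule R M)) :
    f x ∈ (I • ⊤ : Submodule R N) := by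
  have := Submodule.mem_map_of_mem (f := f) hx
  rw [Submodule.map_smul''] at this
  exact Submodule.smul_mono le_rfl le_top this

variable {D : Datum R A' L} {X Y : Type u} [AddCommGroup X] [Module R X] [Module D.A X]
  [IsScalarTower R D.A X] [AddCommGroup Y] [Module R Y] [Module D.A Y] [IsScalarTower R D.A Y]

end

end Datum

/-! ### Splittings over the base ring of sequences with projective quotient. -/

section

variable {R : Type*} [CommRing R] {K X Z : Type*} [AddCommGroup K] [Module R K]
  [AddCommGroup X] [Module R X] [AddCommGroup Z] [Module R Z]

theorem exists_splitting [Module.Projective R Z] {f : K →ₗ[R] X} {g : X →ₗ[R] Z}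
    (hf : Function.Injective f) (hg : Function.Surjective g) (hfg : Function.Exact f g) :
    ∃ (r : X →ₗ[R] K) (σ : Z →ₗ[R] X), ∀ x, f (r x) + σ (g x) = x := by
  obtain ⟨σ, hσ⟩ := Module.projective_lifting_property g LinearMap.id hg
  have h1 : ∀ z, g (σ z) = z := LinearMap.congr_fun hσ
  have h2 : ∀ x, ∃ k, f k = x - σ (g x) := fun x =>
    (hfg _).1 (by rw [map_sub, h1, sub_self])
  choose r hr using h2
  refine ⟨{ toFun := r, map_add' := fun x y => hf ?_, map_smul' := fun a x => hf ?_ }, σ,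
    fun x => ?_⟩
  · simp only [map_add, hr]; abel
  · simp only [map_smul, hr, RingHom.id_apply, smul_sub]
  · change f (r x) + _ = _
    rw [hr, sub_add_cancel]

theorem projective_of_exact [Module.Projective R K] [Module.Projective R Z] {f : K →ₗ[R] X}
    {g : X →ₗ[R] Z} (hf : Function.Injective f) (hg : Function.Surjective g)
    (hfg : Function.Exact f g) : Module.Projective R X := by
  obtain ⟨r, σ, h⟩ := exists_splitting hf hg hfg
  exact Module.Projective.of_split (r.prod g) (f.coprod σ) (LinearMap.ext h)

end

section

variable {R A' : Type*} [CommRing R] [Ring A'] [Algebra R A'] {K X Z : Type*} [AddCommGroup K]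
  [Module R K] [Module A' K] [IsScalarTower R A' K] [AddCommGroup X] [Module R X] [Module A' X]
  [IsScalarTower R A' X] [AddCommGroup Z] [Module R Z] [Module A' Z] [IsScalarTower R A' Z]

theorem exists_splitting_restrictScalars [Module.Projective R Z] {f : K →ₗ[A'] X} {g : X →ₗ[A'] Z}
    (hf : Function.Injective f) (hg : Function.Surjective g) (hfg : Function.Exact f g) :
    ∃ (r : X →ₗ[R] K) (σ : Z →ₗ[R] X), ∀ x, f (r x) + σ (g x) = x :=
  exists_splitting (f := f.restrictScalars R) (g := g.restrictScalars R) hf hg hfg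

theorem projective_restrictScalars_of_exact [Module.Projective R K] [Module.Projective R Z]
    {f : K →ₗ[A'] X} {g : X →ₗ[A'] Z}
    (hf : Function.Injective f) (hg : Function.Surjective g) (hfg : Function.Exact f g) :
    Module.Projective R X :=
  projective_of_exact (f := f.restrictScalars R) (g := g.restrictScalars R) hf hg hfg

end

theorem BTensor.subsingleton {A' A B X : Type u} [Ring A'] [Ring A] [AddCommGroup B] [Module A' B]
    [Module Aᵐᵒᵖ B] [AddCommGroup X] [Module A X] [Subsingleton X] :
    Subsingleton (BTensor A' A B X) := by
  have h : ∀ z : BTensor A' A B X, z = 0 := fun z => by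
    induction z using BTensor.induction_on with
    | zero => rfl
    | tmul b x => rw [Subsingleton.elim x 0, BTensor.tmul_zero]
    | add x y hx hy => rw [hx, hy, add_zero]
  exact ⟨fun a b => by rw [h a, h b]⟩

/-! ### Detection of divisibility on filtered modules. -/

namespace Datum

section

variable {R A' : Type u} [CommRing R] [Ring A'] [Algebra R A'] {L : Type v} [LinearOrder L]
variable {D : Datum R A' L}

theorem IsRS.projective_G (hD : D.IsRS) {l : List L} :
    ∀ {X : Type u} [AddCommGroup X] [Module R X] [Module D.A X] [IsScalarTower R D.A X],
    D.Filt l X → Module.Projective R X ∧ Module.Projective R (D.G X) := by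
  induction l with
  | nil =>
    intro X _ _ _ _ h
    haveI : Subsingleton X := h
    haveI : Subsingleton (D.G X) := BTensor.subsingleton
    exact ⟨inferInstance, inferInstance⟩
  | cons i l ih =>
    rintro X _ _ _ _ ⟨g, hg, h⟩
    obtain ⟨h1, h2⟩ := ih h
    haveI := hD.freeG i
    have hex : Function.Exact (LinearMap.ker g).subtype g := LinearMap.exact_subtype_ker_map g
    exact ⟨projective_restrictScalars_of_exact Subtype.val_injective hg hex,
      projective_restrictScalars_of_exact (hD.exact i l X g hg h) (BTensor.map_surjective hg)
        (BTensor.map_exact hg hex)⟩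

/-- The retraction `r` is only `R`-linear, which is enough for moving divisibility statements from
`G X` down to `G (ker g)`. -/
theorem IsRS.exists_splitting (hD : D.IsRS) {i : L} {l : List L} {X : Type u} [AddCommGroup X]
    [Module R X] [Module D.A X] [IsScalarTower R D.A X] {g : X →ₗ[D.A] D.Δ i}
    (hg : Function.Surjective g) (h : D.Filt l (LinearMap.ker g)) :
    ∃ (r : D.G X →ₗ[R] D.G (LinearMap.ker g)) (σ : D.G (D.Δ i) →ₗ[R] D.G X),
      ∀ z, D.Gmap (LinearMap.ker g).subtype (r z) + σ (D.Gmap g z) = z :=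
  haveI := hD.freeG i
  exists_splitting_restrictScalars (hD.exact i l X g hg h) (BTensor.map_surjective hg)
    (BTensor.map_exact hg (LinearMap.exact_subtype_ker_map g))

variable [IsNoetherianRing R] [Module.Finite R A']

/-- If a coordinate of `x` is not in `I`, all `s` multiplying it into `I` lie in one prime `q` of
height at most 2. But the retraction at `q` recovers `s x`, with `s ∉ q`, linearly from the elements
`b ⊗ x`, so `s x` is divisible by `I`. -/
theorem IsRS.detects_Δ (hD : D.IsRS) {I : Ideal R} (hI : AssHeightLE I 2) (i : L) :
    D.Detects I (D.Δ i) := by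
  intro x hx
  let b := Module.Free.chooseBasis R (D.Δ i)
  have hmem : ∀ y : D.Δ i, y ∈ (I • ⊤ : Submodule R (D.Δ i)) ↔ ∀ j, b.repr y j ∈ I := by
    intro y
    refine ⟨fun hy j => ?_, fun hy => ?_⟩
    · have := map_mem_smul_top (b.coord j) I hy
      rwa [smul_eq_mul, Ideal.mul_top] at this
    · rw [← b.sum_repr y]
      exact Submodule.sum_mem _ fun j _ => Submodule.smul_mem_smul (hy j) trivial
  rw [hmem]
  intro j
  by_contra hj
  obtain ⟨q, hq, hq2, hqI⟩ := hI _ hj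
  obtain ⟨k, c, s, hs, v, hv⟩ := hD.exists_retraction q hq2 i
  refine hs (hqI s ?_)
  have h1 : s • x ∈ (I • ⊤ : Submodule R (D.Δ i)) := by
    rw [← hv]
    refine map_mem_smul_top v I ?_
    rw [← Finset.univ_sum_single fun j => BTensor.tmul A' D.A (c j) x]
    exact Submodule.sum_mem _ fun j _ => map_mem_smul_top
      (LinearMap.single R (fun _ => D.G (D.Δ i)) j) I (hx (c j))
  simpa using (hmem _).1 h1 j

/-- Dévissage along the top factor. Divisibility of `g x` lifts to some `y ∈ I X` with the same
image, and the difference `x - y` lies in the kernel, where the induction hypothesis applies. -/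
theorem IsRS.detects (hD : D.IsRS) {I : Ideal R} (hI : AssHeightLE I 2) {l : List L} :
    ∀ {X : Type u} [AddCommGroup X] [Module R X] [Module D.A X] [IsScalarTower R D.A X],
    D.Filt l X → D.Detects I X := by
  induction l with
  | nil =>
    intro X _ _ _ _ h x _
    haveI : Subsingleton X := h
    rw [Subsingleton.elim x 0]
    exact zero_mem _
  | cons i l ih =>
    rintro X _ _ _ _ ⟨g, hg, h⟩ x hx
    have hex : Function.Exact (LinearMap.ker g).subtype g := LinearMap.exact_subtype_ker_map g
    have h1 : g x ∈ (I • ⊤ : Submodule R (D.Δ i)) := hD.detects_Δ hI i (g x) fun b =>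
      map_mem_smul_top ((D.Gmap g).restrictScalars R) I (hx b)
    have h2 : (I • ⊤ : Submodule R (D.Δ i)) =
        (I • ⊤ : Submodule R X).map (g.restrictScalars R) := by
      rw [Submodule.map_smul'', Submodule.map_top, LinearMap.range_eq_top.2]
      exact hg
    rw [h2] at h1
    obtain ⟨y, hy, hyx⟩ := h1
    have hyx : g y = g x := hyx
    let k : LinearMap.ker g := ⟨x - y, by rw [LinearMap.mem_ker, map_sub, hyx, sub_self]⟩
    obtain ⟨r, σ, hr⟩ := hD.exists_splitting hg h
    have h3 : k ∈ (I • ⊤ : Submodule R (LinearMap.ker g)) := by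
      refine ih h k fun b => ?_
      have h4 : BTensor.tmul A' D.A b (x - y) ∈ (I • ⊤ : Submodule R (D.G X)) := by
        rw [BTensor.tmul_sub]
        exact sub_mem (hx b) (map_mem_smul_top (BTensor.tmulRight A' D.A b) I hy)
      -- The component along `σ` vanishes because `g (x - y) = 0`, so `r` returns the preimage in `G
      -- (ker g)`.
      have h5 : r (BTensor.tmul A' D.A b (x - y)) = BTensor.tmul A' D.A b k := by
        apply hD.exact i l X g hg h
        refine ((eq_sub_of_add_eq (hr _)).trans ?_)
        change _ - σ (BTensor.tmul A' D.A b (g (x - y))) = BTensor.tmul A' D.A b (x - y)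
        rw [map_sub, hyx, sub_self, BTensor.tmul_zero, map_zero, sub_zero]
      rw [← h5]
      exact map_mem_smul_top r I h4
    have h6 := map_mem_smul_top ((LinearMap.ker g).subtype.restrictScalars R) I h3
    have h7 := add_mem h6 hy
    have h8 : (LinearMap.ker g).subtype k + y = x := sub_add_cancel x y
    exact h8 ▸ h7

end

/-! #### Filtered modules are determined by the functor -/

section

variable {R A' : Type u} [CommRing R] [Ring A'] [Algebra R A'] {L : Type v} [LinearOrder L]
variable {D : Datum R A' L} [IsNoetherianRing R] [IsDomain R] [Module.Finite R A']

/-- Over the fraction field, `f` becomes a map from the image of the regular module to the image of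
`X`. Fullness writes it as tensoring with the element `φ 1`, whose denominator is `s`. -/
theorem IsRS.exists_smul_eq_tmul (hD : D.IsRS) {X : Type u} [AddCommGroup X] [Module R X]
    [Module D.A X] [IsScalarTower R D.A X] [Module.Finite D.A X]
    [Module.Projective R (D.G X)] (f : D.B →ₗ[A'] D.G X) :
    ∃ s : R, s ≠ 0 ∧ ∃ x : X, ∀ b, s • f b = BTensor.tmul A' D.A b x := by
  let F := FractionRing R
  haveI : Module.Finite R X := Module.Finite.trans D.A X
  haveI := BC.finite R F D.A X
  obtain ⟨φ, hφ⟩ := hD.full (F ⊗[R] D.A) (BC R F X)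
    ((baseChangeTensor R F D.A A' D.B X).toLinearMap ∘ₗ BC.map R F f ∘ₗ
      (BTensor.rid (F ⊗[R] A') (F ⊗[R] D.A) (BC R F D.B)).toLinearMap)
  obtain ⟨s, hs, x, hx⟩ := BC.exists_smul_eq (nonZeroDivisors R) (φ 1)
  refine ⟨s, nonZeroDivisors.ne_zero hs, x, fun b => ?_⟩
  have h1 := LinearMap.congr_fun hφ (BTensor.tmul _ _ (BC.tmul R F 1 b) 1)
  rw [BTensor.map_tmul, LinearMap.comp_apply, LinearMap.comp_apply, LinearEquiv.coe_coe,
    LinearEquiv.coe_coe, BTensor.rid_tmul, MulOpposite.op_one, one_smul, BC.map_tmul] at h1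
  have h2 : baseChangeTensor R F D.A A' D.B X (BC.tmul R F 1 (s • f b)) =
      baseChangeTensor R F D.A A' D.B X (BC.tmul R F 1 (BTensor.tmul A' D.A b x)) := by
    rw [BC.tmul_smul, ← BC.smul_eq_tmul_one_smul (A := A'), map_smul, ← h1, ← BC.tmul_base_smul,
      BC.smul_eq_tmul_one_smul, hx, baseChangeTensor_tmul]
  exact BC.tmul_one_injective (nonZeroDivisors R)
    (fun s hs x hx => (smul_eq_zero.1 hx).resolve_left (nonZeroDivisors.ne_zero hs))
    ((baseChangeTensor R F D.A A' D.B X).injective h2)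

/-- Injectivity of the unit is detection for the zero ideal. For surjectivity, a nonzero multiple `s
f` is given by some `x`; detection for `(s)` shows `x = s y`, and `s` cancels because `G X` is
torsion-free. -/
theorem IsRS.isGood (hD : D.IsRS) (hreg : ∀ x : R, x ≠ 0 → AssHeightLE (Ideal.span {x}) 1)
    {l : List L} {X : Type u} [AddCommGroup X] [Module R X] [Module D.A X] [IsScalarTower R D.A X]
    (hX : D.Filt l X) : BTensor.IsGood A' D.A D.B X := by
  obtain ⟨hpX, hpG⟩ := hD.projective_G hX
  haveI : Module.Finite D.A X := hX.finite
  constructor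
  · rw [injective_iff_map_eq_zero]
    intro x hx
    have := hD.detects (assHeightLE_bot.mono (by simp)) hX x fun b => by
      have : BTensor.tmul A' D.A b x = 0 := LinearMap.congr_fun hx b
      rw [this]; exact zero_mem _
    simpa using this
  · intro f
    obtain ⟨s, hs, x, hx⟩ := hD.exists_smul_eq_tmul f
    have h1 := hD.detects ((hreg s hs).mono one_le_two) hX x fun b => by
      rw [← hx]
      exact Submodule.smul_mem_smul (Ideal.mem_span_singleton_self s) trivial
    rw [Submodule.ideal_span_singleton_smul] at h1
    obtain ⟨y, -, hy⟩ := h1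
    refine ⟨y, LinearMap.ext fun b => ?_⟩
    have hy : s • y = x := hy
    have h2 : s • f b = s • BTensor.tmul A' D.A b y := by
      rw [hx, ← hy, BTensor.tmul_smul_base]
    exact (smul_right_injective _ hs h2).symm

end

end Datum

end HighestWeight

end

noncomputable section

namespace HighestWeight

/-! ### Extensions of values of the functor -/

section

variable {R A' : Type u} [CommRing R] [Ring A'] [Algebra R A']

/-- Regularity of `y` modulo `x` is applied to each coordinate in a free module of which `M` is a
retract. -/
theorem exists_eq_smul_of_projective {M : Type*} [AddCommGroup M] [Module R M]
    [Module.Projective R M] {x y : R} (hxy : ∀ r, y * r ∈ Ideal.span {x} → r ∈ Ideal.span {x})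
    {m n : M} (h : y • m = x • n) : ∃ k, m = x • k := by
  obtain ⟨s, hs⟩ := Module.projective_def'.1 ‹Module.Projective R M›
  have h1 : s m ∈ (Ideal.span {x} • ⊤ : Submodule R (M →₀ R)) := by
    rw [← Finsupp.sum_single (s m)]
    refine Submodule.sum_mem _ fun j _ => ?_
    refine Datum.map_mem_smul_top (Finsupp.lsingle j) _ ?_
    rw [smul_eq_mul, Ideal.mul_top]
    refine hxy _ (Ideal.mem_span_singleton'.2 ⟨s n j, ?_⟩)
    have := DFunLike.congr_fun (congrArg s h) j
    rw [map_smul, map_smul, Finsupp.smul_apply, Finsupp.smul_apply, smul_eq_mul, smul_eq_mul] at this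
    rw [this, mul_comm]
  have h2 := Datum.map_mem_smul_top (Finsupp.linearCombination R id) _ h1
  have h3 : Finsupp.linearCombination R id (s m) = m := LinearMap.congr_fun hs m
  rw [h3, Submodule.ideal_span_singleton_smul] at h2
  obtain ⟨k, -, hk⟩ := h2
  exact ⟨k, hk.symm⟩

variable {A B : Type u} [Ring A] [Algebra R A] [AddCommGroup B] [Module A' B] [Module Aᵐᵒᵖ B]
  [SMulCommClass A' Aᵐᵒᵖ B] {X Y M : Type u} [AddCommGroup X] [Module A X] [AddCommGroup Y]
  [Module A Y] [AddCommGroup M] [Module A' M]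

/-- An extension `M` of `B ⊗ X` by `B ⊗ Y` such that all homomorphisms `b ↦ b ⊗ x` lift to `M`
comes from an extension of `X` by `Y`. -/
theorem exists_extension_of_lifts (hY : BTensor.IsGood A' A B Y)
    (f : BTensor A' A B Y →ₗ[A'] M) (g : M →ₗ[A'] BTensor A' A B X)
    (hf : Function.Injective f) (hg : Function.Surjective g) (hfg : Function.Exact f g)
    (hlift : ∀ x : X, ∃ h : B →ₗ[A'] M, ∀ b, g (h b) = BTensor.tmul A' A b x) :
    ∃ (E : Type u) (_ : AddCommGroup E) (_ : Module A E) (i : Y →ₗ[A] E) (p : E →ₗ[A] X)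
      (e : BTensor A' A B E ≃ₗ[A'] M), Function.Injective i ∧ Function.Surjective p ∧
      Function.Exact i p ∧ ∀ z, g (e z) = BTensor.map A' A B p z := by
  -- The fibre product of `Hom(B, M)` and `X` over `Hom(B, B ⊗ X)`. The assumed lifts are what makes
  -- its projection to `X` surjective, and goodness of `Y` identifies the kernel.
  let E : Submodule A (BTensor.CoInd A' B M × X) :=
    { carrier := {z | ∀ b, g (z.1.eval b) = BTensor.tmul A' A b z.2}
      zero_mem' := fun b => by
        change g ((0 : B →ₗ[A'] M) b) = BTensor.tmul A' A b 0
        rw [LinearMap.zero_apply, map_zero, BTensor.tmul_zero]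
      add_mem' := fun {y z} hy hz b => by
        change g (y.1.eval b + z.1.eval b) = BTensor.tmul A' A b (y.2 + z.2)
        rw [map_add, hy b, hz b, BTensor.tmul_add]
      smul_mem' := fun a z hz b => by
        change g (z.1.eval (MulOpposite.op a • b)) = BTensor.tmul A' A b (a • z.2)
        rw [hz, BTensor.op_smul_tmul] }
  let p : E →ₗ[A] X := LinearMap.snd A _ _ ∘ₗ E.subtype
  let i : Y →ₗ[A] E :=
    { toFun := fun y => ⟨((f ∘ₗ BTensor.unit A' A B y : B →ₗ[A'] M), 0), fun b => by
        change g (f (BTensor.tmul A' A b y)) = _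
        rw [hfg.apply_apply_eq_zero, BTensor.tmul_zero]⟩
      map_add' := fun y z => Subtype.ext (Prod.ext (LinearMap.ext fun b => by
        change f (BTensor.tmul A' A b (y + z)) = f (BTensor.tmul A' A b y) + f (BTensor.tmul A' A b z)
        rw [BTensor.tmul_add, map_add]) (add_zero 0).symm)
      map_smul' := fun a y => Subtype.ext (Prod.ext (LinearMap.ext fun b => by
        change f (BTensor.tmul A' A b (a • y)) = f (BTensor.tmul A' A (MulOpposite.op a • b) y)
        rw [BTensor.op_smul_tmul]) (smul_zero a).symm) }
  have hi : Function.Injective i := by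
    intro y z h
    refine hY.1 (LinearMap.ext fun b => hf ?_)
    have h1 : (i y).1.1.eval b = (i z).1.1.eval b := by rw [h]
    exact h1
  have hp : Function.Surjective p := by
    intro x
    obtain ⟨h, hh⟩ := hlift x
    exact ⟨⟨(h, x), hh⟩, rfl⟩
  have hip : Function.Exact i p := by
    intro z
    constructor
    · intro hz
      have h1 : ∀ b, ∃ w, f w = z.1.1.eval b := fun b => (hfg _).1 (by
        have h2 : z.1.2 = 0 := hz
        rw [z.2 b, h2, BTensor.tmul_zero])
      choose w hw using h1
      obtain ⟨y, hy⟩ := hY.exists_eq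
        { toFun := w
          map_add' := fun b c => hf (by rw [map_add, hw, hw, hw, map_add])
          map_smul' := fun a b => hf (by rw [RingHom.id_apply, map_smul, hw, hw, map_smul]) }
      refine ⟨y, Subtype.ext (Prod.ext (LinearMap.ext fun b => ?_) (Eq.symm hz))⟩
      change f (BTensor.tmul A' A b y) = z.1.1.eval b
      rw [← hy, ← hw]
      rfl
    · rintro ⟨y, rfl⟩
      rfl
  -- Evaluation is bijective by comparing the right exact sequence for `B ⊗ E` with the given
  -- extension, the outer terms being the same.
  let e : BTensor A' A B E →ₗ[A'] M := BTensor.lift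
    { toFun := fun z => z.1.1.eval
      map_zero' := rfl
      map_add' := fun _ _ => rfl } fun _ _ _ => rfl
  have hei : ∀ w, e (BTensor.map A' A B i w) = f w := fun w =>
    LinearMap.congr_fun (f := e ∘ₗ BTensor.map A' A B i) (g := f) (BTensor.ext fun b y => rfl) w
  have hge : ∀ z, g (e z) = BTensor.map A' A B p z := fun z =>
    LinearMap.congr_fun (f := g ∘ₗ e) (g := BTensor.map A' A B p) (BTensor.ext fun b z => z.2 b) z
  have hex := BTensor.map_exact (A' := A') (B := B) hp hip
  refine ⟨E, _, _, i, p, LinearEquiv.ofBijective e ⟨?_, ?_⟩, hi, hp, hip, hge⟩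
  · rw [injective_iff_map_eq_zero]
    intro z hz
    obtain ⟨w, rfl⟩ := (hex z).1 (by rw [← hge, hz, map_zero])
    rw [hei] at hz
    rw [(map_eq_zero_iff f hf).1 hz, map_zero]
  · intro m
    obtain ⟨z, hz⟩ := BTensor.map_surjective (A' := A') (B := B) hp (g m)
    obtain ⟨w, hw⟩ := (hfg (m - e z)).1 (by rw [map_sub, hge, hz, sub_self])
    exact ⟨BTensor.map A' A B i w + z, by rw [map_add, hei, hw, sub_add_cancel]⟩

end

namespace Datum

section

variable {R A' : Type u} [CommRing R] [Ring A'] [Algebra R A'] {L : Type v} [LinearOrder L]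
variable {D : Datum R A' L} [IsRegularLocalRing R] [Module.Finite R A']

theorem IsRS.isGood' (hD : D.IsRS) {l : List L} {X : Type u} [AddCommGroup X] [Module R X]
    [Module D.A X] [IsScalarTower R D.A X] (hX : D.Filt l X) : BTensor.IsGood A' D.A D.B X :=
  haveI := (IsRegularLocalRing.isDomain R).1
  hD.isGood (fun _ hx => assHeightLE_span_singleton hx) hX

/-- Homomorphisms `b ↦ b ⊗ x` lift along a surjection if they do so at all primes of height at
most one, up to multipliers. -/
theorem IsRS.exists_lift (hD : D.IsRS) {l : List L} {i : L} {Y M : Type u} [AddCommGroup Y]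
    [Module R Y] [Module D.A Y] [IsScalarTower R D.A Y] (hY : D.Filt l Y) [AddCommGroup M]
    [Module R M] [Module A' M] [IsScalarTower R A' M]
    (f : D.G Y →ₗ[A'] M) (g : M →ₗ[A'] D.G (D.Δ i))
    (hf : Function.Injective f) (hg : Function.Surjective g) (hfg : Function.Exact f g)
    (x : D.Δ i)
    (hloc : ∀ q : Ideal R, q.IsPrime → q.height ≤ 1 → ∃ s ∉ q, ∃ h : D.B →ₗ[A'] M,
      ∀ b, g (h b) = s • BTensor.tmul A' D.A b x) :
    ∃ h : D.B →ₗ[A'] M, ∀ b, g (h b) = BTensor.tmul A' D.A b x := by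
  haveI := (IsRegularLocalRing.isDomain R).1
  haveI := hD.freeG i
  haveI := (hD.projective_G hY).2
  haveI : Module.Projective R M := projective_restrictScalars_of_exact hf hg hfg
  haveI : SMulCommClass R A' M := IsScalarTower.to_smulCommClass
  obtain ⟨r, σ, hr⟩ := exists_splitting_restrictScalars (R := R) hf hg hfg
  -- The ideal of multipliers for which a lift exists; the claim is that it contains 1.
  let a : Ideal R :=
    { carrier := {s | ∃ h : D.B →ₗ[A'] M, ∀ b, g (h b) = s • BTensor.tmul A' D.A b x}
      zero_mem' := ⟨0, fun b => by rw [LinearMap.zero_apply, map_zero, zero_smul]⟩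
      add_mem' := by
        rintro s t ⟨h, hh⟩ ⟨k, hk⟩
        exact ⟨h + k, fun b => by rw [LinearMap.add_apply, map_add, hh, hk, add_smul]⟩
      smul_mem' := by
        rintro c s ⟨h, hh⟩
        refine ⟨c • h, fun b => ?_⟩
        have h1 : g (c • h b) = c • g (h b) := (g.restrictScalars R).map_smul c (h b)
        rw [LinearMap.smul_apply, h1, hh, smul_assoc] }
  have ha : ∀ q : Ideal R, q.IsPrime → q.height ≤ 1 → ¬ a ≤ q := fun q hq hq1 haq =>
    let ⟨s, hs, hh⟩ := hloc q hq hq1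
    hs (haq hh)
  -- The zero ideal has height 0, so `a` is nonzero; then `exists_regular_mod` provides the second
  -- multiplier `t`.
  obtain ⟨s, ⟨f₁, hf₁⟩, hs⟩ : ∃ s ∈ a, s ≠ 0 := by
    by_contra hcon
    push Not at hcon
    exact ha ⊥ Ideal.isPrime_bot (by simp) fun s hs => hcon s hs
  obtain ⟨t, ⟨f₂, hf₂⟩, ht⟩ := exists_regular_mod hs a ha
  have gsmul : ∀ (c : R) m, g (c • m) = c • g m := (g.restrictScalars R).map_smul
  have fsmul : ∀ (c : R) m, f (c • m) = c • f m := (f.restrictScalars R).map_smul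
  -- Both `t f₁` and `s f₂` lift `s t (b ⊗ x)`, so the difference takes values in `G Y` and, `Y`
  -- being good, is given by an element `z` of `Y`.
  have h1 : ∀ b, ∃ w, f w = t • f₁ b - s • f₂ b := fun b => (hfg _).1 (by
    rw [map_sub, gsmul, gsmul, hf₁, hf₂, smul_smul, smul_smul, mul_comm, sub_self])
  choose w hw using h1
  obtain ⟨z, hz⟩ := (hD.isGood' hY).exists_eq
    { toFun := w
      map_add' := fun b c => hf (by
        rw [map_add, hw, hw, hw, map_add, map_add, smul_add, smul_add]; abel)
      map_smul' := fun c b => hf (by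
        rw [RingHom.id_apply, map_smul, hw, hw, map_smul, map_smul, smul_sub, smul_comm c,
          smul_comm c]) }
  have hz' : ∀ b, f (BTensor.tmul A' D.A b z) = t • f₁ b - s • f₂ b := fun b => by
    rw [← hz, ← hw]; rfl
  -- This is where primes of height 2 enter: the associated primes of `R/(s, t)` can have that
  -- height.
  have h2 : z ∈ (Ideal.span {s, t} • ⊤ : Submodule R Y) := by
    refine hD.detects (assHeightLE_span_pair hs ht) hY z fun b => ?_
    have h3 : r (f (BTensor.tmul A' D.A b z)) = BTensor.tmul A' D.A b z := by
      have := hr (f (BTensor.tmul A' D.A b z))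
      rw [hfg.apply_apply_eq_zero, map_zero, add_zero] at this
      exact hf this
    rw [← h3]
    refine map_mem_smul_top r _ ?_
    rw [hz']
    exact sub_mem (Submodule.smul_mem_smul (Ideal.subset_span (by simp)) trivial)
      (Submodule.smul_mem_smul (Ideal.subset_span (by simp)) trivial)
  obtain ⟨z₁, z₂, hz12⟩ : ∃ z₁ z₂ : Y, z = t • z₁ - s • z₂ := by
    rw [Ideal.span_insert, Submodule.sup_smul, Submodule.mem_sup] at h2
    obtain ⟨y₁, hy₁, y₂, hy₂, rfl⟩ := h2
    rw [Submodule.ideal_span_singleton_smul] at hy₁ hy₂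
    obtain ⟨z₁, -, rfl⟩ := hy₁
    obtain ⟨z₂, -, rfl⟩ := hy₂
    refine ⟨z₂, -z₁, ?_⟩
    change s • z₁ + t • z₂ = _
    rw [smul_neg, sub_neg_eq_add, add_comm]
  -- Subtracting the maps given by `z₁` and `z₂` changes neither image under `g` and makes the
  -- cross-multiplied lifts equal. As `t` is regular modulo `s`, the corrected first lift is
  -- divisible by `s`; its quotient is `h`.
  have h4 : ∀ b, t • (f₁ b - f (BTensor.tmul A' D.A b z₁)) =
      s • (f₂ b - f (BTensor.tmul A' D.A b z₂)) := fun b => by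
    have := hz' b
    rw [hz12, BTensor.tmul_sub, map_sub, BTensor.tmul_smul_base, BTensor.tmul_smul_base, fsmul,
      fsmul] at this
    rw [smul_sub, smul_sub, sub_eq_sub_iff_add_eq_add]
    rw [sub_eq_sub_iff_add_eq_add] at this
    rw [← this]
    abel
  choose h hh using fun b => exists_eq_smul_of_projective ht (h4 b)
  have hs' : Function.Injective fun m : M => s • m := smul_right_injective M hs
  refine ⟨{ toFun := h, map_add' := fun b c => hs' ?_, map_smul' := fun c b => hs' ?_ },
    fun b => ?_⟩
  · simp only [smul_add, ← hh, map_add, BTensor.add_tmul]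
    abel
  · simp only [RingHom.id_apply]
    rw [smul_comm s c, ← hh, ← hh, map_smul, ← BTensor.smul_tmul, map_smul, smul_sub]
  · change g (h b) = _
    have h5 : s • g (h b) = s • BTensor.tmul A' D.A b x := by
      rw [← gsmul, ← hh, map_sub, hf₁, hfg.apply_apply_eq_zero, sub_zero]
    exact smul_right_injective _ hs h5

/-- Lifting homomorphisms over a localization. -/
theorem exists_lift_localization [IsDomain R] {i : L} {M : Type u} [AddCommGroup M]
    [Module R M] [Module A' M] [IsScalarTower R A' M] [Module.Projective R M]
    [Module.Free R (D.G (D.Δ i))] (g : M →ₗ[A'] D.G (D.Δ i)) (S : Submonoid R)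
    (hS : (0 : R) ∉ S) (R' : Type u) [CommRing R']
    [Algebra R R'] [IsLocalization S R'] {Z : Type u} [AddCommGroup Z] [Module (R' ⊗[R] D.A) Z]
    (ψ : Z →ₗ[R' ⊗[R] D.A] BC R R' (D.Δ i)) (hψ : Function.Surjective ψ)
    (φ : D.GBC R' Z →ₗ[R' ⊗[R] A'] BC R R' M)
    (h : ∀ z, baseChangeTensor R R' D.A A' D.B (D.Δ i) (BC.map R R' g (φ z)) = D.GBCmap R' ψ z)
    (x : D.Δ i) :
    ∃ s ∈ S, ∃ h : D.B →ₗ[A'] M, ∀ b, g (h b) = s • BTensor.tmul A' D.A b x := by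
  have hS' : ∀ s ∈ S, s ≠ 0 := fun s hs h0 => hS (h0 ▸ hs)
  obtain ⟨z, hz⟩ := hψ (BC.tmul R R' 1 x)
  obtain ⟨s, hs, k, hk⟩ := BC.exists_smul_hom_eq (A := A') S
    (fun s hs (y : M) hy => (smul_eq_zero.1 hy).resolve_left (hS' s hs))
    (φ ∘ₗ BTensor.unit (R' ⊗[R] A') (R' ⊗[R] D.A) (BC R R' D.B) z)
  refine ⟨s, hs, k, fun b => ?_⟩
  refine BC.tmul_one_injective (R' := R') S
    (fun s hs y hy => (smul_eq_zero.1 hy).resolve_left (hS' s hs))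
    ((baseChangeTensor R R' D.A A' D.B (D.Δ i)).injective ?_)
  have h1 := h (BTensor.tmul _ _ (BC.tmul R R' 1 b) z)
  rw [BTensor.map_tmul, hz] at h1
  rw [← BC.map_tmul, ← hk, BC.tmul_smul, ← BC.smul_eq_tmul_one_smul (A := A'),
    ← BC.smul_eq_tmul_one_smul (A := A'), map_smul, map_smul, map_smul]
  refine congrArg _ (h1.trans ?_)
  exact (baseChangeTensor_tmul _ _ _).symm

/-- Over the fraction field `M` becomes the image of some `Z`, and `g` the image of some `ψ`. The
functor kills the cokernel of `ψ`, and it reflects vanishing, so `ψ` is surjective and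
`exists_lift_localization` applies. -/
theorem IsRS.exists_lift_generic (hD : D.IsRS) {i : L} {M : Type u} [AddCommGroup M]
    [Module R M] [Module A' M] [IsScalarTower R A' M] [Module.Projective R M] [Module.Finite R M]
    (g : M →ₗ[A'] D.G (D.Δ i)) (hg : Function.Surjective g) (x : D.Δ i) :
    ∃ s : R, s ≠ 0 ∧ ∃ h : D.B →ₗ[A'] M, ∀ b, g (h b) = s • BTensor.tmul A' D.A b x := by
  haveI := (IsRegularLocalRing.isDomain R).1
  haveI := hD.freeG i
  let F := FractionRing R
  haveI := BC.finite R F A' M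
  haveI := BC.finite R F D.A (D.Δ i)
  obtain ⟨Z, _, _, hZ, ⟨e⟩⟩ := hD.essSurj (BC R F M)
  obtain ⟨ψ, hψ⟩ := hD.full Z (BC R F (D.Δ i))
    ((baseChangeTensor R F D.A A' D.B (D.Δ i)).toLinearMap ∘ₗ BC.map R F g ∘ₗ e.toLinearMap)
  have hψs : Function.Surjective (D.GBCmap F ψ) := by
    rw [hψ]
    exact (baseChangeTensor R F D.A A' D.B (D.Δ i)).surjective.comp
      ((BC.map_surjective hg).comp e.surjective)
  have hψ' : Function.Surjective ψ := by
    rw [← LinearMap.range_eq_top]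
    have h0 : D.GBCmap F (LinearMap.range ψ).mkQ = 0 := by
      refine LinearMap.ext fun w => ?_
      obtain ⟨w, rfl⟩ := hψs w
      have h1 : (LinearMap.range ψ).mkQ ∘ₗ ψ = 0 := LinearMap.range_mkQ_comp ψ
      rw [GBCmap, BTensor.map_map, h1, BTensor.map_zero]
      rfl
    have h1 := hD.subsingleton (BC R F (D.Δ i) ⧸ LinearMap.range ψ) ⟨fun a b => by
      obtain ⟨a, rfl⟩ := BTensor.map_surjective (LinearMap.range ψ).mkQ_surjective a
      obtain ⟨b, rfl⟩ := BTensor.map_surjective (LinearMap.range ψ).mkQ_surjective b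
      exact (LinearMap.congr_fun h0 a).trans (LinearMap.congr_fun h0 b).symm⟩
    exact Submodule.Quotient.subsingleton_iff.1 h1
  obtain ⟨s, hs, h⟩ := exists_lift_localization g (nonZeroDivisors R) zero_notMem_nonZeroDivisors F
    ψ hψ' e.toLinearMap (fun z => (LinearMap.congr_fun hψ z).symm) x
  exact ⟨s, nonZeroDivisors.ne_zero hs, h⟩

end

end Datum

end HighestWeight

end

noncomputable section

namespace HighestWeight

/-! ### Homomorphisms from filtered modules over a local ring -/

section

variable {k Λ : Type u} [CommRing k] [Ring Λ] [Algebra k Λ] {L : Type v} {Δ : L → Type u}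
  [∀ i, AddCommGroup (Δ i)] [∀ i, Module Λ (Δ i)]
variable {N : Type u} [AddCommGroup N] [Module k N] [Module Λ N] [IsScalarTower k Λ N]
  [SMulCommClass Λ k N]

/-- Composition with a fixed homomorphism. -/
def compRight (k N : Type u) [CommRing k] [AddCommGroup N] [Module k N] [Module Λ N]
    [SMulCommClass Λ k N] {X Y : Type u} [AddCommGroup X] [Module Λ X] [AddCommGroup Y]
    [Module Λ Y] (g : X →ₗ[Λ] Y) : (Y →ₗ[Λ] N) →ₗ[k] (X →ₗ[Λ] N) where
  toFun f := f ∘ₗ g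
  map_add' _ _ := rfl
  map_smul' _ _ := rfl

theorem apply_mem_smul_top {X : Type u} [AddCommGroup X] [Module Λ X] {I : Ideal k}
    {f : X →ₗ[Λ] N} (hf : f ∈ (I • ⊤ : Submodule k (X →ₗ[Λ] N))) (x : X) :
    f x ∈ (I • ⊤ : Submodule k N) :=
  Datum.map_mem_smul_top
    ({ toFun := fun f => f x, map_add' := fun _ _ => rfl, map_smul' := fun _ _ => rfl } :
      (X →ₗ[Λ] N) →ₗ[k] N) I hf

/-- A homomorphism from a filtered module is surjective or vanishes modulo the maximal ideal. -/
theorem FiltBy.surjective_or_mem [IsLocalRing k] [Module.Finite k N] {l : List L}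
    (hl : ∀ j ∈ l, ExtVanish Λ (Δ j) N ∧ ∀ f : Δ j →ₗ[Λ] N, Function.Surjective f ∨
      f ∈ (IsLocalRing.maximalIdeal k • ⊤ : Submodule k (Δ j →ₗ[Λ] N))) :
    ∀ {Z : Type u} [AddCommGroup Z] [Module Λ Z], FiltBy Λ Δ l Z → ∀ f : Z →ₗ[Λ] N,
      Function.Surjective f ∨ f ∈ (IsLocalRing.maximalIdeal k • ⊤ : Submodule k (Z →ₗ[Λ] N)) := by
  induction l with
  | nil =>
    intro Z _ _ h f
    haveI : Subsingleton Z := h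
    rw [Subsingleton.elim f 0]
    exact Or.inr (zero_mem _)
  | cons j l ih =>
    rintro Z _ _ ⟨g, hg, h⟩ f
    obtain ⟨hext, hj⟩ := hl j List.mem_cons_self
    rcases ih (fun j' hj' => hl j' (List.mem_cons_of_mem j hj')) h (f ∘ₗ (LinearMap.ker g).subtype)
      with h1 | h1
    · exact Or.inl (Function.Surjective.of_comp h1)
    · let res := compRight k N (LinearMap.ker g).subtype
      -- Surjectivity of restriction lets the part of `f` on the kernel, divisible by the maximal
      -- ideal, extend to a divisible `f₁` on all of `Z`. The difference `f - f₁` factors through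
      -- the top factor.
      have hres : Function.Surjective res := fun a => by
        obtain ⟨b, hb⟩ := hext Z g hg a
        exact ⟨b, LinearMap.ext hb⟩
      have h2 : (IsLocalRing.maximalIdeal k • ⊤ : Submodule k (LinearMap.ker g →ₗ[Λ] N)) =
          (IsLocalRing.maximalIdeal k • ⊤ : Submodule k (Z →ₗ[Λ] N)).map res := by
        rw [Submodule.map_smul'', Submodule.map_top, LinearMap.range_eq_top.2 hres]
      rw [h2] at h1
      obtain ⟨f₁, hf₁, hf₁'⟩ := h1
      have hf₁' : ∀ x : Z, g x = 0 → f₁ x = f x := fun x hx =>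
        LinearMap.congr_fun hf₁' (⟨x, hx⟩ : LinearMap.ker g)
      obtain ⟨f₂, hf₂⟩ := exists_factor hg (f - f₁) fun x hx => by
        rw [LinearMap.sub_apply, hf₁' x hx, sub_self]
      have hf : f = f₂ ∘ₗ g + f₁ := LinearMap.ext fun x => by
        rw [LinearMap.add_apply, LinearMap.comp_apply, hf₂, LinearMap.sub_apply, sub_add_cancel]
      rcases hj f₂ with h3 | h3
      · left
        -- The image of `f` is everything modulo the maximal ideal, since `f₁` vanishes there;
        -- Nakayama concludes.
        have h4 : (⊤ : Submodule k N) ≤ (LinearMap.range f).restrictScalars k := by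
          refine Submodule.le_of_le_smul_of_le_jacobson_bot Module.Finite.fg_top
            (IsLocalRing.maximalIdeal_le_jacobson ⊥) fun n _ => ?_
          obtain ⟨y, rfl⟩ := h3 n
          obtain ⟨x, rfl⟩ := hg y
          rw [hf₂, LinearMap.sub_apply]
          exact sub_mem (Submodule.mem_sup_left ⟨x, rfl⟩)
            (Submodule.mem_sup_right (apply_mem_smul_top hf₁ x))
        exact fun n => h4 (Submodule.mem_top (x := n))
      · right
        rw [hf]
        exact add_mem (Datum.map_mem_smul_top (compRight k N g) _ h3) hf₁

end

/-! ### Projectivity after base change, and homomorphisms after localization. -/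

section

variable {R : Type u} [CommRing R] {R' : Type u} [CommRing R'] [Algebra R R']
variable {A : Type u} [Ring A] [Algebra R A]

/-- By the universal property of base change, a splitting of a surjection from a free module is an
`A`-linear lift of `P → R' ⊗ P`, which exists because `P` is projective over `A`. -/
theorem BC.projective {P : Type u} [AddCommGroup P] [Module R P] [Module A P] [IsScalarTower R A P]
    [Module.Projective A P] : Module.Projective (R' ⊗[R] A) (BC R R' P) := by
  refine Module.Projective.of_lifting_property'' fun f hf => ?_
  let M := BC R R' P →₀ R' ⊗[R] A
  letI : AddCommGroup M := inferInstanceAs (AddCommGroup (BC R R' P →₀ R' ⊗[R] A))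
  letI : Module A M := Module.compHom M
    (Algebra.TensorProduct.includeRight : A →ₐ[R] R' ⊗[R] A).toRingHom
  letI : Module A (BC R R' P) := Module.compHom (BC R R' P)
    (Algebra.TensorProduct.includeRight : A →ₐ[R] R' ⊗[R] A).toRingHom
  let f' : M →ₗ[A] BC R R' P := { f with map_smul' := fun a m => map_smul f _ m }
  let g' : P →ₗ[A] BC R R' P :=
    { toFun := fun x => BC.tmul R R' 1 x
      map_add' := fun x y => by rw [BC.tmul_add]
      map_smul' := fun a x => by
        change _ = ((1 : R') ⊗ₜ[R] a : R' ⊗[R] A) • BC.tmul R R' 1 x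
        rw [BC.smul_tmul, one_mul] }
  obtain ⟨h, hh⟩ := Module.projective_lifting_property f' g' hf
  let k : BC R R' P →ₗ[R' ⊗[R] A] M :=
    BC.lift (A' := A) (V := M) h.toAddMonoidHom fun a w => h.map_smul a w
  have hk : ∀ x, k (BC.tmul R R' 1 x) = h x := fun x =>
    (BC.lift_tmul (V := M) _ _ 1 x).trans (one_smul (R' ⊗[R] A) (h x))
  exact ⟨k, BC.hom_ext fun x => (congrArg f (hk x)).trans (LinearMap.congr_fun hh x)⟩

variable (S : Submonoid R) [IsLocalization S R'] {X Y : Type u} [AddCommGroup X] [Module R X]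
  [Module A X] [IsScalarTower R A X] [AddCommGroup Y] [Module R Y] [Module A Y]
  [IsScalarTower R A Y]

theorem smul_eq_zero_of_mem {S : Submonoid R} [IsLocalization S R'] {s : R} (hs : s ∈ S)
    {V : Type*} [AddCommGroup V] [Module R' V] {z : V} (h : algebraMap R R' s • z = 0) : z = 0 :=
  ((IsLocalization.map_units R' (⟨s, hs⟩ : S)).smul_eq_zero).1 h

theorem BC.hom_eq_zero [Module.Finite A X] (h : ∀ s ∈ S, ∀ y : Y, s • y = 0 → y = 0)
    (h0 : ∀ f : X →ₗ[A] Y, f = 0) (f : BC R R' X →ₗ[R' ⊗[R] A] BC R R' Y) : f = 0 := by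
  obtain ⟨s, hs, g, hg⟩ := BC.exists_smul_hom_eq S h f
  refine BC.hom_ext fun x => ?_
  have h1 := hg x
  rw [h0 g, LinearMap.zero_apply, BC.tmul_zero] at h1
  exact smul_eq_zero_of_mem hs h1

theorem BC.end_eq [Module.Finite A X] (h : ∀ s ∈ S, ∀ y : X, s • y = 0 → y = 0)
    (h0 : ∀ f : X →ₗ[A] X, ∃ r : R, ∀ x, f x = r • x) (f : BC R R' X →ₗ[R' ⊗[R] A] BC R R' X) :
    ∃ r : R', ∀ x, f x = r • x := by
  obtain ⟨s, hs, g, hg⟩ := BC.exists_smul_hom_eq S h f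
  obtain ⟨r, hr⟩ := h0 g
  obtain ⟨t, ht⟩ := (IsLocalization.map_units R' (⟨s, hs⟩ : S)).exists_left_inv
  have ht : t * algebraMap R R' s = 1 := ht
  haveI : SMulCommClass (R' ⊗[R] A) R' (BC R R' X) := IsScalarTower.to_smulCommClass'
  refine ⟨t * algebraMap R R' r, fun x => LinearMap.congr_fun (f := f)
    (g := (t * algebraMap R R' r) • LinearMap.id) (BC.hom_ext fun x => ?_) x⟩
  rw [LinearMap.smul_apply, LinearMap.id_apply, mul_smul, ← BC.tmul_smul, ← hr, ← hg, ← mul_smul,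
    ht, one_smul]

end

namespace Datum

section

variable {R A' : Type u} [CommRing R] [Ring A'] [Algebra R A'] {L : Type v} [LinearOrder L]
variable {D : Datum R A' L} [IsRegularLocalRing R] [Module.Finite R A']

theorem IsRS.hom_eq_zero_BC (hD : D.IsRS) (S : Submonoid R) (hS : (0 : R) ∉ S) {R' : Type u}
    [CommRing R'] [Algebra R R'] [IsLocalization S R'] {i j : L} (hij : i < j)
    (f : BC R R' (D.Δ j) →ₗ[R' ⊗[R] D.A] BC R R' (D.Δ i)) : f = 0 := by
  haveI := (IsRegularLocalRing.isDomain R).1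
  refine BC.hom_eq_zero (R := R) (A := D.A) (X := D.Δ j) (Y := D.Δ i) S
    (fun s hs y hy => (smul_eq_zero.1 hy).resolve_left fun h => hS (h ▸ hs))
    (fun g => ?_) f
  by_contra hg
  exact (hD.hom_le _ _ g hg).not_gt hij

/-- The kernel of the cover of the `j`-th standard module is filtered by labels above `j ≥ i`, so it
has no nonzero homomorphism to the `i`-th standard module, even after localization. The zero map is
therefore always an extension. -/
theorem IsRS.extVanish_BC (hD : D.IsRS) (S : Submonoid R) (hS : (0 : R) ∉ S) {R' : Type u}
    [CommRing R'] [Algebra R R'] [IsLocalization S R'] {i j : L} (hij : i ≤ j) :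
    ExtVanish (R' ⊗[R] D.A) (BC R R' (D.Δ j)) (BC R R' (D.Δ i)) := by
  obtain ⟨P, _, _, _, _, p, hP, -, hp, l, hl, hpl⟩ := hD.exists_cover j
  haveI := BC.projective (R := R) (R' := R') (A := D.A) (P := P)
  refine extVanish_of_projective (BC.map R R' p) (BC.map_surjective hp) fun k => ⟨0, fun x => ?_⟩
  have hex : Function.Exact (LinearMap.ker p).subtype p := LinearMap.exact_subtype_ker_map p
  have h1 := BC.map_exact (R := R) (R' := R') hp hex
  have h2 : ∀ z : BC R R' (LinearMap.ker p),
      BC.map R R' (LinearMap.ker p).subtype z ∈ LinearMap.ker (BC.map R R' p) := fun z =>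
    h1.apply_apply_eq_zero z
  have h3 := FiltBy.hom_eq_zero (fun j' hj' f => hD.hom_eq_zero_BC S hS (hij.trans_lt (hl j' hj')) f)
    (hpl.baseChange (R' := R'))
    (k ∘ₗ (BC.map R R' (LinearMap.ker p).subtype).codRestrict _ h2)
  obtain ⟨z, hz⟩ := (h1 x.1).1 x.2
  have h4 : x = (BC.map R R' (LinearMap.ker p).subtype).codRestrict _ h2 z := Subtype.ext hz.symm
  rw [LinearMap.zero_apply, h4]
  exact (LinearMap.congr_fun h3 z).symm

theorem IsRS.extVanish (hD : D.IsRS) {i j : L} (hij : i ≤ j) :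
    ExtVanish D.A (D.Δ j) (D.Δ i) := by
  obtain ⟨P, _, _, _, _, p, hP, -, hp, l, hl, hpl⟩ := hD.exists_cover j
  refine extVanish_of_projective p hp fun k => ⟨0, fun x => ?_⟩
  have h3 := FiltBy.hom_eq_zero (N := D.Δ i) (fun j' hj' f => by
    by_contra hf
    exact (hD.hom_le _ _ f hf).not_gt (hij.trans_lt (hl j' hj'))) hpl k
  rw [h3]
  rfl

/-- Goodness localizes: `B` is finite over `A'`, so homomorphisms out of it acquire a common
denominator, and the values of the functor on standard modules are free over the domain `R`. -/
theorem IsRS.isGood_BC (hD : D.IsRS) (S : Submonoid R) (hS : (0 : R) ∉ S) {R' : Type u}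
    [CommRing R'] [Algebra R R'] [IsLocalization S R'] (i : L) :
    BTensor.IsGood (R' ⊗[R] A') (R' ⊗[R] D.A) (BC R R' D.B) (BC R R' (D.Δ i)) := by
  haveI := (IsRegularLocalRing.isDomain R).1
  haveI := hD.freeG i
  have hS' : ∀ s ∈ S, s ≠ 0 := fun s hs h0 => hS (h0 ▸ hs)
  have hgood := hD.isGood' (FiltBy.singleton (A := D.A) (Δ := D.Δ) i)
  have tf : ∀ s ∈ S, ∀ y : D.G (D.Δ i), s • y = 0 → y = 0 := fun s hs y hy =>
    (smul_eq_zero.1 hy).resolve_left (hS' s hs)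
  have hinj := BC.tmul_one_injective (R' := R') S tf
  let θ := baseChangeTensor R R' D.A A' D.B (D.Δ i)
  constructor
  · rw [injective_iff_map_eq_zero]
    intro y hy
    obtain ⟨s, hs, x, hx⟩ := BC.exists_smul_eq S y
    have h1 : x = 0 := hgood.eq_zero fun b => hinj (θ.injective (by
      rw [baseChangeTensor_tmul, ← hx, ← BC.smul_eq_tmul_one_smul (A := D.A), BC.tmul_base_smul,
        BC.tmul_zero, map_zero]
      have h2 : BTensor.tmul (R' ⊗[R] A') (R' ⊗[R] D.A) (BC.tmul R R' 1 b) y = 0 :=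
        LinearMap.congr_fun hy _
      rw [h2, smul_zero]))
    rw [h1, BC.tmul_zero] at hx
    exact smul_eq_zero_of_mem hs hx
  · intro f
    obtain ⟨s, hs, g, hg⟩ := BC.exists_smul_hom_eq (A := A') S tf (θ.symm.toLinearMap ∘ₗ f)
    obtain ⟨x, hx⟩ := hgood.exists_eq g
    obtain ⟨t, ht⟩ := (IsLocalization.map_units R' (⟨s, hs⟩ : S)).exists_left_inv
    have ht : t * algebraMap R R' s = 1 := ht
    refine ⟨t • BC.tmul R R' 1 x, BC.hom_ext fun b => ?_⟩
    have h1 : f (BC.tmul R R' 1 b) = θ (t • algebraMap R R' s • θ.symm (f (BC.tmul R R' 1 b))) := by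
      rw [← mul_smul, ht, one_smul, LinearEquiv.apply_symm_apply]
    have h2 := hg b
    rw [LinearMap.comp_apply, LinearEquiv.coe_coe] at h2
    change BTensor.tmul (R' ⊗[R] A') (R' ⊗[R] D.A) (BC.tmul R R' 1 b) (t • BC.tmul R R' 1 x) = _
    rw [h1, h2, hx, ← BC.smul_eq_tmul_one_smul (A := D.A) t (BC.tmul R R' 1 x), BC.tmul_base_smul,
      ← BC.smul_eq_tmul_one_smul (A := A') t (BC.tmul R R' 1 (BTensor.tmul A' D.A b x)),
      θ.map_smul]
    exact congrArg _ (baseChangeTensor_tmul 1 b x).symm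

theorem IsRS.nontrivial_G (hD : D.IsRS) (i : L) : Nontrivial (D.G (D.Δ i)) := by
  by_contra h
  rw [not_nontrivial_iff_subsingleton] at h
  haveI := hD.nontrivial i
  obtain ⟨x, hx⟩ := exists_ne (0 : D.Δ i)
  exact hx ((hD.isGood' (FiltBy.singleton (A := D.A) (Δ := D.Δ) i)).eq_zero
    fun b => Subsingleton.elim _ _)

/-- Lifting homomorphisms at a prime where the given extension comes from a filtered module. -/
theorem IsRS.exists_lift_prime (hD : D.IsRS) {i : L} {M : Type u} [AddCommGroup M]
    [Module R M] [Module A' M] [IsScalarTower R A' M] [Module.Projective R M] [Module.Finite A' M]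
    (g : M →ₗ[A'] D.G (D.Δ i)) (hg : Function.Surjective g)
    (hM : ∀ j < i, ∀ f : M →ₗ[A'] D.G (D.Δ j), f = 0)
    (p : Ideal R) [p.IsPrime] {l : List L} {Z : Type u} [AddCommGroup Z]
    [Module (Localization.AtPrime p ⊗[R] D.A) Z] (hZ : D.FiltBC (Localization.AtPrime p) l Z)
    (φ : D.GBC (Localization.AtPrime p) Z ≃ₗ[Localization.AtPrime p ⊗[R] A']
      BC R (Localization.AtPrime p) M) (x : D.Δ i) :
    ∃ s ∉ p, ∃ h : D.B →ₗ[A'] M, ∀ b, g (h b) = s • BTensor.tmul A' D.A b x := by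
  classical
  haveI := (IsRegularLocalRing.isDomain R).1
  let R' := Localization.AtPrime p
  have hS : (0 : R) ∉ p.primeCompl := fun h => h p.zero_mem
  have tf : ∀ j, ∀ s ∈ p.primeCompl, ∀ y : D.G (D.Δ j), s • y = 0 → y = 0 := fun j s hs y hy =>
    haveI := hD.freeG j
    (smul_eq_zero.1 hy).resolve_left fun h0 => hS (h0 ▸ hs)
  have hnt : ∀ j, ¬ Subsingleton (BC R R' (D.G (D.Δ j))) := fun j hsub => by
    haveI := hD.nontrivial_G j
    obtain ⟨y, hy⟩ := exists_ne (0 : D.G (D.Δ j))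
    exact hy (BC.tmul_one_injective (R' := R') p.primeCompl (tf j) (Subsingleton.elim _ _))
  -- A smallest label `m` of `Z` can be moved to the top. If `m < i`, this gives a surjection from
  -- the localization of `M` onto that of `G (Δ m)`; but all such homomorphisms vanish by `hM`,
  -- after clearing denominators.
  have hl : ∀ j ∈ l, i ≤ j := by
    by_contra hcon
    push Not at hcon
    obtain ⟨j, hj, hji⟩ := hcon
    obtain ⟨m, hm, hmin⟩ := l.toFinset.exists_min_image id ⟨j, List.mem_toFinset.2 hj⟩
    obtain ⟨l', -, q, hq, -⟩ := FiltBy.exists_top (List.mem_toFinset.1 hm)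
      (fun j hj => hD.extVanish_BC p.primeCompl hS (R' := R') (hmin j (List.mem_toFinset.2 hj))) hZ
    have hmi : m < i := (hmin j (List.mem_toFinset.2 hj)).trans_lt hji
    have h0 := BC.hom_eq_zero (R' := R') (A := A') p.primeCompl (tf m) (hM m hmi)
      ((baseChangeTensor R R' D.A A' D.B (D.Δ m)).symm.toLinearMap ∘ₗ D.GBCmap R' q ∘ₗ
        φ.symm.toLinearMap)
    have hsurj : Function.Surjective
      ((baseChangeTensor R R' D.A A' D.B (D.Δ m)).symm.toLinearMap ∘ₗ D.GBCmap R' q ∘ₗ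
        φ.symm.toLinearMap) :=
      (baseChangeTensor R R' D.A A' D.B (D.Δ m)).symm.surjective.comp ((BTensor.map_surjective hq).comp φ.symm.surjective)
    rw [h0] at hsurj
    refine hnt m ⟨fun a b => ?_⟩
    obtain ⟨a, rfl⟩ := hsurj a
    obtain ⟨b, rfl⟩ := hsurj b
    rfl
  let θ := baseChangeTensor R R' D.A A' D.B (D.Δ i)
  obtain ⟨ψ, hψ⟩ := (hD.isGood_BC p.primeCompl hS (R' := R') i).exists_map_eq
    (θ.toLinearMap ∘ₗ BC.map R R' g ∘ₗ φ.toLinearMap)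
  have hψz : ∀ z, θ (BC.map R R' g (φ z)) = D.GBCmap R' ψ z := fun z =>
    (LinearMap.congr_fun hψ z).symm
  haveI : SMulCommClass (R' ⊗[R] D.A) R' (BC R R' (D.Δ i)) := IsScalarTower.to_smulCommClass'
  haveI : Module.Finite R' (BC R R' (D.Δ i)) :=
    inferInstanceAs (Module.Finite R' (R' ⊗[R] D.Δ i))
  haveI := D.finite_G (D.Δ i)
  haveI : Module.Finite R' (BC R R' (D.G (D.Δ i))) :=
    inferInstanceAs (Module.Finite R' (R' ⊗[R] D.G (D.Δ i)))
  -- Labels above `i` contribute no homomorphisms to `Δ i`, and for label `i` itself every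
  -- endomorphism is a scalar in a local ring: a unit, hence surjective, or an element of the
  -- maximal ideal.
  rcases FiltBy.surjective_or_mem (k := R') (N := BC R R' (D.Δ i)) (fun j hj =>
    ⟨hD.extVanish_BC p.primeCompl hS (hl j hj), fun f => by
      rcases (hl j hj).eq_or_lt with rfl | hij
      · obtain ⟨r, hr⟩ := BC.end_eq (R' := R') p.primeCompl (fun s hs y hy =>
          (smul_eq_zero.1 hy).resolve_left fun h0 => hS (h0 ▸ hs)) (hD.end_eq i) f
        by_cases hu : IsUnit r
        · left
          intro y
          obtain ⟨t, ht⟩ := hu.exists_right_inv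
          exact ⟨t • y, by rw [hr, ← mul_smul, ht, one_smul]⟩
        · right
          have : f = r • LinearMap.id := LinearMap.ext hr
          rw [this]
          exact Submodule.smul_mem_smul ((IsLocalRing.mem_maximalIdeal r).2 hu) trivial
      · right
        rw [hD.hom_eq_zero_BC p.primeCompl hS hij f]
        exact zero_mem _⟩) hZ ψ with h1 | h1
  · haveI := hD.freeG i
    exact exists_lift_localization g p.primeCompl hS R' ψ h1 φ.toLinearMap hψz x
  · exfalso
    refine hnt i ?_
    -- Evaluation at elements of `G Z` is linear in the homomorphism, so divisibility of `ψ` by the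
    -- maximal ideal passes to all values of the localized surjection `g`. Nakayama would then make
    -- its nonzero target vanish.
    let E : (Z →ₗ[R' ⊗[R] D.A] BC R R' (D.Δ i)) →ₗ[R'] (D.GBC R' Z → BC R R' (D.G (D.Δ i))) :=
      { toFun := fun f z => θ.symm (D.GBCmap R' f z)
        map_add' := fun f f' => funext fun z => by
          rw [GBCmap, BTensor.map_add, LinearMap.add_apply, map_add]; rfl
        map_smul' := fun r f => funext fun z => by
          have h2 : D.GBCmap R' (r • f) z = (r ⊗ₜ[R] (1 : A') : R' ⊗[R] A') • D.GBCmap R' f z := by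
            induction z using BTensor.induction_on with
            | zero => rw [map_zero, map_zero, smul_zero]
            | add y z hy hz => rw [map_add, map_add, hy, hz, smul_add]
            | tmul b z =>
              rw [BTensor.map_tmul, BTensor.map_tmul, LinearMap.smul_apply,
                ← BC.smul_eq_tmul_one_smul (A := D.A), BC.tmul_base_smul]
          rw [h2, map_smul, BC.smul_eq_tmul_one_smul]; rfl }
    have h2 : (⊤ : Submodule R' (BC R R' (D.G (D.Δ i)))) ≤ ⊥ := by
      refine Submodule.le_of_le_smul_of_le_jacobson_bot Module.Finite.fg_top
        (IsLocalRing.maximalIdeal_le_jacobson ⊥) fun n _ => Submodule.mem_sup_right ?_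
      obtain ⟨w, rfl⟩ := BC.map_surjective (R' := R') hg n
      obtain ⟨z, rfl⟩ := φ.surjective w
      have h3 := map_mem_smul_top (LinearMap.proj z ∘ₗ E) _ h1
      have h4 : (LinearMap.proj z ∘ₗ E) ψ = BC.map R R' g (φ z) := by
        change θ.symm (D.GBCmap R' ψ z) = _
        rw [← hψz, LinearEquiv.symm_apply_apply]
      rwa [h4] at h3
    exact (Submodule.subsingleton_iff R').1 (subsingleton_of_bot_eq_top (le_antisymm h2 bot_le).symm)

end

end Datum

end HighestWeight

end

noncomputable section

namespace HighestWeight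

namespace Datum

/-! #### Transfer of filtered modules -/

section

variable {R A' : Type u} [CommRing R] [Ring A'] [Algebra R A'] {L : Type v}

/-- Two data have standard modules with the same images, and filtered modules with the same
images at the primes of height one. -/
structure Matches (D₁ D₂ : Datum R A' L) : Prop where
  standard : ∀ i, Nonempty (D₁.G (D₁.Δ i) ≃ₗ[A'] D₂.G (D₂.Δ i))
  heightOne : ∀ (p : Ideal R) [p.IsPrime], p.height = 1 → ∀ (l : List L) (X : Type u)
    [AddCommGroup X] [Module (Localization.AtPrime p ⊗[R] D₁.A) X],
    D₁.FiltBC (Localization.AtPrime p) l X →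
    ∃ (l' : List L) (Z : Type u) (_ : AddCommGroup Z)
      (_ : Module (Localization.AtPrime p ⊗[R] D₂.A) Z), D₂.FiltBC (Localization.AtPrime p) l' Z ∧
      Nonempty (D₁.GBC (Localization.AtPrime p) X ≃ₗ[Localization.AtPrime p ⊗[R] A']
        D₂.GBC (Localization.AtPrime p) Z)

variable [LinearOrder L] {D₁ D₂ : Datum R A' L} [IsRegularLocalRing R] [Module.Finite R A']

/-- Dévissage reduces to images of standard modules. These can be taken in the second category,
where goodness lifts the homomorphism to one between standard modules in the forbidden direction. -/
theorem IsRS.hom_G_eq_zero (h₂ : D₂.IsRS) (h : Matches D₁ D₂)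
    {i : L} {l : List L} (hl : ∀ j ∈ l, i < j) :
    ∀ {X : Type u} [AddCommGroup X] [Module D₁.A X], D₁.Filt l X →
      ∀ f : D₁.G X →ₗ[A'] D₂.G (D₂.Δ i), f = 0 := by
  induction l with
  | nil =>
    intro X _ _ hX f
    haveI : Subsingleton X := hX
    haveI : Subsingleton (D₁.G X) := BTensor.subsingleton
    exact Subsingleton.elim _ _
  | cons j l ih =>
    rintro X _ _ ⟨g, hg, hX⟩ f
    have h0 := ih (fun j' hj' => hl j' (List.mem_cons_of_mem j hj')) hX
      (f ∘ₗ D₁.Gmap (LinearMap.ker g).subtype)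
    have hex := BTensor.map_exact (A' := A') (B := D₁.B) hg (LinearMap.exact_subtype_ker_map g)
    obtain ⟨f', hf'⟩ := exists_factor (BTensor.map_surjective (A' := A') (B := D₁.B) hg) f
      fun x hx => by
        obtain ⟨y, rfl⟩ := (hex x).1 hx
        exact LinearMap.congr_fun h0 y
    obtain ⟨e⟩ := h.standard j
    obtain ⟨k, hk⟩ := (h₂.isGood' (FiltBy.singleton (A := D₂.A) (Δ := D₂.Δ) i)).exists_map_eq
      (f' ∘ₗ e.symm.toLinearMap)
    have hk0 : k = 0 := by
      by_contra hne
      exact (h₂.hom_le _ _ k hne).not_gt (hl j List.mem_cons_self)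
    refine LinearMap.ext fun x => ?_
    have h1 := LinearMap.congr_fun hk (e (D₁.Gmap g x))
    rw [hk0, BTensor.map_zero, LinearMap.comp_apply, LinearEquiv.coe_coe, e.symm_apply_apply,
      hf'] at h1
    exact h1.symm

/-- Through `eY` and `eΔ`, the module `G₁ X` is an extension of values of the second functor.
`IsRS.exists_lift` reduces its realization in the second category to the zero prime, treated by the
generic equivalence, and to primes of height one, where the images of filtered modules agree. -/
theorem IsRS.exists_transfer_step (h₁ : D₁.IsRS) (h₂ : D₂.IsRS) (h : Matches D₁ D₂) {i : L}
    {l l' : List L} (hl : ∀ j ∈ l, i ≤ j) {X : Type u} [AddCommGroup X] [Module R X]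
    [Module D₁.A X] [IsScalarTower R D₁.A X] (g : X →ₗ[D₁.A] D₁.Δ i) (hg : Function.Surjective g)
    (hX : D₁.Filt l (LinearMap.ker g)) {Y : Type u} [AddCommGroup Y] [Module R Y]
    [Module D₂.A Y] [IsScalarTower R D₂.A Y] (hY : D₂.Filt l' Y)
    (eY : D₁.G (LinearMap.ker g) ≃ₗ[A'] D₂.G Y) (eΔ : D₁.G (D₁.Δ i) ≃ₗ[A'] D₂.G (D₂.Δ i)) :
    ∃ (E : Type u) (_ : AddCommGroup E) (_ : Module R E) (_ : Module D₂.A E)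
      (_ : IsScalarTower R D₂.A E) (p : E →ₗ[D₂.A] D₂.Δ i) (e : D₂.G E ≃ₗ[A'] D₁.G X),
      Function.Surjective p ∧ D₂.Filt l' (LinearMap.ker p) ∧
      ∀ z, eΔ (D₁.Gmap g (e z)) = D₂.Gmap p z := by
  haveI := (IsRegularLocalRing.isDomain R).1
  let f : D₂.G Y →ₗ[A'] D₁.G X := D₁.Gmap (LinearMap.ker g).subtype ∘ₗ eY.symm.toLinearMap
  let g' : D₁.G X →ₗ[A'] D₂.G (D₂.Δ i) := eΔ.toLinearMap ∘ₗ D₁.Gmap g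
  have hf : Function.Injective f := (h₁.exact i l X g hg hX).comp eY.symm.injective
  have hg' : Function.Surjective g' := eΔ.surjective.comp (BTensor.map_surjective hg)
  have hex := BTensor.map_exact (A' := A') (B := D₁.B) hg (LinearMap.exact_subtype_ker_map g)
  have hfg : Function.Exact f g' := by
    intro x
    have h1 : g' x = 0 ↔ D₁.Gmap g x = 0 := eΔ.map_eq_zero_iff
    rw [h1, hex x]
    constructor
    · rintro ⟨y, rfl⟩
      exact ⟨eY y, congrArg _ (eY.symm_apply_apply y)⟩
    · rintro ⟨y, rfl⟩
      exact ⟨eY.symm y, rfl⟩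
  have hXi : D₁.Filt (i :: l) X := ⟨g, hg, hX⟩
  haveI := (h₁.projective_G hXi).2
  haveI : Module.Finite D₁.A X := hXi.finite
  haveI := BTensor.finite A' D₁.A D₁.B (M := X)
  haveI := D₁.finite_G X
  obtain ⟨E, _, _, j, p, e, hj, hp, hjp, hpe⟩ := exists_extension_of_lifts (h₂.isGood' hY) f g'
    hf hg' hfg fun x => h₂.exists_lift hY f g' hf hg' hfg x fun q hq hq1 => by
      by_cases hq0 : q = ⊥
      · subst hq0
        obtain ⟨s, hs, hh⟩ := h₂.exists_lift_generic g' hg' x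
        exact ⟨s, hs, hh⟩
      · have hq1' : q.height = 1 := by
          exact le_antisymm hq1 (ENat.one_le_iff_ne_zero.2 fun h0 =>
            hq0 (Ideal.height_eq_zero_iff_eq_bot.1 h0))
        obtain ⟨l'', Z, _, _, hZ, ⟨φ⟩⟩ := h.heightOne q hq1' (i :: l) (BC R _ X) hXi.baseChange
        exact h₂.exists_lift_prime g' hg'
          -- All labels of `X` are at least `i`, so `G₁ X` has no nonzero homomorphism to images of
          -- standard modules with label below `i`; this is why the step requires a minimal label on
          -- top.
          (fun j hj => h₂.hom_G_eq_zero h (fun j' hj' => by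
            rcases List.mem_cons.1 hj' with rfl | hj'
            · exact hj
            · exact hj.trans_le (hl j' hj')) hXi) q hZ
          (φ.symm.trans (baseChangeTensor R _ D₁.A A' D₁.B X).symm) x
  letI : Module R E := Module.restrictScalars R D₂.A E
  haveI : IsScalarTower R D₂.A E := IsScalarTower.restrictScalars R D₂.A E
  refine ⟨E, _, _, _, ‹_›, p, e, hp, hY.congr ((LinearEquiv.ofInjective j hj).trans
    (LinearEquiv.ofEq _ _ hjp.linearMap_ker_eq.symm)), hpe⟩

/-- Induction is on the length, not on the list, because moving a minimal label to the top permutes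
the list before its tail is transferred. -/
theorem IsRS.exists_transfer (h₁ : D₁.IsRS) (h₂ : D₂.IsRS) (h : Matches D₁ D₂) (n : ℕ) :
    ∀ (l : List L) (_ : l.length = n) (X : Type u) [AddCommGroup X] [Module R X] [Module D₁.A X]
      [IsScalarTower R D₁.A X], D₁.Filt l X → ∃ (l' : List L) (Y : Type u) (_ : AddCommGroup Y)
      (_ : Module R Y) (_ : Module D₂.A Y) (_ : IsScalarTower R D₂.A Y), D₂.Filt l' Y ∧
      Nonempty (D₁.G X ≃ₗ[A'] D₂.G Y) := by
  classical
  induction n with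
  | zero =>
    intro l hl X _ _ _ _ hX
    rw [List.length_eq_zero_iff] at hl
    subst hl
    haveI : Subsingleton X := hX
    haveI : Subsingleton (D₁.G X) := BTensor.subsingleton
    haveI : Subsingleton (D₂.G PUnit) := BTensor.subsingleton
    exact ⟨[], PUnit, inferInstance, inferInstance, inferInstance, inferInstance,
      (inferInstance : Subsingleton PUnit),
      ⟨0, 0, fun _ => Subsingleton.elim _ _, fun _ => Subsingleton.elim _ _⟩⟩
  | succ n ih =>
    intro l hl X _ _ _ _ hX
    obtain ⟨i, hi, hmin⟩ := l.toFinset.exists_min_image id (by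
      obtain ⟨a, ha⟩ := List.exists_mem_of_length_pos (by omega : 0 < l.length)
      exact ⟨a, List.mem_toFinset.2 ha⟩)
    obtain ⟨l₁, hperm, g, hg, hX'⟩ := FiltBy.exists_top (List.mem_toFinset.1 hi)
      (fun j hj => h₁.extVanish (hmin j (List.mem_toFinset.2 hj))) hX
    obtain ⟨l₂, Y, _, _, _, _, hY, ⟨eY⟩⟩ := ih l₁ (by
      have := hperm.length_eq
      rw [List.length_cons] at this
      omega) (LinearMap.ker g) hX'
    obtain ⟨eΔ⟩ := h.standard i
    obtain ⟨E, _, _, _, _, p, e, hp, hE, -⟩ := h₁.exists_transfer_step h₂ h (fun j hj =>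
      hmin j (List.mem_toFinset.2 (hperm.mem_iff.2 (List.mem_cons_of_mem i hj)))) g hg hX' hY eY eΔ
    exact ⟨i :: l₂, E, _, _, _, ‹_›, ⟨p, hp, hE⟩, ⟨e.symm⟩⟩

/-- The transfer of a projective cover of a standard module. -/
theorem IsRS.exists_transfer_cover (h₁ : D₁.IsRS) (h₂ : D₂.IsRS) (h : Matches D₁ D₂) {i : L}
    (eΔ : D₁.G (D₁.Δ i) ≃ₗ[A'] D₂.G (D₂.Δ i))
    {l : List L} (hl : ∀ j ∈ l, i ≤ j) {X : Type u} [AddCommGroup X] [Module R X]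
    [Module D₁.A X] [IsScalarTower R D₁.A X] (g : X →ₗ[D₁.A] D₁.Δ i) (hg : Function.Surjective g)
    (hX : D₁.Filt l (LinearMap.ker g)) :
    ∃ (l' : List L) (E : Type u) (_ : AddCommGroup E) (_ : Module R E) (_ : Module D₂.A E)
      (_ : IsScalarTower R D₂.A E) (p : E →ₗ[D₂.A] D₂.Δ i) (e : D₂.G E ≃ₗ[A'] D₁.G X),
      Function.Surjective p ∧ D₂.Filt l' (LinearMap.ker p) ∧
      ∀ z, eΔ (D₁.Gmap g (e z)) = D₂.Gmap p z := by
  obtain ⟨l', Y, _, _, _, _, hY, ⟨eY⟩⟩ := h₁.exists_transfer h₂ h _ l rfl (LinearMap.ker g) hX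
  obtain ⟨E, hE⟩ := h₁.exists_transfer_step h₂ h hl g hg hX hY eY eΔ
  exact ⟨l', E, hE⟩

end

end Datum

end HighestWeight

end

noncomputable section

namespace HighestWeight

namespace Datum

/-! #### Images of projective modules -/

section

variable {R A' : Type u} [CommRing R] [Ring A'] [Algebra R A'] {L : Type v}

/-- The module is the value of the functor at a finite projective module. -/
def IsImage (D : Datum R A' L) (W : Type u) [AddCommGroup W] [Module A' W] : Prop :=
  ∃ (Q : Type u) (_ : AddCommGroup Q) (_ : Module D.A Q), Module.Projective D.A Q ∧
    Module.Finite D.A Q ∧ Nonempty (D.G Q ≃ₗ[A'] W)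

variable {D : Datum R A' L} {V W : Type u} [AddCommGroup V] [Module A' V] [AddCommGroup W]
  [Module A' W]

theorem IsImage.prod (hV : D.IsImage V) (hW : D.IsImage W) : D.IsImage (V × W) := by
  obtain ⟨P, _, _, hP, hP', ⟨e⟩⟩ := hV
  obtain ⟨Q, _, _, hQ, hQ', ⟨f⟩⟩ := hW
  exact ⟨P × Q, _, _, inferInstance, inferInstance, ⟨BTensor.prodEquiv.trans (e.prodCongr f)⟩⟩

variable [LinearOrder L] [IsRegularLocalRing R] [Module.Finite R A']

/-- A projective module is a retract of a filtered one, and goodness passes to retracts. -/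
theorem IsRS.isGood_projective (hD : D.IsRS) (Q : Type u) [AddCommGroup Q] [Module D.A Q]
    [Module.Projective D.A Q] [Module.Finite D.A Q] : BTensor.IsGood A' D.A D.B Q := by
  obtain ⟨P, _, _, _, _, p, -, -, hp, l, hl⟩ := hD.exists_projective Q
  obtain ⟨i, hi⟩ := Module.projective_lifting_property p LinearMap.id hp
  exact (hD.isGood' hl).retract i p (LinearMap.congr_fun hi)

/-- The idempotent of `G Q` cutting out `W` comes from an endomorphism `ε` of `Q`, by goodness of
`Q`. It is again idempotent, and its range is a projective module with image `W`. -/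
theorem IsImage.retract (hD : D.IsRS) (hV : D.IsImage V) (i : W →ₗ[A'] V) (r : V →ₗ[A'] W)
    (h : ∀ x, r (i x) = x) : D.IsImage W := by
  obtain ⟨Q, _, _, hQ, hQ', ⟨e⟩⟩ := hV
  have hgood := hD.isGood_projective Q
  let i' : W →ₗ[A'] D.G Q := e.symm.toLinearMap ∘ₗ i
  let r' : D.G Q →ₗ[A'] W := r ∘ₗ e.toLinearMap
  have h' : ∀ x, r' (i' x) = x := fun x =>
    (congrArg r (e.apply_symm_apply (i x))).trans (h x)
  obtain ⟨ε, hε⟩ := hgood.exists_map_eq (i' ∘ₗ r')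
  have hε' : ∀ z, D.Gmap ε z = i' (r' z) := LinearMap.congr_fun hε
  have hεε : ε ∘ₗ ε = ε := hgood.map_injective (LinearMap.ext fun z => by
    rw [BTensor.map_comp, LinearMap.comp_apply]
    change D.Gmap ε (D.Gmap ε z) = D.Gmap ε z
    rw [hε', hε', h'])
  let s := (LinearMap.range ε).subtype
  let t := ε.rangeRestrict
  have hst : s ∘ₗ t = ε := rfl
  have hts : t ∘ₗ s = LinearMap.id := LinearMap.ext fun x => by
    obtain ⟨_, y, rfl⟩ := x
    exact Subtype.ext (LinearMap.congr_fun hεε y)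
  refine ⟨LinearMap.range ε, _, _, Module.Projective.of_split s t hts, inferInstance,
    ⟨LinearEquiv.ofLinearMap (r' ∘ₗ D.Gmap s) (D.Gmap t ∘ₗ i') (LinearMap.ext fun x => ?_)
      (LinearMap.ext fun x => ?_)⟩⟩
  · change r' (D.Gmap s (D.Gmap t (i' x))) = x
    rw [BTensor.map_map, hst]
    change r' (D.Gmap ε (i' x)) = x
    rw [hε', h', h']
  · change D.Gmap t (i' (r' (D.Gmap s x))) = x
    have hts' : t ∘ₗ (ε ∘ₗ s) = LinearMap.id := by
      have h1 : ε ∘ₗ s = s ∘ₗ (t ∘ₗ s) := rfl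
      rw [h1, hts, LinearMap.comp_id, hts]
    rw [← hε', BTensor.map_map, BTensor.map_map, LinearMap.comp_assoc, hts', BTensor.map_id]
    rfl

end

/-! ### Covers by projectives whose images come from the other category. -/

section

variable {R A' : Type u} [CommRing R] [Ring A'] [Algebra R A'] {L : Type v}
variable {D₁ D₂ : Datum R A' L}

/-- The module is a quotient of a finite projective module whose value under the functor is the
value of the other functor at a finite projective module. -/
def IsCovered (D₁ D₂ : Datum R A' L) (X : Type u) [AddCommGroup X] [Module D₁.A X] : Prop :=
  ∃ (S : Type u) (_ : AddCommGroup S) (_ : Module D₁.A S) (p : S →ₗ[D₁.A] X),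
    Module.Projective D₁.A S ∧ Module.Finite D₁.A S ∧ Function.Surjective p ∧ D₂.IsImage (D₁.G S)

theorem IsCovered.of_surjective {X Y : Type u} [AddCommGroup X] [Module D₁.A X] [AddCommGroup Y]
    [Module D₁.A Y] (h : IsCovered D₁ D₂ X) (f : X →ₗ[D₁.A] Y) (hf : Function.Surjective f) :
    IsCovered D₁ D₂ Y :=
  let ⟨S, _, _, p, hS, hS', hp, hi⟩ := h
  ⟨S, _, _, f ∘ₗ p, hS, hS', hf.comp hp, hi⟩

theorem IsImage.congr {D : Datum R A' L} {V W : Type u} [AddCommGroup V] [Module A' V]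
    [AddCommGroup W] [Module A' W] (h : D.IsImage V) (e : V ≃ₗ[A'] W) : D.IsImage W :=
  let ⟨Q, _, _, hQ, hQ', ⟨f⟩⟩ := h
  ⟨Q, _, _, hQ, hQ', ⟨f.trans e⟩⟩

/-- The horseshoe construction: a cover of the kernel and a lift of a cover of the top factor
together cover `X`. -/
theorem IsCovered.of_filt {l : List L} (hl : ∀ j ∈ l, IsCovered D₁ D₂ (D₁.Δ j)) :
    ∀ {X : Type u} [AddCommGroup X] [Module D₁.A X], D₁.Filt l X → IsCovered D₁ D₂ X := by
  induction l with
  | nil =>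
    intro X _ _ h
    haveI : Subsingleton X := h
    haveI : Subsingleton (D₁.G PUnit) := BTensor.subsingleton
    haveI : Subsingleton (D₂.G PUnit) := BTensor.subsingleton
    exact ⟨PUnit, inferInstance, inferInstance, 0, inferInstance, inferInstance,
      fun x => ⟨0, Subsingleton.elim _ _⟩, PUnit, inferInstance, inferInstance, inferInstance,
      inferInstance, ⟨0, 0, fun _ => Subsingleton.elim _ _, fun _ => Subsingleton.elim _ _⟩⟩
  | cons j l ih =>
    rintro X _ _ ⟨g, hg, h⟩
    obtain ⟨S, _, _, p, hS, hS', hp, hi⟩ := ih (fun j' hj' => hl j' (List.mem_cons_of_mem j hj')) h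
    obtain ⟨T, _, _, q, hT, hT', hq, hj⟩ := hl j List.mem_cons_self
    obtain ⟨q', hq'⟩ := Module.projective_lifting_property g q hg
    refine ⟨S × T, _, _, ((LinearMap.ker g).subtype ∘ₗ p).coprod q', inferInstance, inferInstance,
      fun x => ?_, (hi.prod hj).congr BTensor.prodEquiv.symm⟩
    obtain ⟨t, ht⟩ := hq (g x)
    have h1 : g (q' t) = g x := (LinearMap.congr_fun hq' t).trans ht
    obtain ⟨s, hs⟩ := hp ⟨x - q' t, by rw [LinearMap.mem_ker, map_sub, h1, sub_self]⟩
    refine ⟨(s, t), ?_⟩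
    rw [LinearMap.coprod_apply, LinearMap.comp_apply, hs]
    exact sub_add_cancel _ _

variable [LinearOrder L] [IsRegularLocalRing R] [Module.Finite R A']

/-- Descending induction on `i`. The covers `P₁` and `P₂` of both standard modules are transferred
to `E₂` and `E₁`; lifting `p₁` and `p₂` through these gives `a' : G₁ P₁ → G₂ P₂` and `b'` back,
compatible with the maps to the common standard image. So `b' a'` comes from an endomorphism `c` of
`P₁` over `Δ i`, and `1 - c` has values in the kernel of `p₁`. -/
theorem IsRS.isCovered_Δ [Finite L] (h₁ : D₁.IsRS) (h₂ : D₂.IsRS) (h₁₂ : Matches D₁ D₂)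
    (h₂₁ : Matches D₂ D₁) (i : L) : IsCovered D₁ D₂ (D₁.Δ i) := by
  induction i using WellFoundedGT.induction with
  | _ i ih =>
  obtain ⟨e⟩ := h₁₂.standard i
  obtain ⟨P₁, _, _, _, _, p₁, hP₁, hP₁', hp₁, l₁, hl₁, hk₁⟩ := h₁.exists_cover i
  obtain ⟨P₂, _, _, _, _, p₂, hP₂, hP₂', hp₂, l₂, hl₂, hk₂⟩ := h₂.exists_cover i
  obtain ⟨_, E₂, _, _, _, _, q₂, e₂, hq₂, -, he₂⟩ := h₁.exists_transfer_cover h₂ h₁₂ e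
    (fun j hj => (hl₁ j hj).le) p₁ hp₁ hk₁
  obtain ⟨_, E₁, _, _, _, _, q₁, e₁, hq₁, -, he₁⟩ := h₂.exists_transfer_cover h₁ h₂₁ e.symm
    (fun j hj => (hl₂ j hj).le) p₂ hp₂ hk₂
  obtain ⟨a, ha⟩ := Module.projective_lifting_property q₁ p₁ hq₁
  obtain ⟨b, hb⟩ := Module.projective_lifting_property q₂ p₂ hq₂
  let a' : D₁.G P₁ →ₗ[A'] D₂.G P₂ := e₁.toLinearMap ∘ₗ D₁.Gmap a
  let b' : D₂.G P₂ →ₗ[A'] D₁.G P₁ := e₂.toLinearMap ∘ₗ D₂.Gmap b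
  have hab : ∀ z, D₁.Gmap p₁ (b' (a' z)) = D₁.Gmap p₁ z := fun z => by
    apply e.injective
    change e (D₁.Gmap p₁ (e₂ (D₂.Gmap b (a' z)))) = _
    rw [he₂, BTensor.map_map, hb]
    apply e.symm.injective
    change e.symm (D₂.Gmap p₂ (e₁ (D₁.Gmap a z))) = _
    rw [he₁, BTensor.map_map, ha, e.symm_apply_apply]
  obtain ⟨c, hc⟩ := (h₁.isGood_projective P₁).exists_map_eq (b' ∘ₗ a')
  have hc' : ∀ z, D₁.Gmap c z = b' (a' z) := LinearMap.congr_fun hc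
  have hpc : p₁ ∘ₗ c = p₁ := (h₁.isGood' (FiltBy.singleton (A := D₁.A) (Δ := D₁.Δ)
    i)).map_injective (LinearMap.ext fun z => by
      rw [BTensor.map_comp, LinearMap.comp_apply]
      change D₁.Gmap p₁ (D₁.Gmap c z) = D₁.Gmap p₁ z
      rw [hc', hab])
  -- The kernel involves only larger labels, so by induction it is covered by some `S` whose image
  -- is also one for the second functor. The map `1 - c` factors through `S`, which exhibits `G₁ P₁`
  -- as a retract of `G₂ P₂ × G₁ S`.
  obtain ⟨S, _, _, s, hS, hS', hs, hi⟩ := IsCovered.of_filt (D₂ := D₂)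
    (fun j hj => ih j (hl₁ j hj)) hk₁
  obtain ⟨d, hd⟩ := Module.projective_lifting_property s
    ((LinearMap.id - c).codRestrict (LinearMap.ker p₁) fun x => by
      have := LinearMap.congr_fun hpc x
      rw [LinearMap.comp_apply] at this
      rw [LinearMap.mem_ker, LinearMap.sub_apply, LinearMap.id_apply, map_sub, this, sub_self]) hs
  have hd' : ∀ x, x = c x + ((LinearMap.ker p₁).subtype ∘ₗ s) (d x) := fun x => by
    have h1 : ((s (d x) : LinearMap.ker p₁) : P₁) = x - c x :=
      congrArg Subtype.val (LinearMap.congr_fun hd x)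
    rw [LinearMap.comp_apply, Submodule.subtype_apply, h1, add_sub_cancel]
  refine ⟨P₁, _, _, p₁, hP₁, hP₁', hp₁, IsImage.retract h₂
    (IsImage.prod (⟨P₂, _, _, hP₂, hP₂', ⟨LinearEquiv.refl _ _⟩⟩ : D₂.IsImage (D₂.G P₂)) hi)
    (a'.prod (D₁.Gmap d)) (b'.coprod (D₁.Gmap ((LinearMap.ker p₁).subtype ∘ₗ s))) fun z => ?_⟩
  have h1 : (LinearMap.id : P₁ →ₗ[D₁.A] P₁) = c + ((LinearMap.ker p₁).subtype ∘ₗ s) ∘ₗ d :=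
    LinearMap.ext hd'
  have h2 := LinearMap.congr_fun (congrArg (D₁.Gmap (X := P₁) (Y := P₁)) h1) z
  change BTensor.map A' D₁.A D₁.B LinearMap.id z = BTensor.map A' D₁.A D₁.B (c + _) z at h2
  rw [BTensor.map_id, LinearMap.id_apply, BTensor.map_add, LinearMap.add_apply,
    BTensor.map_comp _ d] at h2
  rw [LinearMap.coprod_apply]
  change b' (a' z) + _ = z
  rw [← hc']
  exact h2.symm

/-- The bimodule of one functor is the image of a progenerator under the other. -/
theorem IsRS.isImage_B [Finite L] (h₁ : D₁.IsRS) (h₂ : D₂.IsRS) (h₁₂ : Matches D₁ D₂)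
    (h₂₁ : Matches D₂ D₁) : D₂.IsImage D₁.B := by
  obtain ⟨P, _, _, _, _, p, -, -, hp, l, hl⟩ := h₁.exists_projective D₁.A
  obtain ⟨S, _, _, s, hS, hS', hs, hi⟩ := (IsCovered.of_filt
    (fun j _ => h₁.isCovered_Δ h₂ h₁₂ h₂₁ j) hl).of_surjective p hp
  -- The regular module is projective, so it is a retract of its cover `S`; its image under the
  -- functor is `B`.
  obtain ⟨t, ht⟩ := Module.projective_lifting_property s LinearMap.id hs
  have h1 := IsImage.retract (W := D₁.G D₁.A) h₂ hi (D₁.Gmap t) (D₁.Gmap s) fun z => by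
    rw [BTensor.map_map, ht, BTensor.map_id]; rfl
  exact h1.congr (BTensor.rid A' D₁.A D₁.B)

/-- The functor commutes with finite powers. -/
theorem nonempty_G_pi (D : Datum R A' L) (X : Type u) [AddCommGroup X] [Module D.A X] (n : ℕ) :
    Nonempty (D.G (Fin n → X) ≃ₗ[A'] (Fin n → D.G X)) := by
  induction n with
  | zero =>
    haveI : Subsingleton (D.G (Fin 0 → X)) := BTensor.subsingleton
    exact ⟨0, 0, fun _ => Subsingleton.elim _ _, fun _ => Subsingleton.elim _ _⟩
  | succ n ih =>
    obtain ⟨e⟩ := ih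
    exact ⟨(BTensor.congr (Fin.consLinearEquiv D.A fun _ => X).symm).trans
      (BTensor.prodEquiv.trans (((LinearEquiv.refl _ _).prodCongr e).trans
        (Fin.consLinearEquiv A' fun _ => D.G X)))⟩

/-- This says that `Q` is a generator. By symmetry `B₂ ≅ G₁ Q'` with `Q'` a retract of a free
`A₁`-module, so `B₂ = G₂ A₂` is a retract of a power of `B₁ ≅ G₂ Q`. Full faithfulness on
projectives brings the retraction back to `A₂`. -/
theorem IsRS.exists_retract [Finite L] (h₁ : D₁.IsRS) (h₂ : D₂.IsRS) (h₁₂ : Matches D₁ D₂)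
    (h₂₁ : Matches D₂ D₁) (Q : Type u) [AddCommGroup Q] [Module D₂.A Q]
    [Module.Projective D₂.A Q] [Module.Finite D₂.A Q] (e : D₂.G Q ≃ₗ[A'] D₁.B) :
    ∃ (n : ℕ) (i : D₂.A →ₗ[D₂.A] (Fin n → Q)) (r : (Fin n → Q) →ₗ[D₂.A] D₂.A),
      ∀ x, r (i x) = x := by
  obtain ⟨Q', _, _, hQ, hQ', ⟨e'⟩⟩ := h₂.isImage_B h₁ h₂₁ h₁₂
  obtain ⟨n, f, hf⟩ := Module.Finite.exists_fin' D₁.A Q'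
  obtain ⟨g, hg⟩ := Module.projective_lifting_property f LinearMap.id hf
  obtain ⟨e₁⟩ := D₁.nonempty_G_pi D₁.A n
  obtain ⟨e₂⟩ := D₂.nonempty_G_pi Q n
  let E : D₁.G (Fin n → D₁.A) ≃ₗ[A'] D₂.G (Fin n → Q) :=
    e₁.trans ((LinearEquiv.piCongrRight fun _ => (BTensor.rid A' D₁.A D₁.B).trans e.symm).trans
      e₂.symm)
  let E' : D₂.G D₂.A ≃ₗ[A'] D₁.G Q' := (BTensor.rid A' D₂.A D₂.B).trans e'.symm
  haveI : Module.Projective D₂.A (Fin n → Q) :=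
    Module.Projective.of_equiv (DirectSum.linearEquivFunOnFintype D₂.A (Fin n) fun _ => Q)
  obtain ⟨i, hi⟩ := (h₂.isGood_projective (Fin n → Q)).exists_map_eq
    (E.toLinearMap ∘ₗ D₁.Gmap g ∘ₗ E'.toLinearMap)
  obtain ⟨r, hr⟩ := (h₂.isGood_projective D₂.A).exists_map_eq
    (E'.symm.toLinearMap ∘ₗ D₁.Gmap f ∘ₗ E.symm.toLinearMap)
  refine ⟨n, i, r, LinearMap.congr_fun (f := r ∘ₗ i) (g := LinearMap.id)
    ((h₂.isGood_projective D₂.A).map_injective (LinearMap.ext fun z => ?_))⟩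
  have h1 := LinearMap.congr_fun hi z
  have h2 := LinearMap.congr_fun hr (D₂.Gmap i z)
  have h3 : D₁.Gmap f (D₁.Gmap g (E' z)) = E' z := by
    rw [BTensor.map_map, hg, BTensor.map_id]; rfl
  rw [BTensor.map_comp, BTensor.map_id]
  change D₂.Gmap r (D₂.Gmap i z) = z
  refine h2.trans ?_
  change E'.symm (D₁.Gmap f (E.symm (D₂.Gmap i z))) = z
  have h4 : D₂.Gmap i z = E (D₁.Gmap g (E' z)) := h1
  rw [h4, E.symm_apply_apply, h3, E'.symm_apply_apply]

end

end Datum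

end HighestWeight

end

noncomputable section

namespace HighestWeight

/-! ### Right exact functors between categories of finite modules -/

section RightExact

variable {A A' : Type u} [Ring A] [Ring A']

/-- The underlying linear map. -/
abbrev lin {X Y : FGModuleCat.{u} A} (f : X ⟶ Y) : X →ₗ[A] Y := f.hom.hom

/-- The morphism given by a linear map. -/
abbrev mor {X Y : FGModuleCat.{u} A} (f : X →ₗ[A] Y) : X ⟶ Y :=
  ObjectProperty.homMk (ModuleCat.ofHom f)

/-- The functor preserves presentations. -/
def IsRightExact (F : FGModuleCat.{u} A ⥤ FGModuleCat.{u} A') : Prop :=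
  ∀ ⦃X Y Z : FGModuleCat.{u} A⦄ (f : X ⟶ Y) (g : Y ⟶ Z), Function.Surjective (lin g) →
    Function.Exact (lin f) (lin g) → Function.Surjective (lin (F.map g)) ∧
      Function.Exact (lin (F.map f)) (lin (F.map g))

theorem IsRightExact.comp {A'' : Type u} [Ring A''] {F : FGModuleCat.{u} A ⥤ FGModuleCat.{u} A'}
    {G : FGModuleCat.{u} A' ⥤ FGModuleCat.{u} A''} (hF : IsRightExact F) (hG : IsRightExact G) :
    IsRightExact (F ⋙ G) := fun _ _ _ f g hg hfg =>
  hG _ _ (hF f g hg hfg).1 (hF f g hg hfg).2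

theorem surjective_of_epi {X Y : FGModuleCat.{u} A} (f : X ⟶ Y) [Epi f] :
    Function.Surjective (lin f) := by
  rw [← LinearMap.range_eq_top, ← Submodule.ker_mkQ (LinearMap.range (lin f)),
    LinearMap.ker_eq_top]
  let Q : FGModuleCat.{u} A := FGModuleCat.of A (Y ⧸ LinearMap.range (lin f))
  let q : Y ⟶ Q := mor (LinearMap.range (lin f)).mkQ
  have h1 : q = 0 := by
    rw [← cancel_epi f, comp_zero]
    exact FGModuleCat.hom_ext (LinearMap.range_mkQ_comp (lin f))
  exact congrArg lin h1

theorem epi_of_surjective {X Y : FGModuleCat.{u} A} (f : X ⟶ Y)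
    (hf : Function.Surjective (lin f)) : Epi f :=
  ⟨fun {_} _ _ h => FGModuleCat.hom_ext (LinearMap.cancel_right hf |>.1 (congrArg lin h))⟩

theorem isIso_of_bijective {X Y : FGModuleCat.{u} A} (f : X ⟶ Y)
    (hf : Function.Bijective (lin f)) : IsIso f :=
  ⟨mor (LinearEquiv.ofBijective (lin f) hf).symm.toLinearMap,
    FGModuleCat.hom_ext (LinearMap.ext fun x =>
      (LinearEquiv.ofBijective (lin f) hf).symm_apply_apply x),
    FGModuleCat.hom_ext (LinearMap.ext fun x =>
      (LinearEquiv.ofBijective (lin f) hf).apply_symm_apply x)⟩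

/-- A surjection is a cokernel of a homomorphism onto its kernel. -/
def isColimitOfExact {X Y Z : FGModuleCat.{u} A} (f : X ⟶ Y) (g : Y ⟶ Z)
    (hg : Function.Surjective (lin g)) (hfg : Function.Exact (lin f) (lin g)) (w : f ≫ g = 0) :
    IsColimit (CokernelCofork.ofπ g w) :=
  haveI := epi_of_surjective g hg
  have h : ∀ {W : FGModuleCat.{u} A} (k : Y ⟶ W), f ≫ k = 0 → ∃ l : Z ⟶ W, g ≫ l = k := by
    intro W k hk
    obtain ⟨l, hl⟩ := exists_factor hg (lin k) fun y hy => by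
      obtain ⟨x, rfl⟩ := (hfg y).1 hy
      exact LinearMap.congr_fun (congrArg lin hk) x
    exact ⟨mor l, FGModuleCat.hom_ext (LinearMap.ext hl)⟩
  CokernelCofork.IsColimit.ofπ g w (fun k hk => (h k hk).choose)
    (fun k hk => (h k hk).choose_spec) fun k hk m hm => by
      rw [← cancel_epi g, hm, (h k hk).choose_spec]

theorem exact_of_isColimit {X Y Z : FGModuleCat.{u} A} (f : X ⟶ Y) (g : Y ⟶ Z) (w : f ≫ g = 0)
    (hc : IsColimit (CokernelCofork.ofπ g w)) : Function.Surjective (lin g) ∧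
      Function.Exact (lin f) (lin g) := by
  haveI : Epi g := Cofork.IsColimit.epi hc
  refine ⟨surjective_of_epi g, fun y => ⟨fun hy => ?_, ?_⟩⟩
  · let Q : FGModuleCat.{u} A := FGModuleCat.of A (Y ⧸ LinearMap.range (lin f))
    let q : Y ⟶ Q := mor (LinearMap.range (lin f)).mkQ
    obtain ⟨l, hl⟩ := CokernelCofork.IsColimit.desc' hc q
      (FGModuleCat.hom_ext (LinearMap.range_mkQ_comp (lin f)))
    have h1 : lin q y = 0 := by
      have h2 : lin (g ≫ l) y = lin q y := LinearMap.congr_fun (congrArg lin hl) y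
      rw [← h2]
      change lin l (lin g y) = 0
      rw [hy, map_zero]
    exact (Submodule.Quotient.mk_eq_zero _).1 h1
  · rintro ⟨x, rfl⟩
    exact LinearMap.congr_fun (congrArg lin w) x

theorem isRightExact_of_preserves (F : FGModuleCat.{u} A ⥤ FGModuleCat.{u} A') [F.Additive]
    [PreservesFiniteColimits F] : IsRightExact F := by
  intro X Y Z f g hg hfg
  have w : f ≫ g = 0 := FGModuleCat.hom_ext (LinearMap.ext hfg.apply_apply_eq_zero)
  have w' : F.map f ≫ F.map g = 0 := by rw [← F.map_comp, w, F.map_zero]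
  exact exact_of_isColimit (F.map f) (F.map g) w'
    ((CokernelCofork.ofπ g w).mapIsColimit (isColimitOfExact f g hg hfg w) F)

variable {B : Type u} [AddCommGroup B] [Module A' B] [Module Aᵐᵒᵖ B] [SMulCommClass A' Aᵐᵒᵖ B]
  [Module.Finite A' B]

variable (A' A B) in
theorem isRightExact_tensorFunctor : IsRightExact (tensorFunctor A' A B) := fun _ _ _ _ _ hg hfg =>
  ⟨BTensor.map_surjective hg, BTensor.map_exact hg hfg⟩

instance : (tensorFunctor A' A B).Additive where
  map_add {_ _ f g} := FGModuleCat.hom_ext (BTensor.map_add (lin f) (lin g))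

/-- The morphism from the regular module given by an element. -/
def point {X : FGModuleCat.{u} A} (x : X) : FGModuleCat.of A A ⟶ X :=
  mor (LinearMap.toSpanSingleton A X x)

theorem point_comp {X Y : FGModuleCat.{u} A} (x : X) (f : X ⟶ Y) :
    point x ≫ f = point (lin f x) :=
  FGModuleCat.hom_ext (LinearMap.ext fun a => map_smul (lin f) a x)

theorem point_add {X : FGModuleCat.{u} A} (x y : X) : point (x + y) = point x + point y :=
  FGModuleCat.hom_ext (LinearMap.ext fun a => smul_add a x y)

theorem point_smul {X : FGModuleCat.{u} A} (a : A) (x : X) :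
    point (a • x) = rightMul A a ≫ point x :=
  FGModuleCat.hom_ext (LinearMap.ext fun c => (smul_smul c a x))

section Comparison

variable (F : FGModuleCat.{u} A ⥤ FGModuleCat.{u} A') [F.Additive]
  (e : B ≃ₗ[A'] F.obj (FGModuleCat.of A A))
  (he : ∀ (a : A) (b : B), e (MulOpposite.op a • b) = lin (F.map (rightMul A a)) (e b))

/-- The comparison map from the tensor product with the value of a functor at the regular
module. -/
def comparison (X : FGModuleCat.{u} A) : BTensor A' A B X →ₗ[A'] F.obj X :=
  BTensor.lift
    { toFun := fun x => lin (F.map (point x)) ∘ₗ e.toLinearMap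
      map_zero' := by
        have h : point (0 : X) = 0 := FGModuleCat.hom_ext (LinearMap.ext fun a => smul_zero a)
        rw [h, F.map_zero]
        rfl
      map_add' := fun x y => by
        rw [point_add, F.map_add]
        rfl } fun a x b => by
      change lin (F.map (point (a • x))) (e b) = lin (F.map (point x)) (e (MulOpposite.op a • b))
      rw [he, point_smul, F.map_comp]
      rfl

theorem comparison_tmul (X : FGModuleCat.{u} A) (b : B) (x : X) :
    comparison F e he X (BTensor.tmul A' A b x) = lin (F.map (point x)) (e b) := rfl

theorem comparison_naturality {X Y : FGModuleCat.{u} A} (f : X ⟶ Y) (z : BTensor A' A B X) :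
    comparison F e he Y (BTensor.map A' A B (lin f) z) = lin (F.map f) (comparison F e he X z) := by
  induction z using BTensor.induction_on with
  | zero => simp
  | add x y hx hy => rw [map_add, map_add, hx, hy, map_add, map_add]
  | tmul b x =>
    rw [BTensor.map_tmul, comparison_tmul, comparison_tmul, ← point_comp, F.map_comp]
    rfl

theorem comparison_bijective_self :
    Function.Bijective (comparison F e he (FGModuleCat.of A A)) := by
  have h : comparison F e he (FGModuleCat.of A A) = e.toLinearMap ∘ₗ
      (BTensor.rid A' A B).toLinearMap := BTensor.ext fun b a => by
    rw [comparison_tmul]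
    exact (he a b).symm.trans (congrArg e (BTensor.rid_tmul b a).symm)
  rw [h]
  exact e.bijective.comp (BTensor.rid A' A B).bijective

theorem comparison_bijective_of_retracts {X Y Z : FGModuleCat.{u} A} (i : X ⟶ Y) (p : Y ⟶ X)
    (j : Z ⟶ Y) (q : Y ⟶ Z) (h : p ≫ i + q ≫ j = 𝟙 Y)
    (hX : Function.Bijective (comparison F e he X))
    (hZ : Function.Bijective (comparison F e he Z)) :
    Function.Bijective (comparison F e he Y) := by
  have h1 : ∀ z, z = BTensor.map A' A B (lin i) (BTensor.map A' A B (lin p) z) +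
      BTensor.map A' A B (lin j) (BTensor.map A' A B (lin q) z) := fun z => by
    have h2 : lin i ∘ₗ lin p + lin j ∘ₗ lin q = LinearMap.id := congrArg lin h
    rw [BTensor.map_map, BTensor.map_map, ← LinearMap.add_apply, ← BTensor.map_add, h2,
      BTensor.map_id]
    rfl
  have h3 : ∀ w, w = lin (F.map i) (lin (F.map p) w) + lin (F.map j) (lin (F.map q) w) := fun w => by
    have h4 := congrArg F.map h
    rw [F.map_add, F.map_comp, F.map_comp, F.map_id] at h4
    exact (LinearMap.congr_fun (congrArg lin h4) w).symm
  constructor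
  · rw [injective_iff_map_eq_zero]
    intro z hz
    have h5 := comparison_naturality F e he p z
    have h6 := comparison_naturality F e he q z
    rw [hz, map_zero] at h5 h6
    rw [h1 z, (map_eq_zero_iff _ hX.1).1 h5, (map_eq_zero_iff _ hZ.1).1 h6, map_zero, map_zero,
      add_zero]
  · intro w
    obtain ⟨x, hx⟩ := hX.2 (lin (F.map p) w)
    obtain ⟨z, hz⟩ := hZ.2 (lin (F.map q) w)
    exact ⟨BTensor.map A' A B (lin i) x + BTensor.map A' A B (lin j) z, by
      rw [map_add, comparison_naturality, comparison_naturality, hx, hz, ← h3]⟩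

theorem comparison_bijective_pi (n : ℕ) :
    Function.Bijective (comparison F e he (FGModuleCat.of A (Fin n → A))) := by
  induction n with
  | zero =>
    haveI : Subsingleton (BTensor A' A B (FGModuleCat.of A (Fin 0 → A))) :=
      haveI : Subsingleton (FGModuleCat.of A (Fin 0 → A)) :=
        inferInstanceAs (Subsingleton (Fin 0 → A))
      BTensor.subsingleton
    refine ⟨fun _ _ _ => Subsingleton.elim _ _, fun w => ⟨0, ?_⟩⟩
    have h : 𝟙 (FGModuleCat.of A (Fin 0 → A)) = 0 := FGModuleCat.hom_ext
      (LinearMap.ext fun x => @Subsingleton.elim _ (inferInstanceAs (Subsingleton (Fin 0 → A))) _ _)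
    have h2 := congrArg F.map h
    rw [F.map_id, F.map_zero] at h2
    rw [map_zero]
    exact (LinearMap.congr_fun (congrArg lin h2) w).symm
  | succ n ih =>
    let E := Fin.consLinearEquiv A fun _ : Fin (n + 1) => A
    refine comparison_bijective_of_retracts F e he
      (X := FGModuleCat.of A A) (Z := FGModuleCat.of A (Fin n → A))
      (mor (E.toLinearMap ∘ₗ LinearMap.inl A A (Fin n → A)))
      (mor (LinearMap.fst A A (Fin n → A) ∘ₗ E.symm.toLinearMap))
      (mor (E.toLinearMap ∘ₗ LinearMap.inr A A (Fin n → A)))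
      (mor (LinearMap.snd A A (Fin n → A) ∘ₗ E.symm.toLinearMap))
      (FGModuleCat.hom_ext (LinearMap.ext fun x => ?_)) (comparison_bijective_self F e he) ih
    change E ((E.symm x).1, 0) + E (0, (E.symm x).2) = x
    rw [← map_add, Prod.mk_add_mk, add_zero, zero_add]
    exact E.apply_symm_apply x

/-- The Eilenberg–Watts argument: the comparison is bijective on free modules, then surjective on
all finite modules. Surjectivity at the kernel of a presentation, which is finite because `A` is
Noetherian, yields injectivity. -/
theorem comparison_bijective [IsNoetherianRing A] (hF : IsRightExact F) (X : FGModuleCat.{u} A) :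
    Function.Bijective (comparison F e he X) := by
  have hsurj : ∀ X : FGModuleCat.{u} A, Function.Surjective (comparison F e he X) := by
    intro X w
    obtain ⟨n, p, hp⟩ := Module.Finite.exists_fin' A X
    let K : FGModuleCat.{u} A := FGModuleCat.of A (LinearMap.ker p)
    let P : FGModuleCat.{u} A := FGModuleCat.of A (Fin n → A)
    let i : K ⟶ P := mor (LinearMap.ker p).subtype
    let q : P ⟶ X := mor p
    obtain ⟨y, rfl⟩ := (hF i q hp (LinearMap.exact_subtype_ker_map p)).1 w
    obtain ⟨z, rfl⟩ := (comparison_bijective_pi F e he n).2 y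
    exact ⟨_, comparison_naturality F e he q z⟩
  refine ⟨?_, hsurj X⟩
  rw [injective_iff_map_eq_zero]
  intro z hz
  obtain ⟨n, p, hp⟩ := Module.Finite.exists_fin' A X
  let K : FGModuleCat.{u} A := FGModuleCat.of A (LinearMap.ker p)
  let P : FGModuleCat.{u} A := FGModuleCat.of A (Fin n → A)
  let i : K ⟶ P := mor (LinearMap.ker p).subtype
  let q : P ⟶ X := mor p
  obtain ⟨y, rfl⟩ := BTensor.map_surjective (A' := A') (B := B) hp z
  have h1 : lin (F.map q) (comparison F e he P y) = 0 := by
    rw [← comparison_naturality]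
    exact hz
  obtain ⟨w, hw⟩ := ((hF i q hp (LinearMap.exact_subtype_ker_map p)).2 _).1 h1
  obtain ⟨v, rfl⟩ := hsurj K w
  rw [← comparison_naturality] at hw
  rw [← (comparison_bijective_pi F e he n).1 hw]
  exact (BTensor.map_exact (A' := A') (B := B) hp
    (LinearMap.exact_subtype_ker_map p)).apply_apply_eq_zero v

/-- A right exact additive functor is the tensor product with its value at the regular module. -/
def tensorIso [IsNoetherianRing A] (hF : IsRightExact F) : tensorFunctor A' A B ≅ F :=
  NatIso.ofComponents
    (fun X =>
      haveI := isIso_of_bijective (X := (tensorFunctor A' A B).obj X) (Y := F.obj X)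
        (mor (comparison F e he X)) (comparison_bijective F e he hF X)
      asIso (mor (X := (tensorFunctor A' A B).obj X) (Y := F.obj X) (comparison F e he X)))
    fun f => FGModuleCat.hom_ext (LinearMap.ext (comparison_naturality F e he f))

end Comparison

end RightExact

/-! ### Progenerators -/

section Progenerator

variable {A Λ Q : Type u} [Ring A] [Ring Λ] [AddCommGroup Q] [Module Λ Q] [Module Aᵐᵒᵖ Q]
  [SMulCommClass Λ Aᵐᵒᵖ Q]

/-- After `Q ⊗ A = Q`, the unit at the regular module is the map from `A` to endomorphisms of `Q`.
-/
theorem isGood_self (h : Function.Bijective (BTensor.rmul (A := A) Λ Q)) :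
    BTensor.IsGood Λ A Q A := by
  have h1 : ∀ a : A, ∀ q : Q, BTensor.rid Λ A Q (BTensor.tmul Λ A q a) = MulOpposite.op a • q :=
    fun a q => BTensor.rid_tmul q a
  constructor
  · intro a c hac
    refine MulOpposite.op_injective (h.1 (LinearMap.ext fun q => ?_))
    rw [BTensor.rmul_apply, BTensor.rmul_apply, ← h1, ← h1]
    exact congrArg _ (LinearMap.congr_fun hac q)
  · intro f
    obtain ⟨a, ha⟩ := h.2 ((BTensor.rid Λ A Q).toLinearMap ∘ₗ f)
    refine ⟨a.unop, LinearMap.ext fun q => (BTensor.rid Λ A Q).injective ?_⟩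
    exact (h1 _ _).trans (LinearMap.congr_fun ha q)

theorem isGood_pi (h : BTensor.IsGood Λ A Q A) (n : ℕ) : BTensor.IsGood Λ A Q (Fin n → A) := by
  induction n with
  | zero => exact BTensor.isGood_of_subsingleton
  | succ n ih => exact (h.prod ih).congr (Fin.consLinearEquiv A fun _ : Fin (n + 1) => A).symm

/-- Projectivity of `Q` makes `Hom(Q, Q ⊗ -)` right exact, so surjectivity of the unit extends from
free modules to all finite ones. Applied to the kernel of a presentation, it then gives injectivity.
-/
theorem isGood_of_finite [IsNoetherianRing A] [Module.Projective Λ Q]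
    (h : Function.Bijective (BTensor.rmul (A := A) Λ Q)) (X : Type u) [AddCommGroup X] [Module A X]
    [Module.Finite A X] : BTensor.IsGood Λ A Q X := by
  have hsurj : ∀ (X : Type u) [AddCommGroup X] [Module A X] [Module.Finite A X],
      Function.Surjective (BTensor.unit Λ A Q (X := X)) := by
    intro X _ _ _ f
    obtain ⟨n, p, hp⟩ := Module.Finite.exists_fin' A X
    obtain ⟨g, hg⟩ := Module.projective_lifting_property (BTensor.map Λ A Q p) f
      (BTensor.map_surjective hp)
    obtain ⟨y, rfl⟩ := (isGood_pi (isGood_self h) n).2 g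
    exact ⟨p y, hg⟩
  refine ⟨?_, hsurj X⟩
  rw [injective_iff_map_eq_zero]
  intro x hx
  obtain ⟨n, p, hp⟩ := Module.Finite.exists_fin' A X
  obtain ⟨y, rfl⟩ := hp x
  have hex := BTensor.map_exact (A' := Λ) (B := Q) hp (LinearMap.exact_subtype_ker_map p)
  obtain ⟨g, hg⟩ := Module.projective_lifting_property
    ((BTensor.map Λ A Q (LinearMap.ker p).subtype).rangeRestrict)
    ((BTensor.unit Λ A Q y).codRestrict _ fun q =>
      (hex _).1 (LinearMap.congr_fun hx q)) (LinearMap.surjective_rangeRestrict _)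
  obtain ⟨k, rfl⟩ := hsurj (LinearMap.ker p) g
  have h1 : y = k := (isGood_pi (isGood_self h) n).1 (LinearMap.ext fun q =>
    (congrArg Subtype.val (LinearMap.congr_fun hg q)).symm)
  rw [h1]
  exact k.2

theorem tensor_pi (n : ℕ) : Nonempty (BTensor Λ A Q (Fin n → A) ≃ₗ[Λ] (Fin n → Q)) := by
  induction n with
  | zero =>
    haveI : Subsingleton (BTensor Λ A Q (Fin 0 → A)) := BTensor.subsingleton
    exact ⟨0, 0, fun _ => Subsingleton.elim _ _, fun _ => Subsingleton.elim _ _⟩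
  | succ n ih =>
    obtain ⟨e⟩ := ih
    exact ⟨(BTensor.congr (Fin.consLinearEquiv A fun _ => A).symm).trans
      (BTensor.prodEquiv.trans (((BTensor.rid Λ A Q).prodCongr e).trans
        (Fin.consLinearEquiv Λ fun _ => Q)))⟩

/-- The surjection `r` maps `n` copies of `Q` onto `Λ`, so `k * n` copies map onto `k` copies of `Λ`
and thence onto `W`. -/
theorem exists_surjective_tensor {n : ℕ} (r : (Fin n → Q) →ₗ[Λ] Λ) (hr : Function.Surjective r)
    (W : Type u) [AddCommGroup W] [Module Λ W] [Module.Finite Λ W] :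
    ∃ (m : ℕ) (p : BTensor Λ A Q (Fin m → A) →ₗ[Λ] W), Function.Surjective p := by
  obtain ⟨k, f, hf⟩ := Module.Finite.exists_fin' Λ W
  obtain ⟨e⟩ := tensor_pi (A := A) (Λ := Λ) (Q := Q) (k * n)
  let g : (Fin (k * n) → Q) →ₗ[Λ] (Fin k → Λ) := LinearMap.pi fun i =>
    r ∘ₗ LinearMap.funLeft Λ Q fun j => finProdFinEquiv (i, j)
  have hg : Function.Surjective g := by
    intro y
    choose s hs using fun i => hr (y i)
    refine ⟨fun t => s (finProdFinEquiv.symm t).1 (finProdFinEquiv.symm t).2, funext fun i => ?_⟩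
    rw [← hs]
    refine congrArg r (funext fun j => ?_)
    change s (finProdFinEquiv.symm (finProdFinEquiv (i, j))).1
      (finProdFinEquiv.symm (finProdFinEquiv (i, j))).2 = s i j
    rw [finProdFinEquiv.symm_apply_apply]
  exact ⟨k * n, f ∘ₗ g ∘ₗ e.toLinearMap, hf.comp (hg.comp e.surjective)⟩

/-- The tensor product with a progenerator with opposite endomorphism ring `A` is an
equivalence. -/
theorem isEquivalence_tensorFunctor [IsNoetherianRing A] [IsNoetherianRing Λ]
    [Module.Projective Λ Q] [Module.Finite Λ Q]
    (h : Function.Bijective (BTensor.rmul (A := A) Λ Q))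
    {n : ℕ} (r : (Fin n → Q) →ₗ[Λ] Λ) (hr : Function.Surjective r) :
    (tensorFunctor Λ A Q).IsEquivalence where
  faithful := ⟨fun {X Y} f g hfg => FGModuleCat.hom_ext
    ((isGood_of_finite h Y).map_injective (congrArg lin hfg))⟩
  full := ⟨fun {X Y} φ => by
    obtain ⟨f, hf⟩ := (isGood_of_finite h Y).exists_map_eq (X := X) (lin φ)
    exact ⟨mor f, FGModuleCat.hom_ext hf⟩⟩
  -- `W` is presented by tensor products with free modules. Fullness lifts the presenting map to
  -- `f`, and right exactness identifies `W` with the image of the cokernel of `f`.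
  essSurj := ⟨fun W => by
    obtain ⟨m, p, hp⟩ := exists_surjective_tensor (A := A) r hr W
    haveI : Module.Finite Λ (BTensor Λ A Q (Fin m → A)) := BTensor.finite Λ A Q
    obtain ⟨k, q, hq⟩ := exists_surjective_tensor (A := A) r hr (LinearMap.ker p)
    obtain ⟨f, hf⟩ := (isGood_of_finite h (Fin m → A)).exists_map_eq
      ((LinearMap.ker p).subtype ∘ₗ q)
    let C := (Fin m → A) ⧸ LinearMap.range f
    have hex := BTensor.map_exact (A' := Λ) (B := Q) (LinearMap.range f).mkQ_surjective
      (LinearMap.exact_map_mkQ_range f)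
    have hker : LinearMap.ker (BTensor.map Λ A Q (LinearMap.range f).mkQ) = LinearMap.ker p := by
      ext z
      rw [LinearMap.mem_ker, hex z]
      constructor
      · rintro ⟨y, rfl⟩
        rw [hf]
        exact (q y).2
      · intro hz
        obtain ⟨y, hy⟩ := hq ⟨z, hz⟩
        refine ⟨y, ?_⟩
        rw [hf, LinearMap.comp_apply, hy]
        rfl
    let e : BTensor Λ A Q C ≃ₗ[Λ] W :=
      ((BTensor.map Λ A Q (LinearMap.range f).mkQ).quotKerEquivOfSurjective
        (BTensor.map_surjective (LinearMap.range f).mkQ_surjective)).symm.trans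
        ((Submodule.quotEquivOfEq _ _ hker).trans (p.quotKerEquivOfSurjective hp))
    haveI : Module.Finite Λ (BTensor Λ A Q C) := BTensor.finite Λ A Q
    exact ⟨FGModuleCat.of A C, ⟨e.toFGModuleCatIso⟩⟩⟩

end Progenerator

end HighestWeight

end

/-! ### The equivalence given by a progenerator with image the other bimodule. -/

noncomputable section

namespace HighestWeight

namespace Datum

section

variable {R A' : Type u} [CommRing R] [Ring A'] [Algebra R A'] {L : Type v}

/-- The functor of a datum between categories of finite modules. -/
abbrev functor (D : Datum R A' L) : FGModuleCat.{u} D.A ⥤ FGModuleCat.{u} A' :=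
  tensorFunctor A' D.A D.B

/-- The functor on endomorphisms. -/
def endHom (D : Datum R A' L) (Q : Type u) [AddCommGroup Q] [Module D.A Q] :
    Module.End D.A Q →+* Module.End A' (D.G Q) where
  toFun f := D.Gmap f
  map_one' := BTensor.map_id
  map_mul' f g := BTensor.map_comp f g
  map_zero' := BTensor.map_zero
  map_add' f g := BTensor.map_add f g

theorem endHom_bijective {D : Datum R A' L} {Q : Type u} [AddCommGroup Q] [Module D.A Q]
    (h : BTensor.IsGood A' D.A D.B Q) : Function.Bijective (D.endHom Q) :=
  ⟨h.map_injective, h.exists_map_eq⟩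

variable [LinearOrder L] [IsRegularLocalRing R] [Module.Finite R A'] {D₁ D₂ : Datum R A' L}

/-- The regular module is projective, hence good, and its unit becomes right multiplication on `B`
after the identification `B ⊗ A = B`. -/
theorem IsRS.rmul_bijective (h₁ : D₁.IsRS) : Function.Bijective (BTensor.rmul (A := D₁.A) A' D₁.B) := by
  have hgood := h₁.isGood_projective D₁.A
  have h1 : ∀ a : D₁.A, ∀ b : D₁.B, BTensor.rid A' D₁.A D₁.B (BTensor.tmul A' D₁.A b a) =
    MulOpposite.op a • b := fun a b => BTensor.rid_tmul b a
  constructor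
  · intro a c hac
    refine MulOpposite.unop_injective (hgood.1 (LinearMap.ext fun b =>
      (BTensor.rid A' D₁.A D₁.B).injective ?_))
    exact (h1 _ _).trans ((LinearMap.congr_fun hac b).trans (h1 _ _).symm)
  · intro f
    obtain ⟨a, ha⟩ := hgood.exists_eq ((BTensor.rid A' D₁.A D₁.B).symm.toLinearMap ∘ₗ f)
    refine ⟨MulOpposite.op a, LinearMap.ext fun b => ?_⟩
    rw [BTensor.rmul_apply, ← h1, ← ha]
    exact (BTensor.rid A' D₁.A D₁.B).apply_symm_apply _

/-- Choose `Q` with `G₂ Q ≅ B₁`. Then `End Q = End (G₂ Q) = End B₁ = A₁ᵒᵖ` makes `Q` a bimodule, and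
`Q` is a progenerator. The composite of `Q ⊗ -` with `G₂` is right exact with value `B₁` at the
regular module, hence isomorphic to `G₁`. -/
theorem IsRS.exists_equivalence [Finite L] (h₁ : D₁.IsRS) (h₂ : D₂.IsRS) (h₁₂ : Matches D₁ D₂)
    (h₂₁ : Matches D₂ D₁) : ∃ Φ : FGModuleCat.{u} D₁.A ≌ FGModuleCat.{u} D₂.A,
      Φ.functor.Additive ∧ Φ.functor.Linear R ∧ Nonempty (Φ.functor ⋙ D₂.functor ≅ D₁.functor) := by
  obtain ⟨Q, _, _, hQ, hQ', ⟨e⟩⟩ := h₁.isImage_B h₂ h₁₂ h₂₁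
  obtain ⟨n, i, r, hir⟩ := h₁.exists_retract h₂ h₁₂ h₂₁ Q e
  have hgood := h₂.isGood_projective Q
  haveI : IsNoetherianRing D₁.A := D₁.isNoetherianRing_A
  haveI : IsNoetherianRing D₂.A := D₂.isNoetherianRing_A
  let E : Module.End D₂.A Q ≃+* Module.End A' (D₂.G Q) :=
    RingEquiv.ofBijective (D₂.endHom Q) (endHom_bijective hgood)
  let ρ : D₁.Aᵐᵒᵖ →+* Module.End D₂.A Q :=
    (E.symm.toRingHom.comp e.symm.conjRingEquiv.toRingHom).comp (BTensor.rmul A' D₁.B)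
  have hρ : Function.Bijective ρ :=
    (E.symm.bijective.comp e.symm.conjRingEquiv.bijective).comp h₁.rmul_bijective
  have hρe : ∀ (a : D₁.Aᵐᵒᵖ) z, e (D₂.Gmap (ρ a) z) = a • e z := fun a z => by
    have h3 : E (ρ a) = e.symm.conjRingEquiv (BTensor.rmul A' D₁.B a) := E.apply_symm_apply _
    have h4 : D₂.Gmap (ρ a) z = e.symm (a • e z) := LinearMap.congr_fun h3 z
    rw [h4, e.apply_symm_apply]
  letI : Module D₁.Aᵐᵒᵖ Q := Module.compHom Q ρ
  have hsmul : ∀ (a : D₁.Aᵐᵒᵖ) (q : Q), a • q = ρ a q := fun _ _ => rfl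
  haveI : SMulCommClass D₂.A D₁.Aᵐᵒᵖ Q := ⟨fun c a q => ((ρ a).map_smul c q).symm⟩
  -- Needed for `R`-linearity of `Q ⊗ -`: the two actions of `R` on `Q` agree because they do on `G₂
  -- Q ≅ B₁` and the functor is faithful on endomorphisms of `Q`.
  have hR : ∀ (s : R) (q : Q), MulOpposite.op (algebraMap R D₁.A s) • q =
      algebraMap R D₂.A s • q := fun s q => by
    let t : Q →ₗ[D₂.A] Q :=
      { toFun := fun q => algebraMap R D₂.A s • q
        map_add' := smul_add _
        map_smul' := fun a q => by
          rw [smul_smul, RingHom.id_apply, smul_smul, Algebra.commutes] }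
    have h3 : ρ (MulOpposite.op (algebraMap R D₁.A s)) = t := by
      refine hgood.map_injective (BTensor.ext fun b q => e.injective ?_)
      have h4 := hρe (MulOpposite.op (algebraMap R D₁.A s)) (BTensor.tmul A' D₂.A b q)
      have h5 : ∀ (D : Datum R A' L) (b : D.B), MulOpposite.op (algebraMap R D.A s) • b =
          algebraMap R A' s • b := fun D b => by
        rw [algebraMap_smul, Algebra.algebraMap_eq_smul_one, MulOpposite.op_smul,
          MulOpposite.op_one, smul_assoc, one_smul]
      refine h4.trans ?_
      rw [h5, ← map_smul, BTensor.smul_tmul, ← h5, BTensor.op_smul_tmul]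
      rfl
    exact LinearMap.congr_fun h3 q
  have hrm : Function.Bijective (BTensor.rmul (A := D₁.A) D₂.A Q) := hρ
  haveI : (tensorFunctor D₂.A D₁.A Q).IsEquivalence := isEquivalence_tensorFunctor hrm r fun x => ⟨i x, hir x⟩
  let T := tensorFunctor D₂.A D₁.A Q
  have hex : IsRightExact (T ⋙ D₂.functor) :=
    (isRightExact_tensorFunctor D₁.A D₂.A Q).comp (isRightExact_tensorFunctor D₂.A A' D₂.B)
  let e' : D₁.B ≃ₗ[A'] (T ⋙ D₂.functor).obj (FGModuleCat.of D₁.A D₁.A) :=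
    e.symm.trans (BTensor.congr (BTensor.rid D₂.A D₁.A Q)).symm
  refine ⟨T.asEquivalence, inferInstanceAs T.Additive, ⟨fun {X Y} f s => ?_⟩,
    ⟨(tensorIso (T ⋙ D₂.functor) e' (fun a b => ?_) hex).symm⟩⟩
  · refine FGModuleCat.hom_ext (BTensor.ext fun q x => ?_)
    change BTensor.tmul D₂.A D₁.A q (algebraMap R D₁.A s • lin f x) =
      algebraMap R D₂.A s • BTensor.tmul D₂.A D₁.A q (lin f x)
    rw [← BTensor.op_smul_tmul, hR, BTensor.smul_tmul]
  -- The identification with `B₁` must respect the right action of `A₁`; both sides reduce to `ρ`,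
  -- which was defined by transport along `e`.
  · apply (BTensor.congr (A' := A') (B := D₂.B) (BTensor.rid D₂.A D₁.A Q)).injective
    change BTensor.congr (BTensor.rid D₂.A D₁.A Q) ((BTensor.congr (BTensor.rid D₂.A D₁.A Q)).symm
      (e.symm (MulOpposite.op a • b))) = BTensor.map A' D₂.A D₂.B (BTensor.rid D₂.A D₁.A Q).toLinearMap
        (BTensor.map A' D₂.A D₂.B (BTensor.map D₂.A D₁.A Q (LinearMap.toSpanSingleton D₁.A D₁.A a))
          ((BTensor.congr (BTensor.rid D₂.A D₁.A Q)).symm (e.symm b)))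
    have h6 : (BTensor.rid D₂.A D₁.A Q).toLinearMap ∘ₗ
        BTensor.map D₂.A D₁.A Q (LinearMap.toSpanSingleton D₁.A D₁.A a) =
        ρ (MulOpposite.op a) ∘ₗ (BTensor.rid D₂.A D₁.A Q).toLinearMap := BTensor.ext fun q c => by
      rw [LinearMap.comp_apply, LinearMap.comp_apply, BTensor.map_tmul]
      refine (BTensor.rid_tmul _ _).trans ?_
      refine Eq.trans ?_ (congrArg (ρ (MulOpposite.op a)) (BTensor.rid_tmul _ _).symm)
      rw [← hsmul, smul_smul, ← MulOpposite.op_mul]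
      rfl
    rw [LinearEquiv.apply_symm_apply, BTensor.map_map, h6, BTensor.map_comp]
    change _ = D₂.Gmap (ρ (MulOpposite.op a)) (BTensor.congr (BTensor.rid D₂.A D₁.A Q)
      ((BTensor.congr (BTensor.rid D₂.A D₁.A Q)).symm (e.symm b)))
    rw [LinearEquiv.apply_symm_apply]
    apply e.injective
    rw [hρe, LinearEquiv.apply_symm_apply, LinearEquiv.apply_symm_apply]

end

end Datum

end HighestWeight

end

noncomputable section

namespace HighestWeight

/-! ### Standardly filtered objects under equivalences -/

section Transport

variable {k : Type u} [CommRing k] {C : Type v} [Category.{w} C] [Preadditive C] [Linear k C]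
  {C' : Type v'} [Category.{w'} C'] [Preadditive C'] [Linear k C']

theorem IsTensorObj.congr {D D' X : C} {P : Type u} [AddCommGroup P] [Module k P]
    (h : IsTensorObj k D X P) (e : D' ≅ D) : IsTensorObj k D' X P := by
  obtain ⟨t, ht⟩ := h
  refine ⟨(Linear.leftComp k X e.hom).comp t, fun Y => ⟨fun f g hfg => (ht Y).1 ?_, fun φ => ?_⟩⟩
  · refine LinearMap.ext fun p => ?_
    have h1 : (e.hom ≫ t p) ≫ f = (e.hom ≫ t p) ≫ g := LinearMap.congr_fun hfg p
    rw [Category.assoc, Category.assoc, cancel_epi] at h1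
    exact h1
  · obtain ⟨f, hf⟩ := (ht Y).2 ((Linear.leftComp k Y e.inv).comp φ)
    refine ⟨f, LinearMap.ext fun p => ?_⟩
    have h1 : t p ≫ f = e.inv ≫ φ p := LinearMap.congr_fun hf p
    change (e.hom ≫ t p) ≫ f = φ p
    rw [Category.assoc, h1, Iso.hom_inv_id_assoc]

theorem IsTensorObj.map {D X : C} {P : Type u} [AddCommGroup P] [Module k P]
    (h : IsTensorObj k D X P) (F : C ⥤ C') [F.Additive] [F.Linear k] [F.IsEquivalence] :
    IsTensorObj k (F.obj D) (F.obj X) P := by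
  obtain ⟨t, ht⟩ := h
  refine ⟨(F.mapLinearMap k).comp t, fun Y => ⟨fun f g hfg => ?_, fun φ => ?_⟩⟩
  · let e := F.objObjPreimageIso Y
    obtain ⟨f', hf'⟩ := F.map_surjective (f ≫ e.inv)
    obtain ⟨g', hg'⟩ := F.map_surjective (g ≫ e.inv)
    rw [← cancel_mono e.inv, ← hf', ← hg']
    congr 1
    refine (ht _).1 (LinearMap.ext fun p => F.map_injective ?_)
    have h1 : F.map (t p) ≫ f = F.map (t p) ≫ g := LinearMap.congr_fun hfg p
    change F.map (t p ≫ f') = F.map (t p ≫ g')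
    rw [F.map_comp, F.map_comp, hf', hg', ← Category.assoc, h1, Category.assoc]
  · let e := F.objObjPreimageIso Y
    let ψ : P →ₗ[k] (D ⟶ F.objPreimage Y) :=
      { toFun := fun p => F.preimage (φ p ≫ e.inv)
        map_add' := fun p q => F.map_injective (by simp)
        map_smul' := fun r p => F.map_injective (by simp) }
    obtain ⟨f, hf⟩ := (ht _).2 ψ
    refine ⟨F.map f ≫ e.hom, LinearMap.ext fun p => ?_⟩
    have h1 : t p ≫ f = F.preimage (φ p ≫ e.inv) := LinearMap.congr_fun hf p
    change F.map (t p) ≫ F.map f ≫ e.hom = φ p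
    rw [← Category.assoc, ← F.map_comp, h1, F.map_preimage, Category.assoc, e.inv_hom_id,
      Category.comp_id]

theorem StdFiltered.map {T : Type*} {Δ : T → C} {Δ' : T → C'} {S : Set T} {X : C}
    (h : StdFiltered k Δ S X) (F : C ⥤ C') [F.Additive] [F.Linear k] [F.IsEquivalence]
    (e : ∀ τ, Nonempty (F.obj (Δ τ) ≅ Δ' τ)) : StdFiltered k Δ' S (F.obj X) := by
  induction h with
  | zero X hX => exact .zero _ (F.map_isZero hX)
  | ext E hE h₁ τ hτ P h₃ ih =>
    exact .ext (E.map F) (hE.map_of_exact F) ih τ hτ P ((h₃.map F).congr (e τ).some.symm)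

theorem isTensorObj_self (D : C) : IsTensorObj k D D k := by
  refine ⟨LinearMap.toSpanSingleton k _ (𝟙 D), fun Y => ⟨fun f g hfg => ?_, fun φ => ⟨φ 1, ?_⟩⟩⟩
  · have h1 : ((1 : k) • 𝟙 D) ≫ f = ((1 : k) • 𝟙 D) ≫ g := LinearMap.congr_fun hfg 1
    rwa [one_smul, Category.id_comp, Category.id_comp] at h1
  · refine LinearMap.ext_ring ?_
    change ((1 : k) • 𝟙 D) ≫ φ 1 = φ 1
    rw [one_smul, Category.id_comp]

end Transport

/-! ### Standardly filtered modules -/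

section Modules

variable {k Λ : Type u} [CommRing k] [Ring Λ] [Algebra k Λ]

theorem injective_of_mono {X Y : FGModuleCat.{u} Λ} (f : X ⟶ Y) [Mono f] :
    Function.Injective (lin f) := by
  rw [injective_iff_map_eq_zero]
  intro x hx
  have h1 : point x = 0 := by
    rw [← cancel_mono f, point_comp, hx, zero_comp]
    exact FGModuleCat.hom_ext (LinearMap.ext fun a => smul_zero a)
  have h2 : lin (point x) (1 : Λ) = 0 := LinearMap.congr_fun (congrArg lin h1) (1 : Λ)
  exact (one_smul Λ x).symm.trans h2

theorem mono_of_injective {X Y : FGModuleCat.{u} Λ} (f : X ⟶ Y)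
    (hf : Function.Injective (lin f)) : Mono f :=
  ⟨fun {_} g h e => FGModuleCat.hom_ext (LinearMap.ext fun x =>
    hf (LinearMap.congr_fun (congrArg lin e) x))⟩

theorem shortExact_iff [IsNoetherianRing Λ] (S : ShortComplex (FGModuleCat.{u} Λ)) :
    S.ShortExact ↔ Function.Injective (lin S.f) ∧ Function.Surjective (lin S.g) ∧
      Function.Exact (lin S.f) (lin S.g) := by
  constructor
  · intro h
    haveI := h.mono_f
    haveI := h.epi_g
    exact ⟨injective_of_mono S.f, exact_of_isColimit S.f S.g S.zero h.gIsCokernel⟩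
  · rintro ⟨h1, h2, h3⟩
    exact ShortComplex.ShortExact.mk'
      (ShortComplex.exact_of_g_is_cokernel S (isColimitOfExact S.f S.g h2 h3 S.zero))
      (mono_of_injective S.f h1) (epi_of_surjective S.g h2)

theorem isZero_iff_subsingleton (X : FGModuleCat.{u} Λ) : IsZero X ↔ Subsingleton X := by
  rw [IsZero.iff_id_eq_zero]
  constructor
  · intro h
    exact ⟨fun x y => (LinearMap.congr_fun (congrArg lin h) x).trans
      (LinearMap.congr_fun (congrArg lin h) y).symm⟩
  · intro h
    exact FGModuleCat.hom_ext (LinearMap.ext fun x => Subsingleton.elim _ _)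

theorem FiltBy.pi {L : Type v} {Δ : L → Type u} [∀ i, AddCommGroup (Δ i)] [∀ i, Module Λ (Δ i)]
    (i : L) (n : ℕ) : FiltBy Λ Δ (List.replicate n i) (Fin n → Δ i) := by
  induction n with
  | zero => exact (inferInstance : Subsingleton (Fin 0 → Δ i))
  | succ n ih =>
    rw [List.replicate_succ']
    exact (FiltBy.prod (FiltBy.singleton i) ih).congr
      (Fin.consLinearEquiv Λ fun _ : Fin (n + 1) => Δ i)

/-- The universal property turns coordinate functionals into projections `r i`, with inclusions `t
(b i)`. That the projections and inclusions sum to the identity follows from its uniqueness part. -/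
theorem IsTensorObj.exists_equiv {D X : FGModuleCat.{u} Λ} {P : Type u} [AddCommGroup P]
    [Module k P] {n : ℕ} (b : Module.Basis (Fin n) k P) (h : IsTensorObj k D X P) :
    Nonempty ((Fin n → D) ≃ₗ[Λ] X) := by
  obtain ⟨t, ht⟩ := h
  have h1 : ∀ i, ∃ r : X ⟶ D, ∀ p, t p ≫ r = b.coord i p • 𝟙 D := fun i => by
    obtain ⟨r, hr⟩ := (ht D).2 ((LinearMap.toSpanSingleton k _ (𝟙 D)).comp (b.coord i))
    exact ⟨r, fun p => LinearMap.congr_fun hr p⟩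
  choose r hr using h1
  have h2 : ∑ i, r i ≫ t (b i) = 𝟙 X := by
    refine (ht X).1 (LinearMap.ext fun p => ?_)
    change t p ≫ ∑ i, r i ≫ t (b i) = t p ≫ 𝟙 X
    rw [Preadditive.comp_sum, Category.comp_id]
    conv_rhs => rw [← b.sum_repr p, map_sum]
    refine Finset.sum_congr rfl fun i _ => ?_
    rw [← Category.assoc, hr, Linear.smul_comp, Category.id_comp, map_smul]
    rfl
  have h2' : ∀ x : X, ∑ i, lin (t (b i)) (lin (r i) x) = x := fun x => by
    have h3 := LinearMap.congr_fun (congrArg lin h2) x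
    have h4 : lin (∑ i, r i ≫ t (b i)) = ∑ i, lin (t (b i)) ∘ₗ lin (r i) := by
      let L : (X ⟶ X) →+ (X →ₗ[Λ] X) := ⟨⟨lin, rfl⟩, fun _ _ => rfl⟩
      exact map_sum L _ _
    rw [h4, LinearMap.sum_apply] at h3
    exact h3
  have h5 : ∀ i j (d : D), lin (r j) (lin (t (b i)) d) = if i = j then d else 0 := fun i j d => by
    have h6 := LinearMap.congr_fun (congrArg lin (hr j (b i))) d
    refine h6.trans ?_
    rw [b.coord_apply, b.repr_self, Finsupp.single_apply]
    split_ifs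
    · rw [one_smul]; rfl
    · rw [zero_smul]; rfl
  exact ⟨
    { toFun := fun y => ∑ i, lin (t (b i)) (y i)
      map_add' := fun y z => by simp [Finset.sum_add_distrib]
      map_smul' := fun a y => by simp [Finset.smul_sum]
      invFun := fun x i => lin (r i) x
      left_inv := fun y => funext fun j => by
        change lin (r j) (∑ i, lin (t (b i)) (y i)) = y j
        rw [map_sum]
        simp [h5]
      right_inv := h2' }⟩

variable {T : Type*} {L : Type v} {Δ : T → FGModuleCat.{u} Λ}

/-- Over a local ring the multiplicity modules `P` are free, so each factor splits into copies of
one standard module. -/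
theorem StdFiltered.exists_filtBy [IsLocalRing k] [IsNoetherianRing Λ] {S : Set T}
    {X : FGModuleCat.{u} Λ} (h : StdFiltered k Δ S X) (e : L ≃ T) :
    ∃ l : List L, (∀ i ∈ l, e i ∈ S) ∧ FiltBy Λ (fun i => Δ (e i)) l X := by
  induction h with
  | zero X hX => exact ⟨[], by simp, (isZero_iff_subsingleton X).1 hX⟩
  | ext E hE h₁ τ hτ P h₃ ih =>
    obtain ⟨l, hl, hX⟩ := ih
    obtain ⟨i, rfl⟩ := e.surjective τ
    haveI : Module.Free k P := Module.free_of_flat_of_isLocalRing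
    obtain ⟨u⟩ := h₃.exists_equiv (Module.finBasis k P)
    obtain ⟨hf, hg, hfg⟩ := (shortExact_iff E).1 hE
    refine ⟨_, fun j hj => ?_, FiltBy.append (lin E.f) (lin E.g) hf hg hfg hX
      ((FiltBy.pi (Δ := fun i => Δ (e i)) i _).congr u)⟩
    rcases List.mem_append.1 hj with hj | hj
    · rwa [List.eq_of_mem_replicate hj]
    · exact hl j hj

theorem FiltBy.stdFiltered [IsNoetherianRing Λ] {S : Set T} (e : L → T) {l : List L}
    (hl : ∀ i ∈ l, e i ∈ S) : ∀ {X : FGModuleCat.{u} Λ}, FiltBy Λ (fun i => Δ (e i)) l X →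
      StdFiltered k Δ S X := by
  induction l with
  | nil => intro X h; exact .zero X ((isZero_iff_subsingleton X).2 h)
  | cons i l ih =>
    rintro X ⟨g, hg, h⟩
    let K : FGModuleCat.{u} Λ := FGModuleCat.of Λ (LinearMap.ker g)
    let E : ShortComplex (FGModuleCat.{u} Λ) := ShortComplex.mk (X₁ := K) (X₂ := X)
      (X₃ := Δ (e i)) (mor (LinearMap.ker g).subtype) (mor g)
      (FGModuleCat.hom_ext (LinearMap.ext fun x => x.2))
    refine .ext E ((shortExact_iff E).2 ⟨Subtype.val_injective, hg,
      LinearMap.exact_subtype_ker_map g⟩)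
      (ih (X := K) (fun j hj => hl j (List.mem_cons_of_mem _ hj)) h) (e i)
      (hl i List.mem_cons_self) k (isTensorObj_self _)

end Modules

end HighestWeight

end

noncomputable section

namespace HighestWeight

/-! ### The module-theoretic datum of a highest weight category with a functor -/

section OverR

variable {R : Type u} [CommRing R] {C : Type v} [Category.{w} C] [Preadditive C] [Linear R C]
  (M : ModuleModel R C)

theorem isProjective_self (A : Type u) [Ring A] : Projective (FGModuleCat.of A A) where
  factors {E X} f e _ := by
    obtain ⟨x, hx⟩ := surjective_of_epi e (lin f (1 : A))
    refine ⟨point x, ?_⟩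
    rw [point_comp, hx]
    exact FGModuleCat.hom_ext (LinearMap.ext_ring (one_smul A _))

/-- The object corresponding to the regular module. -/
def ModuleModel.regular : C := M.equiv.inverse.obj (FGModuleCat.of M.alg M.alg)

theorem ModuleModel.projective_regular : Projective M.regular := by
  rw [ModuleModel.regular]
  exact (M.equiv.symm.map_projective_iff _).2 (isProjective_self M.alg)

/-- The regular module corresponds to itself. -/
def ModuleModel.regularIso : FGModuleCat.of M.alg M.alg ≅ M.equiv.functor.obj M.regular :=
  (M.equiv.counitIso.app _).symm

theorem point_injective {A : Type u} [Ring A] {X : FGModuleCat.{u} A} {x y : X}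
    (h : point x = point y) : x = y := by
  have h2 := LinearMap.congr_fun (congrArg lin h) (1 : A)
  exact (one_smul A x).symm.trans (h2.trans (one_smul A y))

theorem point_one (A : Type u) [Ring A] :
    point (X := FGModuleCat.of A A) (1 : A) = 𝟙 (FGModuleCat.of A A) := rightMul_one A

/-- Homomorphisms from the regular module are elements. -/
def ModuleModel.pointEquiv (X : C) : (M.regular ⟶ X) ≃ₗ[R] M.equiv.functor.obj X :=
  LinearEquiv.ofBijective
    { toFun := fun f => lin (M.regularIso.hom ≫ M.equiv.functor.map f) (1 : M.alg)
      map_add' := fun f g => by rw [Functor.map_add]; rfl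
      map_smul' := fun r f => by rw [Functor.map_smul]; rfl } <| by
    have hc : ∀ f : M.regular ⟶ X, point (lin (M.regularIso.hom ≫ M.equiv.functor.map f)
        (1 : M.alg)) = M.regularIso.hom ≫ M.equiv.functor.map f := fun f => by
      rw [← point_comp, point_one, Category.id_comp]
    constructor
    · intro f g hfg
      refine M.equiv.functor.map_injective ?_
      rw [← cancel_epi M.regularIso.hom]
      exact (hc f).symm.trans ((congrArg point hfg).trans (hc g))
    · intro x
      obtain ⟨f, hf⟩ := M.equiv.functor.map_surjective (M.regularIso.inv ≫ point x)
      refine ⟨f, point_injective ((hc f).trans ?_)⟩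
      rw [hf, Iso.hom_inv_id_assoc]

variable {M} [IsNoetherianRing R] [IsLocalRing R]

/-- Homomorphisms from the regular object recover the underlying module, and a finite flat module
over a Noetherian local ring is free. -/
theorem FlatOver.free {X : C} (h : FlatOver R X) : Module.Free R (M.equiv.functor.obj X) :=
  haveI := h M.regular M.projective_regular
  haveI : Module.Flat R (M.equiv.functor.obj X) := Module.Flat.of_linearEquiv (M.pointEquiv X).symm
  Module.free_of_flat_of_isLocalRing

theorem ProjectiveOver.free {X : C} (h : ProjectiveOver R X) :
    Module.Free R (M.equiv.functor.obj X) :=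
  haveI := h M.regular M.projective_regular
  haveI : Module.Flat R (M.equiv.functor.obj X) := Module.Flat.of_linearEquiv (M.pointEquiv X).symm
  Module.free_of_flat_of_isLocalRing

end OverR

section Datum

variable {R : Type u} [CommRing R] [IsRegularLocalRing R]
  {T : Type*} [PartialOrder T] {C : Type v} [Category.{w} C] [Abelian C] [Linear R C]
  {C' : Type v'} [Category.{w'} C'] [Abelian C'] [Linear R C']
  (M : ModuleModel R C) (N : ModuleModel R C') (Δ : T → C) (hC : IsHighestWeight R Δ)
  (π : C ⥤ C') [π.Additive] [π.Linear R] {L : Type t₁} (e : L ≃ T)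

/-- The datum of a highest weight category with a functor, the standard objects being relabelled
by `e`. -/
abbrev datum : Datum R N.alg L :=
  haveI : ∀ i, Module.Free R (M.equiv.functor.obj (Δ (e i))) := fun i => (hC.flat (e i)).free
  { A := M.alg
    B := bimodule M N π
    Δ := fun i => M.equiv.functor.obj (Δ (e i)) }

instance : IsNoetherianRing M.alg := IsNoetherianRing.of_finite R M.alg

/-- The functor of the datum is the given functor. -/
def datumIso [PreservesFiniteColimits π] :
    (datum M N Δ hC π e).functor ≅ modelFunctor M N π :=
  tensorIso (A := M.alg) (A' := N.alg) (B := bimodule M N π) (modelFunctor M N π)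
    (LinearEquiv.refl _ _) (fun _ _ => rfl)
    (isRightExact_of_preserves _)

end Datum

end HighestWeight

end

noncomputable section

namespace HighestWeight

/-! ### Translation of the hypotheses -/

section Translation

theorem module_projective {A : Type u} [Ring A] (X : FGModuleCat.{u} A) [Projective X] :
    Module.Projective A X := by
  obtain ⟨n, p, hp⟩ := Module.Finite.exists_fin' A X
  let Y : FGModuleCat.{u} A := FGModuleCat.of A (Fin n → A)
  let q : Y ⟶ X := mor p
  haveI : Epi q := epi_of_surjective q hp
  exact Module.Projective.of_split (lin (Projective.factorThru (𝟙 X) q)) p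
    (congrArg lin (Projective.factorThru_comp (𝟙 X) q))

/-- The linear equivalence underlying an isomorphism. -/
def linEquiv {A : Type u} [Ring A] {X Y : FGModuleCat.{u} A} (i : X ≅ Y) : X ≃ₗ[A] Y :=
  LinearEquiv.ofLinear (lin i.hom) (lin i.inv) (congrArg lin i.inv_hom_id)
    (congrArg lin i.hom_inv_id)

variable {R : Type u} [CommRing R] [IsRegularLocalRing R]
  {T : Type*} [PartialOrder T] {C : Type v} [Category.{w} C] [Abelian C] [Linear R C]
  {C' : Type v'} [Category.{w'} C'] [Abelian C'] [Linear R C']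
  (M : ModuleModel R C) (N : ModuleModel R C') (Δ : T → C) (hC : IsHighestWeight R Δ)
  (π : C ⥤ C') [π.Additive] [π.Linear R] [PreservesFiniteColimits π] {L : Type t₁} (e : L ≃ T)

instance (R' : Type u) [CommRing R'] [Algebra R R'] [IsNoetherianRing R'] :
    IsNoetherianRing (R' ⊗[R] M.alg) :=
  IsNoetherianRing.of_finite R' _

/-- The value of the functor of the datum. -/
def datumEquiv (X : C) : (datum M N Δ hC π e).G (M.equiv.functor.obj X) ≃ₗ[N.alg]
    N.equiv.functor.obj (π.obj X) :=
  linEquiv ((datumIso M N Δ hC π e).app (M.equiv.functor.obj X) ≪≫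
    (π ⋙ N.equiv.functor).mapIso (M.equiv.unitIso.app X).symm)

/-- Exactness of the functor on standardly filtered objects, carried through the module model: the
kernel, the module and the top factor are all filtered. -/
theorem datum_exact (hC : IsHighestWeight R Δ) (hπ : IsRouquierSoergel M N π Δ) (i : L) (l : List L)
    (X : FGModuleCat.{u} M.alg) (g : X →ₗ[M.alg] M.equiv.functor.obj (Δ (e i)))
    (hg : Function.Surjective g)
    (hl : FiltBy M.alg (fun i => M.equiv.functor.obj (Δ (e i))) l (LinearMap.ker g)) :
    Function.Injective (BTensor.map N.alg M.alg (bimodule M N π) (LinearMap.ker g).subtype) := by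
  let K : FGModuleCat.{u} M.alg := FGModuleCat.of M.alg (LinearMap.ker g)
  let E : ShortComplex (FGModuleCat.{u} M.alg) := ShortComplex.mk (X₁ := K) (X₂ := X)
    (X₃ := M.equiv.functor.obj (Δ (e i))) (mor (LinearMap.ker g).subtype) (mor g)
    (FGModuleCat.hom_ext (LinearMap.ext fun x => x.2))
  have hE : E.ShortExact := (shortExact_iff E).2 ⟨Subtype.val_injective, hg,
      LinearMap.exact_subtype_ker_map g⟩
  have hfilt : ∀ (Y : FGModuleCat.{u} M.alg) (l : List L),
      FiltBy M.alg (fun i => M.equiv.functor.obj (Δ (e i))) l Y →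
      StdFiltered R Δ Set.univ (M.equiv.inverse.obj Y) := fun Y l h =>
    (FiltBy.stdFiltered (k := R) (Δ := fun τ => M.equiv.functor.obj (Δ τ)) (S := Set.univ) e
      (fun _ _ => trivial) h).map M.equiv.inverse fun τ => ⟨(M.equiv.unitIso.app (Δ τ)).symm⟩
  have h1 := hπ.exact (E.map M.equiv.inverse) (hE.map_of_exact _) (hfilt K l hl)
    (hfilt X (i :: l) ⟨g, hg, hl⟩)
    (hfilt _ [i] (FiltBy.singleton (Δ := fun i => M.equiv.functor.obj (Δ (e i))) i))
  haveI : Mono ((modelFunctor M N π).map E.f) := (h1.map_of_exact N.equiv.functor).mono_f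
  haveI : Mono ((datum M N Δ hC π e).functor.map E.f) := by
    have h3 := (datumIso M N Δ hC π e).hom.naturality E.f
    haveI : Mono ((datum M N Δ hC π e).functor.map E.f ≫ (datumIso M N Δ hC π e).hom.app X) := by
      rw [h3]
      exact mono_comp _ _
    exact mono_of_mono _ ((datumIso M N Δ hC π e).hom.app X)
  exact injective_of_mono ((datum M N Δ hC π e).functor.map E.f)

theorem datum_cover (hC : IsHighestWeight R Δ) (i : L) : ∃ (P : Type u) (_ : AddCommGroup P) (_ : Module M.alg P)
    (p : P →ₗ[M.alg] M.equiv.functor.obj (Δ (e i))),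
    Module.Projective M.alg P ∧ Module.Finite M.alg P ∧ Function.Surjective p ∧
      ∃ l : List L, (∀ j ∈ l, e i < e j) ∧
        FiltBy M.alg (fun i => M.equiv.functor.obj (Δ (e i))) l (LinearMap.ker p) := by
  obtain ⟨E, hE, hP, ⟨c⟩, hf⟩ := hC.exists_proj (e i)
  let S : ShortComplex C := ShortComplex.mk E.f (E.g ≫ c.hom) (by simp)
  have hS : S.ShortExact := ShortComplex.shortExact_of_iso
    (ShortComplex.isoMk (S₁ := E) (Iso.refl _) (Iso.refl _) c (by simp [S]) (by simp [S])) hE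
  obtain ⟨h1, h2, h3⟩ := (shortExact_iff (S.map M.equiv.functor)).1 (hS.map_of_exact _)
  haveI : Projective (M.equiv.functor.obj E.X₂) := (M.equiv.map_projective_iff _).2 hP
  obtain ⟨l, hl, hl'⟩ := (hf.map (Δ' := fun τ => M.equiv.functor.obj (Δ τ)) M.equiv.functor
    fun τ => ⟨Iso.refl _⟩).exists_filtBy e
  refine ⟨M.equiv.functor.obj E.X₂, inferInstance, inferInstance,
    lin (M.equiv.functor.map (E.g ≫ c.hom)), module_projective _, inferInstance, h2, l, hl,
    hl'.congr ((LinearEquiv.ofInjective _ h1).trans (LinearEquiv.ofEq _ _ ?_))⟩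
  exact (LinearMap.exact_iff.1 h3).symm

/-- The hypothesis `he` says that the linear order on labels refines the partial order, so the
directions of homomorphisms and of the kernels of projective covers remain valid for it. -/
theorem isRS_datum [LinearOrder L] (he : ∀ i j, e i ≤ e j → i ≤ j)
    (hπ : IsRouquierSoergel M N π Δ) : (datum M N Δ hC π e).IsRS where
  nontrivial i := by
    by_contra h
    have h0 : Subsingleton (M.equiv.functor.obj (Δ (e i))) := not_nontrivial_iff_subsingleton.1 h
    have h1 : 𝟙 (Δ (e i)) = 0 := M.equiv.functor.map_injective
      (FGModuleCat.hom_ext (LinearMap.ext fun x => Subsingleton.elim _ _))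
    exact one_ne_zero ((hC.end_eq (e i)).1 (a₁ := (1 : R)) (a₂ := 0) (by simp [h1]))
  hom_le i j f hf := by
    obtain ⟨g, hg⟩ := M.equiv.functor.map_surjective (X := Δ (e i)) (Y := Δ (e j)) (mor f)
    refine he i j (hC.le_of_hom _ _ g fun h => hf ?_)
    rw [h, Functor.map_zero] at hg
    exact (congrArg lin hg).symm
  end_eq i f := by
    obtain ⟨g, hg⟩ := M.equiv.functor.map_surjective (X := Δ (e i)) (Y := Δ (e i)) (mor f)
    obtain ⟨r, rfl⟩ := (hC.end_eq (e i)).2 g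
    refine ⟨r, fun x => ?_⟩
    have h1 : r • 𝟙 (M.equiv.functor.obj (Δ (e i))) = mor f := by
      rw [← hg, Functor.map_smul, CategoryTheory.Functor.map_id]
    exact (LinearMap.congr_fun (congrArg lin h1) x).symm
  cover i := by
    obtain ⟨P, _, _, p, h1, h2, h3, l, hl, h4⟩ := datum_cover M Δ e hC i
    exact ⟨P, _, _, p, h1, h2, h3, l,
      fun j hj => lt_of_le_of_ne (he i j (hl j hj).le) fun h => (hl j hj).ne (congrArg e h), h4⟩
  gen X _ _ _ _ := by
    let Y : FGModuleCat.{u} M.alg := FGModuleCat.of M.alg X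
    obtain ⟨τ, f, hf⟩ := hC.exists_hom (M.equiv.inverse.obj Y) fun h => by
      have h1 : Subsingleton Y := (isZero_iff_subsingleton Y).1
        ((M.equiv.functor.map_isZero h).of_iso (M.equiv.counitIso.app Y).symm)
      exact not_subsingleton X h1
    obtain ⟨i, rfl⟩ := e.surjective τ
    refine ⟨i, lin (M.equiv.functor.map f ≫ M.equiv.counit.app Y), fun h => hf ?_⟩
    have h1 : M.equiv.functor.map f ≫ M.equiv.counit.app Y = 0 := FGModuleCat.hom_ext h
    refine M.equiv.functor.map_injective ?_
    rw [Functor.map_zero, ← cancel_mono (M.equiv.counit.app Y), h1, zero_comp]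
  freeG i :=
    haveI := (hπ.projective (e i)).free (M := N)
    Module.Free.of_equiv ((datumEquiv M N Δ hC π e (Δ (e i))).restrictScalars R).symm
  exact i l X _ _ g hg hl := by
    haveI : Module.Finite M.alg X :=
      FiltBy.finite (Δ := fun i => M.equiv.functor.obj (Δ (e i))) (l := i :: l) ⟨g, hg, hl⟩
    exact datum_exact M N Δ π e hC hπ i l (FGModuleCat.of M.alg X) g hg hl
  full X Y _ _ _ _ _ _ φ := by
    haveI := hπ.generic.2.2
    obtain ⟨f, hf⟩ := (baseChangeFunctor M N π (FractionRing R)).map_surjective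
      (X := FGModuleCat.of (FractionRing R ⊗[R] M.alg) X)
      (Y := FGModuleCat.of (FractionRing R ⊗[R] M.alg) Y) (mor φ)
    exact ⟨lin f, congrArg lin hf⟩
  essSurj W _ _ _ := by
    haveI := hπ.generic.2.2
    let W' : N.Cat (FractionRing R) := FGModuleCat.of (FractionRing R ⊗[R] N.alg) W
    let F := baseChangeFunctor M N π (FractionRing R)
    exact ⟨F.objPreimage W', inferInstance, inferInstance, inferInstance,
      ⟨linEquiv (F.objObjPreimageIso W')⟩⟩
  subsingleton X _ _ _ h := by
    haveI := hπ.generic.2.2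
    let F := baseChangeFunctor M N π (FractionRing R)
    let X' : M.Cat (FractionRing R) := FGModuleCat.of (FractionRing R ⊗[R] M.alg) X
    haveI : Subsingleton (F.obj X') := h
    have h1 : 𝟙 X' = 0 := F.map_injective
      (FGModuleCat.hom_ext (LinearMap.ext fun x => Subsingleton.elim _ _))
    exact (isZero_iff_subsingleton X').1 ((IsZero.iff_id_eq_zero _).2 h1)
  faithful q _ hq X Y _ _ _ _ l l' hX hY f hf := by
    let A := q.ResidueField ⊗[R] M.alg
    haveI hfin : ∀ i, Module.Finite A (BC R q.ResidueField (M.equiv.functor.obj (Δ (e i)))) :=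
      fun i => BC.finite R q.ResidueField M.alg (M.equiv.functor.obj (Δ (e i)))
    haveI : Module.Finite A X := hX.finite
    haveI : Module.Finite A Y := hY.finite
    have h1 := hπ.faithful q hq (FGModuleCat.of A X) (FGModuleCat.of A Y)
      (FiltBy.stdFiltered (Δ := fun τ => M.obj q.ResidueField (Δ τ)) (S := Set.univ) e (fun _ _ => trivial) hX)
      (FiltBy.stdFiltered (Δ := fun τ => M.obj q.ResidueField (Δ τ)) (S := Set.univ) e (fun _ _ => trivial) hY)
    have h2 : (mor f : FGModuleCat.of A X ⟶ FGModuleCat.of A Y) = 0 :=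
      h1 (FGModuleCat.hom_ext (hf.trans BTensor.map_zero.symm))
    exact congrArg lin h2

end Translation

section Comparison

variable {R : Type u} [CommRing R] [IsRegularLocalRing R]
  {T₁ : Type*} [PartialOrder T₁] {C₁ : Type v₁} [Category.{w₁} C₁] [Abelian C₁] [Linear R C₁]
  {T₂ : Type*} [PartialOrder T₂] {C₂ : Type v₂} [Category.{w₂} C₂] [Abelian C₂] [Linear R C₂]
  {D : Type v₃} [Category.{w₃} D] [Abelian D] [Linear R D]
  {M₁ : ModuleModel R C₁} {M₂ : ModuleModel R C₂} {N : ModuleModel R D}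
  {Δ₁ : T₁ → C₁} {Δ₂ : T₂ → C₂} (hC₁ : IsHighestWeight R Δ₁) (hC₂ : IsHighestWeight R Δ₂)
  (π₁ : C₁ ⥤ D) [π₁.Additive] [π₁.Linear R] [PreservesFiniteColimits π₁]
  (π₂ : C₂ ⥤ D) [π₂.Additive] [π₂.Linear R] [PreservesFiniteColimits π₂]

/-- Both families must be labelled by the same `L`. The filtration over the localization is
recovered from the categorical one because that ring is local. -/
theorem matches_datum {L : Type t₁} (e₁ : L ≃ T₁) (e₂ : L ≃ T₂)
    (ha : ∀ i, Nonempty (π₁.obj (Δ₁ (e₁ i)) ≅ π₂.obj (Δ₂ (e₂ i))))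
    (hb : ∀ (p : Ideal R) [p.IsPrime], p.height = 1 →
      stdImage M₁ N π₁ Δ₁ (Localization.AtPrime p) =
        stdImage M₂ N π₂ Δ₂ (Localization.AtPrime p)) :
    Datum.Matches (datum M₁ N Δ₁ hC₁ π₁ e₁) (datum M₂ N Δ₂ hC₂ π₂ e₂) where
  standard i := ⟨(datumEquiv M₁ N Δ₁ hC₁ π₁ e₁ _).trans
    ((linEquiv (N.equiv.functor.mapIso (ha i).some)).trans
      (datumEquiv M₂ N Δ₂ hC₂ π₂ e₂ _).symm)⟩
  heightOne p _ hp l X _ _ hX := by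
    let A := Localization.AtPrime p ⊗[R] M₁.alg
    haveI hfin : ∀ i, Module.Finite A
        (BC R (Localization.AtPrime p) (M₁.equiv.functor.obj (Δ₁ (e₁ i)))) :=
      fun i => BC.finite R (Localization.AtPrime p) M₁.alg (M₁.equiv.functor.obj (Δ₁ (e₁ i)))
    haveI : Module.Finite A X := hX.finite
    have h1 : stdImage M₁ N π₁ Δ₁ (Localization.AtPrime p)
        ((baseChangeFunctor M₁ N π₁ (Localization.AtPrime p)).obj (FGModuleCat.of A X)) :=
      ⟨FGModuleCat.of A X,
        FiltBy.stdFiltered (Δ := fun τ => M₁.obj (Localization.AtPrime p) (Δ₁ τ)) (S := Set.univ) e₁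
          (fun _ _ => trivial) hX, ⟨Iso.refl _⟩⟩
    rw [hb p hp] at h1
    obtain ⟨Z, hZ, ⟨c⟩⟩ := h1
    obtain ⟨l', -, hl'⟩ := StdFiltered.exists_filtBy hZ e₂
    exact ⟨l', Z, inferInstance, inferInstance, hl', ⟨(linEquiv c).symm⟩⟩

end Comparison

end HighestWeight

end

noncomputable section

namespace HighestWeight

/-! ### Objects on which a functor is fully faithful -/

section Good

variable {C₁ : Type v₁} [Category.{w₁} C₁] {C₂ : Type v₂} [Category.{w₂} C₂]
  {D : Type v₃} [Category.{w₃} D]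

/-- The functor is bijective on the morphisms to `Y`. -/
def GoodObj (F : C₁ ⥤ D) (Y : C₁) : Prop :=
  ∀ X : C₁, Function.Bijective fun f : X ⟶ Y => F.map f

theorem GoodObj.of_natIso {F G : C₁ ⥤ D} {Y : C₁} (h : GoodObj F Y) (i : F ≅ G) :
    GoodObj G Y := by
  intro X
  have h1 : (fun f : X ⟶ Y => G.map f) =
      (i.app X).homCongr (i.app Y) ∘ fun f : X ⟶ Y => F.map f := funext fun f =>
    (NatIso.naturality_1 i f).symm
  rw [h1]
  exact ((i.app X).homCongr (i.app Y)).bijective.comp (h X)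

theorem GoodObj.of_comp {F : C₁ ⥤ C₂} {G : C₂ ⥤ D} [G.Full] [G.Faithful] {Y : C₁}
    (h : GoodObj (F ⋙ G) Y) : GoodObj F Y := fun X =>
  ⟨fun f g hfg => (h X).1 (congrArg G.map hfg), fun φ => by
    obtain ⟨f, hf⟩ := (h X).2 (G.map φ)
    exact ⟨f, G.map_injective hf⟩⟩

theorem GoodObj.comp {F : C₁ ⥤ C₂} {G : C₂ ⥤ D} [F.Full] [F.Faithful] {Y : C₁}
    (h : GoodObj G (F.obj Y)) : GoodObj (F ⋙ G) Y := fun X =>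
  (h (F.obj X)).comp ⟨F.map_injective, F.map_surjective⟩

theorem GoodObj.obj {F : C₁ ⥤ C₂} {G : C₂ ⥤ D} [F.IsEquivalence] {Y : C₁}
    (h : GoodObj (F ⋙ G) Y) : GoodObj G (F.obj Y) := fun X => by
  let i := F.objObjPreimageIso X
  constructor
  · intro f g hfg
    obtain ⟨f', hf⟩ := F.map_surjective (i.hom ≫ f)
    obtain ⟨g', hg⟩ := F.map_surjective (i.hom ≫ g)
    rw [← cancel_epi i.hom, ← hf, ← hg]
    refine congrArg F.map ((h _).1 ?_)
    change G.map (F.map f') = G.map (F.map g')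
    rw [hf, hg, G.map_comp, G.map_comp]
    exact congrArg _ hfg
  · intro φ
    obtain ⟨f, hf⟩ := (h _).2 (G.map i.hom ≫ φ)
    refine ⟨i.inv ≫ F.map f, ?_⟩
    change G.map (i.inv ≫ F.map f) = φ
    rw [G.map_comp]
    refine (congrArg _ hf).trans ?_
    rw [← Category.assoc, ← G.map_comp, i.inv_hom_id, G.map_id, Category.id_comp]

/-- Goodness of each object lifts one of the two mutually inverse morphisms, and injectivity on
endomorphisms gives the identities. -/
theorem GoodObj.exists_iso {F : C₁ ⥤ D} {Y Y' : C₁} (h : GoodObj F Y) (h' : GoodObj F Y')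
    (i : F.obj Y ≅ F.obj Y') : ∃ j : Y ≅ Y', F.map j.hom = i.hom := by
  obtain ⟨f, hf⟩ := (h' Y).2 i.hom
  obtain ⟨g, hg⟩ := (h Y').2 i.inv
  replace hf : F.map f = i.hom := hf
  replace hg : F.map g = i.inv := hg
  exact ⟨⟨f, g, (h Y).1 (by simp [hf, hg]), (h' Y').1 (by simp [hf, hg])⟩, hf⟩

end Good

/-! ### Right exact functors are determined by the regular module -/

section Regular

variable {R : Type u} [CommRing R] [IsNoetherianRing R]
  {C : Type v} [Category.{w} C] [Abelian C] [Linear R C]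
  {C' : Type v'} [Category.{w'} C'] [Abelian C'] [Linear R C']
  (M : ModuleModel R C)
  {F G : C ⥤ C'} [F.Additive] [F.Linear R] [PreservesFiniteColimits F]

/-- A right exact functor is a tensor product with its value at the regular module, so its values
are spanned by images of that one value under morphisms out of the regular module. Naturality along
those morphisms decides everything. -/
theorem natTrans_ext_regular (N : ModuleModel R C') {σ τ : F ⟶ G}
    (h : σ.app M.regular = τ.app M.regular) : σ = τ := by
  haveI : IsNoetherianRing M.alg := IsNoetherianRing.of_finite R M.alg
  let iF := tensorIso (A := M.alg) (A' := N.alg) (B := bimodule M N F) (modelFunctor M N F)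
    (LinearEquiv.refl _ _) (fun _ _ => rfl) (isRightExact_of_preserves _)
  have h1 : Functor.whiskerLeft M.equiv.inverse (Functor.whiskerRight σ N.equiv.functor) =
      Functor.whiskerLeft M.equiv.inverse (Functor.whiskerRight τ N.equiv.functor) := by
    rw [← cancel_epi iF.hom]
    ext X : 2
    refine FGModuleCat.hom_ext (BTensor.ext fun b x => ?_)
    have h2 : (modelFunctor M N F).map (point x) ≫ N.equiv.functor.map (σ.app _) =
        (modelFunctor M N F).map (point x) ≫ N.equiv.functor.map (τ.app _) := by
      change N.equiv.functor.map (F.map _) ≫ _ = N.equiv.functor.map (F.map _) ≫ _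
      rw [← N.equiv.functor.map_comp, ← N.equiv.functor.map_comp, σ.naturality, τ.naturality]
      exact congrArg (fun t => N.equiv.functor.map (t ≫ _)) h
    exact LinearMap.congr_fun (congrArg lin h2) b
  ext X
  have h2 : σ.app (M.equiv.inverse.obj (M.equiv.functor.obj X)) =
      τ.app (M.equiv.inverse.obj (M.equiv.functor.obj X)) :=
    N.equiv.functor.map_injective (congrArg (fun t => t.app (M.equiv.functor.obj X)) h1)
  rw [← cancel_epi (F.map (M.equiv.unitInv.app X))]
  exact (σ.naturality _).trans ((congrArg (· ≫ _) h2).trans (τ.naturality _).symm)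

/-- Compatibility with endomorphisms of the regular object makes `c` an isomorphism of bimodules.
Both functors are then the tensor product with one bimodule; the rest is transport along the unit of
the module model. -/
theorem exists_natIso (N : ModuleModel R C') [G.Additive] [G.Linear R] [PreservesFiniteColimits G]
    (c : F.obj M.regular ≅ G.obj M.regular) (hc : ∀ f, F.map f ≫ c.hom = c.hom ≫ G.map f) :
    ∃ β : F ≅ G, β.hom.app M.regular = c.hom := by
  haveI : IsNoetherianRing M.alg := IsNoetherianRing.of_finite R M.alg
  let iF := tensorIso (A := M.alg) (A' := N.alg) (B := bimodule M N F) (modelFunctor M N F)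
    (LinearEquiv.refl _ _) (fun _ _ => rfl) (isRightExact_of_preserves _)
  have he : ∀ (a : M.alg) (b : bimodule M N F),
      linEquiv (N.equiv.functor.mapIso c) (MulOpposite.op a • b) =
        lin ((modelFunctor M N G).map (rightMul M.alg a))
          (linEquiv (N.equiv.functor.mapIso c) b) := fun a b => by
    have h1 := congrArg N.equiv.functor.map (hc (M.equiv.inverse.map (rightMul M.alg a)))
    rw [Functor.map_comp, Functor.map_comp] at h1
    exact LinearMap.congr_fun (congrArg lin h1) b
  let iG := tensorIso (A := M.alg) (A' := N.alg) (B := bimodule M N F) (modelFunctor M N G)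
    (linEquiv (N.equiv.functor.mapIso c)) he (isRightExact_of_preserves _)
  let β₀ : modelFunctor M N F ≅ modelFunctor M N G := iF.symm ≪≫ iG
  have h0 : β₀.hom.app (FGModuleCat.of M.alg M.alg) = N.equiv.functor.map c.hom := by
    refine (Iso.inv_comp_eq (iF.app (FGModuleCat.of M.alg M.alg))).2 ?_
    refine FGModuleCat.hom_ext (BTensor.ext fun b a => ?_)
    have h1 := congrArg N.equiv.functor.map (hc (M.equiv.inverse.map (rightMul M.alg a)))
    rw [Functor.map_comp, Functor.map_comp] at h1
    exact (LinearMap.congr_fun (congrArg lin h1) b).symm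
  let β₁ : M.equiv.inverse ⋙ F ≅ M.equiv.inverse ⋙ G :=
    Functor.fullyFaithfulCancelRight N.equiv.functor β₀
  have h1 : β₁.hom.app (FGModuleCat.of M.alg M.alg) = c.hom :=
    N.equiv.functor.map_injective ((N.equiv.functor.map_preimage _).trans h0)
  refine ⟨NatIso.ofComponents (fun X => F.mapIso (M.equiv.unitIso.app X) ≪≫
    β₁.app (M.equiv.functor.obj X) ≪≫ G.mapIso (M.equiv.unitIso.app X).symm) ?_, ?_⟩
  · intro X Y f
    have h2 := β₁.hom.naturality (M.equiv.functor.map f)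
    have h3 := M.equiv.unit.naturality f
    have h4 := M.equiv.unitInv.naturality f
    rw [Functor.id_map] at h3 h4
    change F.map f ≫ F.map (M.equiv.unit.app Y) ≫ β₁.hom.app _ ≫ G.map (M.equiv.unitInv.app Y) =
      (F.map (M.equiv.unit.app X) ≫ β₁.hom.app _ ≫ G.map (M.equiv.unitInv.app X)) ≫ G.map f
    rw [Category.assoc, Category.assoc, ← G.map_comp, ← h4, G.map_comp, ← F.map_comp_assoc]
    rw [h3, F.map_comp_assoc]
    congr 1
    exact (Category.assoc _ _ _).symm.trans ((congrArg (· ≫ _) h2).trans (Category.assoc _ _ _))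
  · change F.map (M.equiv.unit.app _) ≫ β₁.hom.app _ ≫ G.map (M.equiv.unitInv.app _) = _
    have h2 : M.equiv.unitInv.app (M.equiv.inverse.obj (FGModuleCat.of M.alg M.alg)) =
        M.equiv.inverse.map (M.equiv.counit.app _) := by
      rw [← cancel_epi (M.equiv.unit.app (M.equiv.inverse.obj (FGModuleCat.of M.alg M.alg))),
        Equivalence.unit_inverse_comp]
      exact Iso.hom_inv_id_app _ _
    have h3 := β₁.hom.naturality (M.equiv.counit.app (FGModuleCat.of M.alg M.alg))
    have h4 := (congrArg (fun t => β₁.hom.app _ ≫ G.map t) h2).trans h3.symm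
    refine (congrArg (fun t => _ ≫ t) h4).trans ?_
    have h5 := congrArg F.map (M.equiv.unit_inverse_comp (FGModuleCat.of M.alg M.alg))
    rw [F.map_comp, F.map_id] at h5
    exact (Category.assoc _ _ _).symm.trans ((congrArg (· ≫ _) h5).trans
      ((Category.id_comp _).trans h1))

end Regular

end HighestWeight

end

noncomputable section

namespace HighestWeight

/-! ### Rouquier–Soergel functors -/

section RouquierSoergel

variable {R : Type u} [CommRing R] [IsRegularLocalRing R]
  {T : Type*} [PartialOrder T] [Finite T] {C : Type v} [Category.{w} C] [Abelian C] [Linear R C]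
  {C' : Type v'} [Category.{w'} C'] [Abelian C'] [Linear R C']
  {M : ModuleModel R C} {N : ModuleModel R C'} {Δ : T → C}
  {π : C ⥤ C'} [π.Additive] [π.Linear R] [PreservesFiniteColimits π]

theorem goodObj_of_isGood (hC : IsHighestWeight R Δ) {L : Type t₁} (e : L ≃ T) {Y : C}
    (h : BTensor.IsGood N.alg M.alg (bimodule M N π) (M.equiv.functor.obj Y)) : GoodObj π Y := by
  have h1 : GoodObj (datum M N Δ hC π e).functor (M.equiv.functor.obj Y) := fun X =>
    ⟨fun f g hfg => FGModuleCat.hom_ext (h.map_injective (congrArg lin hfg)), fun φ => by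
      obtain ⟨f, hf⟩ := h.exists_map_eq (X := X) (lin φ)
      exact ⟨mor f, FGModuleCat.hom_ext hf⟩⟩
  refine GoodObj.of_comp (G := N.equiv.functor) ((h1.comp (F := M.equiv.functor)).of_natIso ?_)
  exact Functor.isoWhiskerLeft M.equiv.functor (datumIso M N Δ hC π e) ≪≫
    Functor.isoWhiskerRight M.equiv.unitIso.symm (π ⋙ N.equiv.functor)

instance : Finite (LinearExtension T) := inferInstanceAs (Finite T)

/-- A poset is identified with its linear extension. -/
def linearExtensionEquiv (T : Type*) : LinearExtension T ≃ T := Equiv.refl T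

theorem le_of_linearExtensionEquiv (i j : LinearExtension T)
    (h : linearExtensionEquiv T i ≤ linearExtensionEquiv T j) : i ≤ j :=
  (toLinearExtension (α := T)).monotone (a := linearExtensionEquiv T i)
    (b := linearExtensionEquiv T j) h

theorem IsRouquierSoergel.goodObj_standard (hπ : IsRouquierSoergel M N π Δ)
    (hC : IsHighestWeight R Δ) (τ : T) : GoodObj π (Δ τ) := by
  let e := linearExtensionEquiv T
  have h := isRS_datum M N Δ hC π e le_of_linearExtensionEquiv hπ
  exact goodObj_of_isGood hC e
    (h.isGood' (X := M.equiv.functor.obj (Δ τ)) (FiltBy.singleton (e.symm τ)))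

theorem IsRouquierSoergel.goodObj_projective (hπ : IsRouquierSoergel M N π Δ)
    (hC : IsHighestWeight R Δ) (P : C) [Projective P] : GoodObj π P := by
  let e := linearExtensionEquiv T
  have h := isRS_datum M N Δ hC π e le_of_linearExtensionEquiv hπ
  haveI : Projective (M.equiv.functor.obj P) := (M.equiv.map_projective_iff _).2 inferInstance
  haveI := module_projective (M.equiv.functor.obj P)
  exact goodObj_of_isGood hC e (h.isGood_projective (M.equiv.functor.obj P))

end RouquierSoergel

section Comparison

variable {R : Type u} [CommRing R] [IsRegularLocalRing R]
  {T₁ : Type t₁} [PartialOrder T₁] [Finite T₁] {T₂ : Type t₂} [PartialOrder T₂] [Finite T₂]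
  {C₁ : Type v₁} [Category.{w₁} C₁] [Abelian C₁] [Linear R C₁]
  {C₂ : Type v₂} [Category.{w₂} C₂] [Abelian C₂] [Linear R C₂]
  {D : Type v₃} [Category.{w₃} D] [Abelian D] [Linear R D]
  {M₁ : ModuleModel R C₁} {M₂ : ModuleModel R C₂} {N : ModuleModel R D}
  {Δ₁ : T₁ → C₁} {Δ₂ : T₂ → C₂}
  {π₁ : C₁ ⥤ D} [π₁.Additive] [π₁.Linear R] [PreservesFiniteColimits π₁]
  {π₂ : C₂ ⥤ D} [π₂.Additive] [π₂.Linear R] [PreservesFiniteColimits π₂]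

/-- Both objects have isomorphic images under `π₂`, and both are good for it: the first because `Ψ`
carries goodness for `π₁` to goodness for `π₂`. Preservation of standard objects by `Ψ` is a
consequence, not an assumption. -/
theorem nonempty_iso_standard (hC₁ : IsHighestWeight R Δ₁) (hC₂ : IsHighestWeight R Δ₂)
    (hπ₁ : IsRouquierSoergel M₁ N π₁ Δ₁) (hπ₂ : IsRouquierSoergel M₂ N π₂ Δ₂)
    (Ψ : C₁ ≌ C₂) (η : Ψ.functor ⋙ π₂ ≅ π₁) {τ₁ : T₁} {τ₂ : T₂}
    (a : π₁.obj (Δ₁ τ₁) ≅ π₂.obj (Δ₂ τ₂)) : Nonempty (Ψ.functor.obj (Δ₁ τ₁) ≅ Δ₂ τ₂) := by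
  obtain ⟨j, -⟩ := (((hπ₁.goodObj_standard hC₁ τ₁).of_natIso η.symm).obj).exists_iso
    (hπ₂.goodObj_standard hC₂ τ₂) (η.app _ ≪≫ a)
  exact ⟨j⟩

/-- The equivalences send the regular object to projectives, on which `π₂` is fully faithful. So the
isomorphism forced by `θ` and `η` lifts uniquely at the regular object, and right exactness
propagates existence, compatibility and uniqueness to all objects. -/
theorem existsUnique_natIso (hC₂ : IsHighestWeight R Δ₂) (hπ₂ : IsRouquierSoergel M₂ N π₂ Δ₂)
    (M₁ : ModuleModel R C₁) (Φ Ψ : C₁ ≌ C₂) [Φ.functor.Additive] [Φ.functor.Linear R]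
    [Ψ.functor.Additive] [Ψ.functor.Linear R] (θ : Φ.functor ⋙ π₂ ≅ π₁)
    (η : Ψ.functor ⋙ π₂ ≅ π₁) : ∃! α : Φ.functor ≅ Ψ.functor,
      ∀ X, π₂.map (α.hom.app X) ≫ η.hom.app X = θ.hom.app X := by
  haveI := M₁.projective_regular
  haveI h1 : Projective (Φ.functor.obj M₁.regular) := (Φ.map_projective_iff _).2 inferInstance
  haveI h2 : Projective (Ψ.functor.obj M₁.regular) := (Ψ.map_projective_iff _).2 inferInstance
  have g1 := hπ₂.goodObj_projective hC₂ (Φ.functor.obj M₁.regular)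
  have g2 := hπ₂.goodObj_projective hC₂ (Ψ.functor.obj M₁.regular)
  obtain ⟨c, hc⟩ := g1.exists_iso g2 (θ.app M₁.regular ≪≫ (η.app M₁.regular).symm)
  replace hc : π₂.map c.hom = θ.hom.app M₁.regular ≫ η.inv.app M₁.regular := hc
  obtain ⟨α, hα⟩ := exists_natIso M₁ (F := Φ.functor) (G := Ψ.functor) M₂ c fun f => by
    refine (g2 _).1 ?_
    change π₂.map _ = π₂.map _
    rw [π₂.map_comp, π₂.map_comp, hc]
    have h3 := θ.hom.naturality f
    have h4 := η.inv.naturality f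
    rw [Functor.comp_map] at h3 h4
    rw [Category.assoc, ← h4, reassoc_of% h3]
  refine ⟨α, fun X => ?_, fun β hβ => ?_⟩
  · have h3 : Functor.whiskerRight α.hom π₂ ≫ η.hom = θ.hom :=
      natTrans_ext_regular M₁ (F := Φ.functor ⋙ π₂) N (by
        change π₂.map (α.hom.app M₁.regular) ≫ η.hom.app M₁.regular = _
        rw [hα, hc, Category.assoc, Iso.inv_hom_id_app]
        exact Category.comp_id _)
    exact congrArg (fun t => t.app X) h3
  · refine Iso.ext (natTrans_ext_regular M₁ M₂ ((g2 _).1 ?_))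
    change π₂.map _ = π₂.map _
    rw [hα, hc, ← hβ, Category.assoc, Iso.hom_inv_id_app]
    exact (Category.comp_id _).symm

theorem exists_equivalence (hC₁ : IsHighestWeight R Δ₁) (hC₂ : IsHighestWeight R Δ₂)
    (hπ₁ : IsRouquierSoergel M₁ N π₁ Δ₁) (hπ₂ : IsRouquierSoergel M₂ N π₂ Δ₂)
    (ι : T₁ ≃ T₂) (hι : Monotone ι) (ha : ∀ τ, Nonempty (π₁.obj (Δ₁ τ) ≅ π₂.obj (Δ₂ (ι τ))))
    (hb : ∀ (p : Ideal R) [p.IsPrime], p.height = 1 →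
      stdImage M₁ N π₁ Δ₁ (Localization.AtPrime p) =
        stdImage M₂ N π₂ Δ₂ (Localization.AtPrime p)) :
    ∃ Φ : C₁ ≌ C₂, Φ.functor.Additive ∧ Φ.functor.Linear R ∧
      Nonempty (Φ.functor ⋙ π₂ ≅ π₁) := by
  let e₂ := linearExtensionEquiv T₂
  -- A linear extension of the second poset labels both families. Monotonicity of `ι` ensures that
  -- it also refines the order of the first poset.
  let e₁ : LinearExtension T₂ ≃ T₁ := e₂.trans ι.symm
  have he₁ : ∀ i, ι (e₁ i) = e₂ i := fun i => ι.apply_symm_apply _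
  have ha' : ∀ i, Nonempty (π₁.obj (Δ₁ (e₁ i)) ≅ π₂.obj (Δ₂ (e₂ i))) := fun i => he₁ i ▸ ha (e₁ i)
  obtain ⟨Φ, _, _, ⟨θ⟩⟩ := (isRS_datum M₁ N Δ₁ hC₁ π₁ e₁ (fun i j h =>
      le_of_linearExtensionEquiv i j (by
        have h1 := hι h
        rwa [he₁, he₁] at h1)) hπ₁).exists_equivalence
    (isRS_datum M₂ N Δ₂ hC₂ π₂ e₂ le_of_linearExtensionEquiv hπ₂)
    (matches_datum hC₁ hC₂ π₁ π₂ e₁ e₂ ha' hb)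
    (matches_datum hC₂ hC₁ π₂ π₁ e₂ e₁ (fun i => ⟨(ha' i).some.symm⟩)
      fun p _ hp => (hb p hp).symm)
  let Φ' : FGModuleCat.{u} M₁.alg ≌ FGModuleCat.{u} M₂.alg := Φ
  haveI : Φ'.functor.Additive := ‹Φ.functor.Additive›
  haveI : Φ'.functor.Linear R := ‹Φ.functor.Linear R›
  refine ⟨M₁.equiv.trans (Φ'.trans M₂.equiv.symm),
    inferInstanceAs (M₁.equiv.functor ⋙ Φ'.functor ⋙ M₂.equiv.inverse).Additive,
    inferInstanceAs ((M₁.equiv.functor ⋙ Φ'.functor ⋙ M₂.equiv.inverse).Linear R),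
    ⟨Functor.fullyFaithfulCancelRight N.equiv.functor ?_⟩⟩
  exact Functor.isoWhiskerLeft M₁.equiv.functor
      (Functor.isoWhiskerLeft Φ'.functor (datumIso M₂ N Δ₂ hC₂ π₂ e₂).symm ≪≫ θ ≪≫
        datumIso M₁ N Δ₁ hC₁ π₁ e₁) ≪≫
    Functor.isoWhiskerRight M₁.equiv.unitIso.symm (π₁ ⋙ N.equiv.functor)

end Comparison

end HighestWeight

end

theorem theorem3p9
    {R : Type u} [CommRing R] [IsRegularLocalRing R]
    {T₁ : Type t₁} [PartialOrder T₁] [Finite T₁] {T₂ : Type t₂} [PartialOrder T₂] [Finite T₂]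
    {C₁ : Type v₁} [Category.{w₁} C₁] [Abelian C₁] [Linear R C₁]
    {C₂ : Type v₂} [Category.{w₂} C₂] [Abelian C₂] [Linear R C₂]
    {D : Type v₃} [Category.{w₃} D] [Abelian D] [Linear R D]
    (M₁ : HighestWeight.ModuleModel R C₁) [Module.Projective R M₁.alg]
    (M₂ : HighestWeight.ModuleModel R C₂) [Module.Projective R M₂.alg]
    (N : HighestWeight.ModuleModel R D)
    (Δ₁ : T₁ → C₁) (Δ₂ : T₂ → C₂)
    (hC₁ : HighestWeight.IsHighestWeight R Δ₁) (hC₂ : HighestWeight.IsHighestWeight R Δ₂)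
    (π₁ : C₁ ⥤ D) [π₁.Additive] [π₁.Linear R] [PreservesFiniteColimits π₁]
    (π₂ : C₂ ⥤ D) [π₂.Additive] [π₂.Linear R] [PreservesFiniteColimits π₂]
    (hπ₁ : HighestWeight.IsRouquierSoergel M₁ N π₁ Δ₁)
    (hπ₂ : HighestWeight.IsRouquierSoergel M₂ N π₂ Δ₂)
    (ι : T₁ ≃ T₂) (hι : Monotone ι)
    (ha : ∀ τ, Nonempty (π₁.obj (Δ₁ τ) ≅ π₂.obj (Δ₂ (ι τ))))
    (hb : ∀ (p : Ideal R) [p.IsPrime], p.height = 1 →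
      HighestWeight.stdImage M₁ N π₁ Δ₁ (Localization.AtPrime p) =
        HighestWeight.stdImage M₂ N π₂ Δ₂ (Localization.AtPrime p)) :
    ∃ (Φ : C₁ ≌ C₂) (θ : Φ.functor ⋙ π₂ ≅ π₁),
      HighestWeight.IsHWEquivalence R Δ₁ Δ₂ Φ ∧
      (∀ τ, Nonempty (Φ.functor.obj (Δ₁ τ) ≅ Δ₂ (ι τ))) ∧
      ∀ (Ψ : C₁ ≌ C₂) (η : Ψ.functor ⋙ π₂ ≅ π₁), HighestWeight.IsHWEquivalence R Δ₁ Δ₂ Ψ →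
        (∃! α : Φ.functor ≅ Ψ.functor,
          ∀ X, π₂.map (α.hom.app X) ≫ η.hom.app X = θ.hom.app X) ∧
        ∀ τ, Nonempty (Ψ.functor.obj (Δ₁ τ) ≅ Δ₂ (ι τ)) := by
  obtain ⟨Φ, h₁, h₂, ⟨θ⟩⟩ :=
    HighestWeight.exists_equivalence hC₁ hC₂ hπ₁ hπ₂ ι hι ha hb
  have hΔ : ∀ (Ψ : C₁ ≌ C₂) (_ : Ψ.functor ⋙ π₂ ≅ π₁) (τ : T₁),
      Nonempty (Ψ.functor.obj (Δ₁ τ) ≅ Δ₂ (ι τ)) := fun Ψ η τ =>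
    HighestWeight.nonempty_iso_standard hC₁ hC₂ hπ₁ hπ₂ Ψ η (ha τ).some
  refine ⟨Φ, θ, ⟨h₁, h₂, fun τ => ⟨ι τ, hΔ Φ θ τ⟩⟩, hΔ Φ θ, fun Ψ η hΨ => ⟨?_, hΔ Ψ η⟩⟩
  haveI := hΨ.1
  haveI := hΨ.2.1
  exact HighestWeight.existsUnique_natIso hC₂ hπ₂ M₁ Φ Ψ θ η
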